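/- **Conventions.** $C^*$-algebras are complex and need not be unital. For a $C^*$-algebra $B$ put $IB=C([0,1],B)$, with evaluations $\mathrm{ev}_t:IB\to B$, and $\mathfrak A B=C_b([0,\infty),B)/C_0([0,\infty),B)$, with the natural map $\alpha_B:B\to\mathfrak A B$ that sends $b$ to the class of the constant function $b$; put $\mathfrak A^0B=B$ and $\mathfrak A^{n+1}B=\mathfrak A(\mathfrak A^nB)$. Let $\mathbb K B$ be the closure, in the adjointable operators $\mathcal L_B(\ell^2(\mathbb N,B))$, of the set of $\mathbb N\times\mathbb N$-matrices with entries in $B$ only finitely many of which are non-zero. Let $X$ be a metric space of bounded geometry (for every $R>0$ the cardinalities of the balls of radius $R$ in $X$ are uniformly bounded; in particular $X$ is discrete and countable), and let $X_0\subset X$ be a subset, possibly empty. Let $\mathfrak M^u_XB$ be the closure, in $\mathcal L_B(\ell^2(X,B))$, of the set of $X\times X$-matrices $(m_{x,y})$ with entries in $B$ such that $\sup_{x,y}\|m_{x,y}\|<\infty$ and $\sup\{d(x,y): m_{x,y}\neq0\}<\infty$. Let $\mathfrak M^u_{X\supset X_0}B\subset\mathfrak M^u_XB$ be the closed ideal obtained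 as the closure of the set of those $m\in\mathfrak M^u_XB$ for which there is an $R>0$ such that $m_{x,y}\ne0$ implies $d(x,X_0)<R$ and $d(y,X_0)<R$ (where $d(x,\emptyset)=\infty$), and let $\mathfrak N^u_{X,X_0}B=\mathfrak M^u_XB/\mathfrak M^u_{X\supset X_0}B$. All these constructions are functors: a $*$-homomorphism is applied pointwise, respectively entrywise. For an endofunctor $F$ of the category of $C^*$-algebras, two $*$-homomorphisms $\varphi_0,\varphi_1:A\to FB$ are called $F$-homotopic if there is a $*$-homomorphism $\Phi:A\to F(IB)$ with $F(\mathrm{ev}_j)\circ\Phi=\varphi_j$ for $j=0,1$. For the functors $F=\mathfrak N^u_{X,X_0}\mathfrak A^n\mathbb K$, $n\ge0$, this is an equivalence relation, and $[A,F,B]$ denotes the set of classes. It is a commutative monoid: the neutral element is the class of the zero homomorphism, and the sum of the classes of $\varphi$ and $\psi$ is the class of the composition $$A\xrightarrow{(\varphi,\psi)}G\mathbb KB\oplus G\mathbb KB\cong G(\mathbb KB\oplus\mathbb KB)\xrightarrow{G(\mu_B)}G\mathbb KB,\qquad G=\mathfrak N^u_{X,X_0}\mathfrak A^n,$$ where $\mu_B(S,T)=V_0SV_0^*+V_1TV_1^*$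 and $V_0$, $V_1$ are the isometries $e_i\mapsto e_{2i}$ and $e_i\mapsto e_{2i+1}$ of $\ell^2(\mathbb N,B)$. The formula $[\varphi]\mapsto[\mathfrak N^u_{X,X_0}(\alpha_{\mathfrak A^n\mathbb KB})\circ\varphi]$ gives a well-defined monoid homomorphism $$\tau_n:[A,\mathfrak N^u_{X,X_0}\mathfrak A^n\mathbb K,B]\to[A,\mathfrak N^u_{X,X_0}\mathfrak A^{n+1}\mathbb K,B].$$ **Theorem.** Let $A$ and $B$ be $C^*$-algebras with $A$ separable, and let $X$ be a metric space of bounded geometry with a subset $X_0\subset X$. Then for every $n\ge1$ the map $\tau_n$ is an isomorphism of monoids. Consequently, the canonical map $$[A,\mathfrak N^u_{X,X_0}\mathfrak A\mathbb K,B]\to\operatorname*{colim}_{n\ge1}\,[A,\mathfrak N^u_{X,X_0}\mathfrak A^n\mathbb K,B],$$ where the colimit is taken along $\tau_1,\tau_2,\dots$, is an isomorphism of monoids. -/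

import Mathlib

universe u v

open Filter Topology

noncomputable section

namespace RoeAsym

section Quotient

/-- A closed two-sided ideal of a C⋆-algebra. (Such an ideal is automatically closed under the
involution.) -/
structure CStarIdeal (A : Type*) [NonUnitalCStarAlgebra A] extends Submodule ℂ A where
  isClosed' : IsClosed (carrier : Set A)
  mul_left_mem : ∀ (a : A) {j : A}, j ∈ carrier → a * j ∈ carrier
  mul_right_mem : ∀ (a : A) {j : A}, j ∈ carrier → j * a ∈ carrier
  star_mem' : ∀ {j : A}, j ∈ carrier → star j ∈ carrier

variable {A : Type*} [NonUnitalCStarAlgebra A]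

/-- An ideal as a `⋆`-subalgebra. -/
def CStarIdeal.toSubalg (J : CStarIdeal A) : NonUnitalStarSubalgebra ℂ A where
  carrier := J.carrier
  add_mem' := J.add_mem'
  zero_mem' := J.zero_mem'
  mul_mem' := fun {a _} _ hb => J.mul_left_mem a hb
  smul_mem' := J.smul_mem'
  star_mem' := J.star_mem'

theorem CStarIdeal.exists_approx (J : CStarIdeal A) {j : A} (hj : j ∈ J.toSubmodule) {ε : ℝ}
    (hε : 0 < ε) : ∃ u ∈ J.toSubmodule, ‖j - j * u‖ < ε ∧ ∀ a : A, ‖a - a * u‖ ≤ ‖a‖ ∧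
      ‖star (a - a * u) * (a - a * u)‖ ≤ ‖star a * a - star a * a * u‖ := by
  have : IsClosed (J.toSubalg : Set A) := J.isClosed'
  let _ := CStarAlgebra.spectralOrder J.toSubalg
  have := CStarAlgebra.spectralOrderedRing J.toSubalg
  let _ := CStarAlgebra.spectralOrder A
  have := CStarAlgebra.spectralOrderedRing A
  have hl := CStarAlgebra.increasingApproximateUnit J.toSubalg
  have h1 := hl.tendsto_mul_left ⟨j, hj⟩
  have h2 := (Metric.tendsto_nhds.mp h1) ε hε
  obtain ⟨u, hu, hu0, hu1⟩ := (h2.and (hl.eventually_nonneg.and hl.eventually_norm)).exists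
  have hu0' : (0 : A) ≤ (u : A) := by
    obtain ⟨s, rfl⟩ := CStarAlgebra.nonneg_iff_eq_star_mul_self.mp hu0
    exact star_mul_self_nonneg (s : A)
  set w : Unitization ℂ A := 1 - ((u : A) : Unitization ℂ A) with hw
  have hU0 : (0 : Unitization ℂ A) ≤ ((u : A) : Unitization ℂ A) := by
    rwa [Unitization.inr_nonneg_iff]
  have hU1 : ((u : A) : Unitization ℂ A) ≤ 1 := by
    rw [← CStarAlgebra.norm_le_one_iff_of_nonneg _ hU0, Unitization.norm_inr]
    exact hu1
  have hw1 : ‖w‖ ≤ 1 := by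
    rw [CStarAlgebra.norm_le_one_iff_of_nonneg _ (sub_nonneg.mpr hU1)]
    simpa [hw] using hU0
  have hws : star w = w := by
    simp [hw, (IsSelfAdjoint.of_nonneg hU0).star_eq]
  have key : ∀ a : A, ((a - a * u : A) : Unitization ℂ A) = (a : Unitization ℂ A) * w := by
    intro a; simp [hw, mul_sub]
  refine ⟨u, u.2, ?_, fun a => ⟨?_, ?_⟩⟩
  · have : ‖j * (u : A) - j‖ < ε := by simpa [dist_eq_norm] using hu
    rwa [norm_sub_rev]
  · rw [← Unitization.norm_inr (𝕜 := ℂ), key, ← Unitization.norm_inr (𝕜 := ℂ) a]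
    calc _ ≤ _ := norm_mul_le _ _
      _ ≤ _ := mul_le_of_le_one_right (norm_nonneg _) hw1
  · rw [← Unitization.norm_inr (𝕜 := ℂ), ← Unitization.norm_inr (𝕜 := ℂ) (star a * a - _), key,
      Unitization.inr_mul, Unitization.inr_star, key, star_mul, hws, Unitization.inr_mul,
      Unitization.inr_star]
    calc ‖w * star (a : Unitization ℂ A) * (a * w)‖
        = ‖w * (star (a : Unitization ℂ A) * a * w)‖ := by simp only [mul_assoc]
      _ ≤ _ := norm_mul_le _ _
      _ ≤ _ := mul_le_of_le_one_left (norm_nonneg _) hw1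

/-- The quotient C⋆-algebra. -/
def CStarIdeal.Quot (J : CStarIdeal A) : Type _ := A ⧸ J.toSubmodule

namespace CStarIdeal.Quot
variable (J : CStarIdeal A)

instance : IsClosed (J.toSubmodule : Set A) := J.isClosed'

instance : NormedAddCommGroup J.Quot := inferInstanceAs (NormedAddCommGroup (A ⧸ J.toSubmodule))
instance : NormedSpace ℂ J.Quot := inferInstanceAs (NormedSpace ℂ (A ⧸ J.toSubmodule))
instance : CompleteSpace J.Quot := inferInstanceAs (CompleteSpace (A ⧸ J.toSubmodule))

/-- The quotient map as a linear map. -/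
def mkₗ : A →ₗ[ℂ] J.Quot := J.toSubmodule.mkQ

theorem mkₗ_surjective : Function.Surjective (mkₗ J) := J.toSubmodule.mkQ_surjective

theorem mkₗ_eq_iff {a b : A} : mkₗ J a = mkₗ J b ↔ a - b ∈ J.toSubmodule :=
  Submodule.Quotient.eq _

theorem norm_mkₗ_le (a : A) : ‖mkₗ J a‖ ≤ ‖a‖ := Submodule.Quotient.norm_mk_le _ a

theorem exists_norm_lt (x : J.Quot) {ε : ℝ} (hε : 0 < ε) : ∃ a, mkₗ J a = x ∧ ‖a‖ < ‖x‖ + ε :=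
  Submodule.Quotient.norm_mk_lt (S := J.toSubmodule) x hε

instance : Mul J.Quot where
  mul := Quotient.map₂ (· * ·) (by
    intro a a' h b b' h'
    rw [← Quotient.eq_iff_equiv] at *
    have h := (mkₗ_eq_iff J).1 h
    have h' := (mkₗ_eq_iff J).1 h'
    refine (mkₗ_eq_iff J).2 ?_
    have : a * b - a' * b' = (a - a') * b + a' * (b - b') := by noncomm_ring
    change a * b - a' * b' ∈ _
    rw [this]
    exact J.add_mem (J.mul_right_mem _ h) (J.mul_left_mem _ h'))

instance : Star J.Quot where
  star := Quotient.map star (by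
    intro a a' h
    rw [← Quotient.eq_iff_equiv] at *
    have h := (mkₗ_eq_iff J).1 h
    refine (mkₗ_eq_iff J).2 ?_
    rw [← star_sub]
    exact J.star_mem' h)

theorem mkₗ_mul (a b : A) : mkₗ J (a * b) = mkₗ J a * mkₗ J b := rfl
theorem mkₗ_star (a : A) : mkₗ J (star a) = star (mkₗ J a) := rfl

theorem norm_cstar (x : J.Quot) : ‖x‖ * ‖x‖ ≤ ‖star x * x‖ := by
  obtain ⟨a, rfl⟩ := mkₗ_surjective J x
  refine le_of_forall_pos_le_add fun ε hε => ?_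
  obtain ⟨c, hc, hlt⟩ := exists_norm_lt J (star (mkₗ J a) * mkₗ J a) (half_pos hε)
  have hj : star a * a - c ∈ J.toSubmodule := by
    rw [← mkₗ_eq_iff, hc]; rfl
  obtain ⟨u, huJ, hu1, hu2⟩ := J.exists_approx hj (half_pos hε)
  have hq : mkₗ J a = mkₗ J (a - a * u) := by
    rw [mkₗ_eq_iff]; simpa using J.mul_left_mem a huJ
  calc ‖mkₗ J a‖ * ‖mkₗ J a‖ ≤ ‖a - a * u‖ * ‖a - a * u‖ := by
        rw [hq]; gcongr <;> exact norm_mkₗ_le J _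
    _ = ‖star (a - a * u) * (a - a * u)‖ := (CStarRing.norm_star_mul_self).symm
    _ ≤ ‖star a * a - star a * a * u‖ := (hu2 a).2
    _ = ‖((star a * a - c) - (star a * a - c) * u) + (c - c * u)‖ := by
        congr 1; noncomm_ring
    _ ≤ ε / 2 + ‖c‖ := (norm_add_le _ _).trans (add_le_add hu1.le (hu2 c).1)
    _ ≤ _ := by linarith

instance : NonUnitalNormedRing J.Quot where
  __ := (inferInstance : NormedAddCommGroup J.Quot)
  mul_assoc x y z := by
    obtain ⟨a, rfl⟩ := mkₗ_surjective J x
    obtain ⟨b, rfl⟩ := mkₗ_surjective J y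
    obtain ⟨c, rfl⟩ := mkₗ_surjective J z
    simp only [← mkₗ_mul, mul_assoc]
  left_distrib x y z := by
    obtain ⟨a, rfl⟩ := mkₗ_surjective J x
    obtain ⟨b, rfl⟩ := mkₗ_surjective J y
    obtain ⟨c, rfl⟩ := mkₗ_surjective J z
    simp only [← mkₗ_mul, ← map_add, mul_add]
  right_distrib x y z := by
    obtain ⟨a, rfl⟩ := mkₗ_surjective J x
    obtain ⟨b, rfl⟩ := mkₗ_surjective J y
    obtain ⟨c, rfl⟩ := mkₗ_surjective J z
    simp only [← mkₗ_mul, ← map_add, add_mul]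
  zero_mul x := by
    obtain ⟨a, rfl⟩ := mkₗ_surjective J x
    rw [← map_zero (mkₗ J), ← mkₗ_mul, zero_mul]
  mul_zero x := by
    obtain ⟨a, rfl⟩ := mkₗ_surjective J x
    rw [← map_zero (mkₗ J), ← mkₗ_mul, mul_zero]
  norm_mul_le x y := by
    have h : ∀ ε > 0, ‖x * y‖ ≤ (‖x‖ + ε) * (‖y‖ + ε) := by
      intro ε hε
      obtain ⟨a, rfl, ha⟩ := exists_norm_lt J x hε
      obtain ⟨b, rfl, hb⟩ := exists_norm_lt J y hε
      rw [← mkₗ_mul]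
      calc _ ≤ ‖a * b‖ := norm_mkₗ_le J _
        _ ≤ ‖a‖ * ‖b‖ := norm_mul_le _ _
        _ ≤ _ := by gcongr
    have ht : Tendsto (fun ε : ℝ => (‖x‖ + ε) * (‖y‖ + ε)) (𝓝[>] 0) (𝓝 (‖x‖ * ‖y‖)) := by
      have : Continuous (fun ε : ℝ => (‖x‖ + ε) * (‖y‖ + ε)) := by fun_prop
      simpa using (this.tendsto 0).mono_left nhdsWithin_le_nhds
    exact ge_of_tendsto ht (eventually_nhdsWithin_of_forall h)

instance : StarRing J.Quot where
  star_involutive x := by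
    obtain ⟨a, rfl⟩ := mkₗ_surjective J x
    simp only [← mkₗ_star, star_star]
  star_mul x y := by
    obtain ⟨a, rfl⟩ := mkₗ_surjective J x
    obtain ⟨b, rfl⟩ := mkₗ_surjective J y
    simp only [← mkₗ_star, ← mkₗ_mul, star_mul]
  star_add x y := by
    obtain ⟨a, rfl⟩ := mkₗ_surjective J x
    obtain ⟨b, rfl⟩ := mkₗ_surjective J y
    simp only [← mkₗ_star, ← map_add, star_add]

instance : NonUnitalCStarAlgebra J.Quot where
  norm_mul_self_le := norm_cstar J
  smul_assoc c x y := by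
    obtain ⟨a, rfl⟩ := mkₗ_surjective J x
    obtain ⟨b, rfl⟩ := mkₗ_surjective J y
    simp only [smul_eq_mul, ← mkₗ_mul, ← map_smul, smul_mul_assoc]
  smul_comm c x y := by
    obtain ⟨a, rfl⟩ := mkₗ_surjective J x
    obtain ⟨b, rfl⟩ := mkₗ_surjective J y
    simp only [smul_eq_mul, ← mkₗ_mul, ← map_smul, mul_smul_comm]
  star_smul c x := by
    obtain ⟨a, rfl⟩ := mkₗ_surjective J x
    simp only [← mkₗ_star, ← map_smul, star_smul]

/-- The quotient projection. -/
def mk : A →⋆ₙₐ[ℂ] J.Quot where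
  toFun := mkₗ J
  map_smul' := map_smul (mkₗ J)
  map_zero' := map_zero (mkₗ J)
  map_add' := map_add (mkₗ J)
  map_mul' := mkₗ_mul J
  map_star' := mkₗ_star J

theorem mk_surjective : Function.Surjective (mk J) := mkₗ_surjective J

theorem mk_eq_iff {a b : A} : mk J a = mk J b ↔ a - b ∈ J.toSubmodule := mkₗ_eq_iff J

variable {J} {B : Type*} [NonUnitalCStarAlgebra B] {K : CStarIdeal B}

/-- The map of quotients induced by a `⋆`-homomorphism carrying one ideal into the other. -/
def map (φ : A →⋆ₙₐ[ℂ] B) (h : ∀ a ∈ J.toSubmodule, φ a ∈ K.toSubmodule) :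
    J.Quot →⋆ₙₐ[ℂ] K.Quot :=
  let f : J.Quot → K.Quot := Quotient.lift (fun a => mk K (φ a)) (by
    intro a b hab
    rw [← Quotient.eq_iff_equiv] at hab
    have := (mk_eq_iff J).1 hab
    rw [mk_eq_iff, ← map_sub]
    exact h _ this)
  have hf : ∀ a, f (mk J a) = mk K (φ a) := fun _ => rfl
  { toFun := f
    map_smul' := fun c x => by
      obtain ⟨a, rfl⟩ := mk_surjective J x
      simp only [← map_smul, hf, MonoidHom.id_apply]
    map_zero' := by rw [← map_zero (mk J), hf, map_zero, map_zero]
    map_add' := fun x y => by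
      obtain ⟨a, rfl⟩ := mk_surjective J x
      obtain ⟨b, rfl⟩ := mk_surjective J y
      simp only [← map_add, hf]
    map_mul' := fun x y => by
      obtain ⟨a, rfl⟩ := mk_surjective J x
      obtain ⟨b, rfl⟩ := mk_surjective J y
      simp only [← map_mul, hf]
    map_star' := fun x => by
      obtain ⟨a, rfl⟩ := mk_surjective J x
      simp only [← map_star, hf] }

@[simp] theorem map_mk (φ : A →⋆ₙₐ[ℂ] B) (h : ∀ a ∈ J.toSubmodule, φ a ∈ K.toSubmodule) (a : A) :
    map φ h (mk J a) = mk K (φ a) := rfl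

end CStarIdeal.Quot
end Quotient

section HilbertModule

section Order

variable {B : Type*} [NonUnitalCStarAlgebra B] [PartialOrder B] [StarOrderedRing B]

theorem star_add_mul_add_le (a b : B) :
    star (a + b) * (a + b) ≤ (2 : ℝ) • (star a * a) + (2 : ℝ) • (star b * b) := by
  have h := star_mul_self_nonneg (a - b)
  rw [← sub_nonneg]
  convert h using 1
  rw [two_smul, two_smul, star_add, star_sub]
  noncomm_ring

theorem summable_of_le_of_nonneg {ι : Type*} {f g : ι → B} (h0 : ∀ i, 0 ≤ f i)
    (h : ∀ i, f i ≤ g i) (hg : Summable g) : Summable f := by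
  rw [summable_iff_vanishing_norm] at hg ⊢
  intro ε hε
  obtain ⟨s, hs⟩ := hg ε hε
  refine ⟨s, fun t ht => lt_of_le_of_lt ?_ (hs t ht)⟩
  exact CStarAlgebra.norm_le_norm_of_nonneg_of_le (Finset.sum_nonneg fun i _ => h0 i)
    (Finset.sum_le_sum fun i _ => h i)

theorem norm_sum_le_norm_tsum {ι : Type*} {f : ι → B} (h0 : ∀ i, 0 ≤ f i) (hf : Summable f)
    (t : Finset ι) : ‖∑ i ∈ t, f i‖ ≤ ‖∑' i, f i‖ :=
  CStarAlgebra.norm_le_norm_of_nonneg_of_le (Finset.sum_nonneg fun i _ => h0 i)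
    (hf.sum_le_tsum t fun i _ => h0 i)

end Order

variable (X : Type*) (B : Type*) [NonUnitalCStarAlgebra B]

/-- The functions `ξ : X → B` for which `∑ₓ ξ(x)⋆ ξ(x)` converges in norm. -/
def l2Submodule : Submodule ℂ (X → B) where
  carrier := {ξ | Summable fun x => star (ξ x) * ξ x}
  zero_mem' := by simp [summable_zero]
  add_mem' := fun {ξ η} hξ hη => by
    let _ := CStarAlgebra.spectralOrder B
    have := CStarAlgebra.spectralOrderedRing B
    exact summable_of_le_of_nonneg (fun x => star_mul_self_nonneg _)
      (fun x => star_add_mul_add_le (ξ x) (η x)) ((hξ.const_smul (2 : ℝ)).add (hη.const_smul (2 : ℝ)))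
  smul_mem' := fun c ξ hξ => by
    have : (fun x => star ((c • ξ) x) * (c • ξ) x) = fun x => (star c * c) • (star (ξ x) * ξ x) := by
      funext x; simp [smul_mul_smul_comm]
    simp only [Set.mem_ofPred_eq, this]
    exact hξ.const_smul _

/-- The standard Hilbert `B`-module `ℓ²(X, B)`. -/
def L2 : Type _ := l2Submodule X B

namespace L2

variable {X B}

/-- The element of `ℓ²(X, B)` given by a function. -/
def mk (ξ : X → B) (h : Summable fun x => star (ξ x) * ξ x) : L2 X B := ⟨ξ, h⟩

@[simp] theorem mk_val (ξ : X → B) (h : Summable fun x => star (ξ x) * ξ x) : (mk ξ h).1 = ξ := rfl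

instance : AddCommGroup (L2 X B) := inferInstanceAs (AddCommGroup (l2Submodule X B))
instance : Module ℂ (L2 X B) := inferInstanceAs (Module ℂ (l2Submodule X B))

@[ext] theorem ext {ξ η : L2 X B} (h : ∀ x, ξ.1 x = η.1 x) : ξ = η := Subtype.ext (funext h)

@[simp] theorem add_val (ξ η : L2 X B) (x : X) : (ξ + η).1 x = ξ.1 x + η.1 x := rfl
@[simp] theorem sub_val (ξ η : L2 X B) (x : X) : (ξ - η).1 x = ξ.1 x - η.1 x := rfl
@[simp] theorem neg_val (ξ : L2 X B) (x : X) : (-ξ).1 x = -ξ.1 x := rfl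
@[simp] theorem zero_val (x : X) : (0 : L2 X B).1 x = 0 := rfl
@[simp] theorem smul_val (c : ℂ) (ξ : L2 X B) (x : X) : (c • ξ).1 x = c • ξ.1 x := rfl

theorem summable_self (ξ : L2 X B) : Summable fun x => star (ξ.1 x) * ξ.1 x := ξ.2

theorem summable_inner (ξ η : L2 X B) : Summable fun x => star (ξ.1 x) * η.1 x := by
  have e : (fun x => star (ξ.1 x) * η.1 x) = fun x =>
      ((1 / 4 : ℂ) • (star ((ξ + η).1 x) * (ξ + η).1 x - star ((ξ - η).1 x) * (ξ - η).1 x)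
        - (Complex.I / 4) • (star ((ξ + Complex.I • η).1 x) * (ξ + Complex.I • η).1 x
          - star ((ξ - Complex.I • η).1 x) * (ξ - Complex.I • η).1 x)) := by
    funext x
    simp only [add_val, sub_val, smul_val, star_add, star_sub, star_smul, Complex.star_def,
      Complex.conj_I, add_mul, mul_add, sub_mul, mul_sub, smul_mul_assoc, mul_smul_comm]
    match_scalars <;> ring_nf <;> simp <;> norm_num
  rw [e]
  exact (((summable_self (ξ + η)).sub (summable_self (ξ - η))).const_smul _).sub
    (((summable_self (ξ + Complex.I • η)).sub (summable_self (ξ - Complex.I • η))).const_smul _)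

/-- The `B`-valued inner product `⟨ξ, η⟩ = ∑ₓ ξ(x)⋆ η(x)`. -/
def ip (ξ η : L2 X B) : B := ∑' x, star (ξ.1 x) * η.1 x

instance : Norm (L2 X B) where
  norm ξ := √‖ip ξ ξ‖

theorem norm_def (ξ : L2 X B) : ‖ξ‖ = √‖ip ξ ξ‖ := rfl

theorem ip_add_right (ξ η ζ : L2 X B) : ip ξ (η + ζ) = ip ξ η + ip ξ ζ := by
  simp only [ip, ← (summable_inner ξ η).tsum_add (summable_inner ξ ζ)]
  simp [mul_add]

theorem ip_smul_right (c : ℂ) (ξ η : L2 X B) : ip ξ (c • η) = c • ip ξ η := by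
  rw [ip, ip, ← (summable_inner ξ η).tsum_const_smul]
  exact tsum_congr fun x => by rw [smul_val, mul_smul_comm]

theorem star_ip (ξ η : L2 X B) : star (ip ξ η) = ip η ξ := by
  simp only [ip, tsum_star]
  simp

theorem mul_mem_right (ξ : L2 X B) (b : B) : Summable fun x => star (ξ.1 x * b) * (ξ.1 x * b) := by
  have := ((summable_self ξ).mul_left (star b)).mul_right b
  refine this.congr fun x => ?_
  simp [mul_assoc]

/-- The right action of `B`, written as a left action of the opposite algebra. -/
instance : SMul Bᵐᵒᵖ (L2 X B) where
  smul b ξ := mk (fun x => ξ.1 x * b.unop) (mul_mem_right ξ _)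

theorem ip_op_smul_right (b : Bᵐᵒᵖ) (ξ η : L2 X B) : ip ξ (b • η) = ip ξ η * b.unop := by
  rw [ip, ip, ← (summable_inner ξ η).tsum_mul_right]
  exact tsum_congr fun x => (mul_assoc _ _ _).symm

theorem ip_self_eq_zero {ξ : L2 X B} (h : ip ξ ξ = 0) : ξ = 0 := by
  let _ := CStarAlgebra.spectralOrder B
  have := CStarAlgebra.spectralOrderedRing B
  ext x
  have h1 := norm_sum_le_norm_tsum (fun x => star_mul_self_nonneg (ξ.1 x)) (summable_self ξ) {x}
  change _ ≤ ‖ip ξ ξ‖ at h1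
  rw [h, norm_zero, Finset.sum_singleton, norm_le_zero_iff, CStarRing.star_mul_self_eq_zero_iff] at h1
  exact h1

/-- The module axioms in the convention of `CStarModule`. -/
@[reducible] def cstarModule [PartialOrder Bᵐᵒᵖ] [StarOrderedRing Bᵐᵒᵖ] :
    CStarModule Bᵐᵒᵖ (L2 X B) where
  inner ξ η := MulOpposite.op (ip ξ η)
  inner_add_right := by simp [ip_add_right]
  inner_self_nonneg {ξ} := by
    have : HasSum (fun x => MulOpposite.op (star (ξ.1 x) * ξ.1 x)) (MulOpposite.op (ip ξ ξ)) :=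
      (summable_self ξ).hasSum.op
    rw [← this.tsum_eq]
    exact tsum_nonneg fun x => by
      rw [MulOpposite.op_mul, MulOpposite.op_star]
      exact mul_star_self_nonneg _
  inner_self {ξ} := by
    constructor
    · intro h; exact ip_self_eq_zero (by simpa using h)
    · rintro rfl; simp [ip]
  inner_op_smul_right {b ξ η} := by
    rw [ip_op_smul_right, MulOpposite.op_mul, MulOpposite.op_unop]
  inner_smul_right_complex := by simp [ip_smul_right]
  star_inner ξ η := by rw [← star_ip ξ η, MulOpposite.op_star]
  norm_eq_sqrt_norm_inner_self ξ := rfl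

theorem core : NormedSpace.Core ℂ (L2 X B) := by
  let _ := CStarAlgebra.spectralOrder Bᵐᵒᵖ
  have := CStarAlgebra.spectralOrderedRing Bᵐᵒᵖ
  let _ : CStarModule Bᵐᵒᵖ (L2 X B) := cstarModule
  exact CStarModule.normedSpaceCore Bᵐᵒᵖ

theorem norm_ip_le (ξ η : L2 X B) : ‖ip ξ η‖ ≤ ‖ξ‖ * ‖η‖ := by
  let _ := CStarAlgebra.spectralOrder Bᵐᵒᵖ
  have := CStarAlgebra.spectralOrderedRing Bᵐᵒᵖ
  let _ : CStarModule Bᵐᵒᵖ (L2 X B) := cstarModule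
  exact CStarModule.norm_inner_le (A := Bᵐᵒᵖ) (L2 X B) (x := ξ) (y := η)

instance : NormedAddCommGroup (L2 X B) := NormedAddCommGroup.ofCore core
instance : NormedSpace ℂ (L2 X B) := NormedSpace.ofCore core

theorem norm_sq (ξ : L2 X B) : ‖ξ‖ ^ 2 = ‖ip ξ ξ‖ := by
  rw [norm_def, Real.sq_sqrt (norm_nonneg _)]

theorem norm_sum_le (ξ : L2 X B) (t : Finset X) :
    ‖∑ x ∈ t, star (ξ.1 x) * ξ.1 x‖ ≤ ‖ξ‖ ^ 2 := by
  let _ := CStarAlgebra.spectralOrder B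
  have := CStarAlgebra.spectralOrderedRing B
  rw [norm_sq]
  exact norm_sum_le_norm_tsum (fun x => star_mul_self_nonneg _) (summable_self ξ) t

theorem norm_apply_le (ξ : L2 X B) (x : X) : ‖ξ.1 x‖ ≤ ‖ξ‖ := by
  have := norm_sum_le ξ {x}
  rw [Finset.sum_singleton, CStarRing.norm_star_mul_self, ← sq] at this
  exact (pow_le_pow_iff_left₀ (norm_nonneg _) (norm_nonneg _) two_ne_zero).1 this

theorem norm_le_of_forall_sum (ξ : L2 X B) {C : ℝ} (hC : 0 ≤ C)
    (h : ∀ t : Finset X, ‖∑ x ∈ t, star (ξ.1 x) * ξ.1 x‖ ≤ C ^ 2) : ‖ξ‖ ≤ C := by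
  have h2 : ‖ip ξ ξ‖ ≤ C ^ 2 :=
    le_of_tendsto ((summable_self ξ).hasSum.norm) (Eventually.of_forall h)
  rw [← norm_sq] at h2
  exact (pow_le_pow_iff_left₀ (norm_nonneg _) hC two_ne_zero).1 h2

/-- Evaluation at a point, as a continuous linear map. -/
def evalL (x : X) : L2 X B →L[ℂ] B :=
  LinearMap.mkContinuous
    { toFun := fun ξ => ξ.1 x, map_add' := fun _ _ => rfl, map_smul' := fun _ _ => rfl } 1
    (fun ξ => (norm_apply_le ξ x).trans_eq (one_mul _).symm)

@[simp] theorem evalL_apply (x : X) (ξ : L2 X B) : evalL x ξ = ξ.1 x := rfl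

instance : CompleteSpace (L2 X B) := by
  let _ := CStarAlgebra.spectralOrder B
  have := CStarAlgebra.spectralOrderedRing B
  refine Metric.complete_of_cauchySeq_tendsto fun u hu => ?_
  have hx : ∀ x, ∃ b, Tendsto (fun n => (u n).1 x) atTop (𝓝 b) := fun x =>
    cauchySeq_tendsto_of_complete (hu.map (evalL x).uniformContinuous)
  choose g hg using hx
  have key : ∀ ε > 0, ∃ N, ∀ n ≥ N, ∀ t : Finset X,
      ‖∑ x ∈ t, star ((u n).1 x - g x) * ((u n).1 x - g x)‖ ≤ ε ^ 2 := by
    intro ε hε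
    obtain ⟨N, hN⟩ := Metric.cauchySeq_iff.1 hu ε hε
    refine ⟨N, fun n hn t => ?_⟩
    have hT : Tendsto (fun m => ‖∑ x ∈ t, star ((u n - u m).1 x) * (u n - u m).1 x‖) atTop
        (𝓝 ‖∑ x ∈ t, star ((u n).1 x - g x) * ((u n).1 x - g x)‖) := by
      refine (tendsto_finsetSum _ fun x _ => ?_).norm
      have h1 : Tendsto (fun m => (u n - u m).1 x) atTop (𝓝 ((u n).1 x - g x)) :=
        tendsto_const_nhds.sub (hg x)
      exact h1.star.mul h1
    refine le_of_tendsto hT ((eventually_ge_atTop N).mono fun m hm => ?_)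
    have := hN n hn m hm
    rw [dist_eq_norm] at this
    exact (norm_sum_le _ t).trans (by gcongr)
  have hgm : Summable fun x => star (g x) * g x := by
    rw [summable_iff_vanishing_norm]
    intro ε hε
    obtain ⟨N, hN⟩ := key (√(ε / 8)) (by positivity)
    obtain ⟨s, hs⟩ := summable_iff_vanishing_norm.1 (summable_self (u N)) (ε / 8) (by positivity)
    refine ⟨s, fun t ht => ?_⟩
    have h1 := hN N le_rfl t
    rw [Real.sq_sqrt (by positivity)] at h1
    have h2 := hs t ht
    have hle : ∑ x ∈ t, star (g x) * g x ≤
        (2 : ℝ) • ∑ x ∈ t, star ((u N).1 x) * (u N).1 x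
          + (2 : ℝ) • ∑ x ∈ t, star ((u N).1 x - g x) * ((u N).1 x - g x) := by
      rw [Finset.smul_sum, Finset.smul_sum, ← Finset.sum_add_distrib]
      refine Finset.sum_le_sum fun x _ => ?_
      have := star_add_mul_add_le ((u N).1 x) (g x - (u N).1 x)
      rw [add_sub_cancel] at this
      refine this.trans_eq ?_
      congr 2
      rw [← neg_sub, star_neg, neg_mul_neg]
    have h3 := CStarAlgebra.norm_le_norm_of_nonneg_of_le
      (Finset.sum_nonneg fun x _ => star_mul_self_nonneg (g x)) hle
    refine lt_of_le_of_lt (h3.trans (norm_add_le _ _)) ?_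
    rw [norm_smul, norm_smul, Real.norm_of_nonneg zero_le_two]
    linarith
  refine ⟨L2.mk g hgm, Metric.tendsto_atTop.2 fun ε hε => ?_⟩
  obtain ⟨N, hN⟩ := key (ε / 2) (by positivity)
  refine ⟨N, fun n hn => ?_⟩
  rw [dist_eq_norm]
  refine lt_of_le_of_lt (norm_le_of_forall_sum _ (by positivity) fun t => ?_) (half_lt_self hε)
  exact hN n hn t

end L2

/-- `IsAdjointPair T S`: the operator `S` is an adjoint of `T`. -/
def IsAdjointPair {X B : Type*} [NonUnitalCStarAlgebra B] (T S : L2 X B →L[ℂ] L2 X B) : Prop :=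
  ∀ ξ η, L2.ip (T ξ) η = L2.ip ξ (S η)

namespace IsAdjointPair
variable {X B} {T S T' S' : L2 X B →L[ℂ] L2 X B}

open L2

theorem symm (h : IsAdjointPair T S) : IsAdjointPair S T := fun ξ η => by
  rw [← star_ip, ← h, star_ip]

theorem ip_sub_right (ξ η ζ : L2 X B) : ip ξ (η - ζ) = ip ξ η - ip ξ ζ := by
  rw [eq_sub_iff_add_eq, ← ip_add_right, sub_add_cancel]

theorem ext_ip {ξ η : L2 X B} (h : ∀ ζ, ip ζ ξ = ip ζ η) : ξ = η := by
  rw [← sub_eq_zero]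
  exact ip_self_eq_zero (by rw [ip_sub_right, h, sub_self])

theorem unique (h : IsAdjointPair T S) (h' : IsAdjointPair T S') : S = S' := by
  ext1 η
  exact ext_ip fun ζ => by rw [← h, ← h']

theorem norm_le (h : IsAdjointPair T S) : ‖S‖ ≤ ‖T‖ := by
  refine S.opNorm_le_bound (norm_nonneg _) fun η => ?_
  by_cases h0 : ‖S η‖ = 0
  · rw [h0]; positivity
  have : ‖S η‖ ^ 2 ≤ ‖T‖ * ‖S η‖ * ‖η‖ := by
    rw [norm_sq, ← h]
    exact (norm_ip_le _ _).trans (by gcongr; exact T.le_opNorm _)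
  have hpos : 0 < ‖S η‖ := lt_of_le_of_ne (norm_nonneg _) (Ne.symm h0)
  nlinarith

theorem add (h : IsAdjointPair T S) (h' : IsAdjointPair T' S') :
    IsAdjointPair (T + T') (S + S') := fun ξ η => by
  rw [← star_ip]
  simp only [add_apply, ip_add_right, star_add, star_ip, h ξ η, h' ξ η]

theorem smul (c : ℂ) (h : IsAdjointPair T S) : IsAdjointPair (c • T) (star c • S) := fun ξ η => by
  rw [← star_ip]
  simp only [smul_apply, ip_smul_right, star_smul, star_ip, h ξ η]

theorem sub (h : IsAdjointPair T S) (h' : IsAdjointPair T' S') :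
    IsAdjointPair (T - T') (S - S') := by
  have := h.add (h'.smul (-1))
  simpa only [star_neg, star_one, neg_one_smul, ← sub_eq_add_neg] using this

theorem mul (h : IsAdjointPair T S) (h' : IsAdjointPair T' S') :
    IsAdjointPair (T * T') (S' * S) := fun ξ η => by
  simp only [mul_apply_eq_comp, h _ η, h' ξ]

theorem one : IsAdjointPair (1 : L2 X B →L[ℂ] L2 X B) 1 := fun _ _ => rfl

theorem norm_mul_self_le (h : IsAdjointPair T S) : ‖T‖ * ‖T‖ ≤ ‖S * T‖ := by
  have hb : ‖T‖ ≤ √‖S * T‖ := by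
    refine T.opNorm_le_bound (Real.sqrt_nonneg _) fun ξ => ?_
    rw [← pow_le_pow_iff_left₀ (norm_nonneg _) (by positivity) two_ne_zero, mul_pow,
      Real.sq_sqrt (norm_nonneg _), norm_sq, h]
    refine (norm_ip_le _ _).trans ?_
    have := (S * T).le_opNorm ξ
    change ‖S (T ξ)‖ ≤ _ at this
    nlinarith [norm_nonneg ξ]
  calc _ ≤ √‖S * T‖ * √‖S * T‖ := by gcongr
    _ = _ := Real.mul_self_sqrt (norm_nonneg _)

end IsAdjointPair

/-- The C⋆-algebra `𝓛_B(ℓ²(X, B))` of adjointable operators on the Hilbert module `ℓ²(X, B)`. -/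
def adjointable : Subalgebra ℂ (L2 X B →L[ℂ] L2 X B) where
  carrier := {T | ∃ S, IsAdjointPair T S}
  mul_mem' := fun ⟨_, h⟩ ⟨_, h'⟩ => ⟨_, h.mul h'⟩
  add_mem' := fun ⟨_, h⟩ ⟨_, h'⟩ => ⟨_, h.add h'⟩
  algebraMap_mem' := fun c => ⟨star c • 1, by
    rw [Algebra.algebraMap_eq_smul_one]; exact IsAdjointPair.one.smul c⟩

/-- The C⋆-algebra `𝓛_B(ℓ²(X, B))` as a type. -/
abbrev Adj : Type _ := adjointable X B

namespace Adj

variable {X B}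

instance : Star (Adj X B) where
  star T := ⟨T.2.choose, T.1, T.2.choose_spec.symm⟩

theorem isAdjointPair_star (T : Adj X B) : IsAdjointPair T.1 (star T).1 := T.2.choose_spec

theorem star_eq_of {T S : Adj X B} (h : IsAdjointPair T.1 S.1) : star T = S :=
  Subtype.ext (T.isAdjointPair_star.unique h)

instance : StarRing (Adj X B) where
  star_involutive T := star_eq_of (T.isAdjointPair_star.symm)
  star_mul T S := star_eq_of (T.isAdjointPair_star.mul S.isAdjointPair_star)
  star_add T S := star_eq_of (T.isAdjointPair_star.add S.isAdjointPair_star)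

theorem isClosed_adjointable : IsClosed (adjointable X B : Set (L2 X B →L[ℂ] L2 X B)) := by
  refine isClosed_of_closure_subset fun T hT => ?_
  obtain ⟨u, hu, hT⟩ := mem_closure_iff_seq_limit.1 hT
  choose v hv using hu
  have hc : CauchySeq v := by
    rw [Metric.cauchySeq_iff]
    intro ε hε
    obtain ⟨N, hN⟩ := Metric.cauchySeq_iff.1 hT.cauchySeq ε hε
    refine ⟨N, fun m hm n hn => lt_of_le_of_lt ?_ (hN m hm n hn)⟩
    rw [dist_eq_norm, dist_eq_norm]
    exact ((hv m).sub (hv n)).norm_le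
  obtain ⟨S, hS⟩ := cauchySeq_tendsto_of_complete hc
  refine ⟨S, fun ξ η => ?_⟩
  have hip : Continuous fun p : L2 X B × L2 X B => L2.ip p.1 p.2 := by
    let _ := CStarAlgebra.spectralOrder Bᵐᵒᵖ
    have := CStarAlgebra.spectralOrderedRing Bᵐᵒᵖ
    let _ : CStarModule Bᵐᵒᵖ (L2 X B) := L2.cstarModule
    exact MulOpposite.continuous_unop.comp
      (CStarModule.continuous_inner (A := Bᵐᵒᵖ) (E := L2 X B))
  have h1 : Tendsto (fun n => L2.ip (u n ξ) η) atTop (𝓝 (L2.ip (T ξ) η)) :=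
    (hip.tendsto (T ξ, η)).comp
      (((ContinuousLinearMap.apply ℂ _ ξ).continuous.tendsto T |>.comp hT).prodMk_nhds
        tendsto_const_nhds)
  have h2 : Tendsto (fun n => L2.ip ξ (v n η)) atTop (𝓝 (L2.ip ξ (S η))) :=
    (hip.tendsto (ξ, S η)).comp
      (tendsto_const_nhds.prodMk_nhds
        ((ContinuousLinearMap.apply ℂ _ η).continuous.tendsto S |>.comp hS))
  exact tendsto_nhds_unique h1 (by simpa only [(hv _) ξ η] using h2)

instance : CStarAlgebra (Adj X B) where
  complete := isClosed_adjointable.completeSpace_coe.complete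
  norm_mul_self_le T := T.isAdjointPair_star.norm_mul_self_le
  star_smul c T := star_eq_of (T.isAdjointPair_star.smul c)

end Adj

end HilbertModule

section Matrices

namespace L2

variable {X B : Type*} [NonUnitalCStarAlgebra B]

open Classical in
theorem summable_single (y : X) (b : B) : Summable fun x =>
    star ((Pi.single y b : X → B) x) * (Pi.single y b : X → B) x :=
  summable_of_ne_finset_zero (s := {y}) fun x hx => by
    rw [Pi.single_eq_of_ne (by simpa using hx), mul_zero]

open Classical in
/-- The vector `e_y b`, with value `b` at `y` and zero elsewhere. -/
def single (y : X) (b : B) : L2 X B := mk (Pi.single y b) (summable_single y b)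

open Classical in
theorem single_val (y : X) (b : B) (x : X) : (single y b).1 x = if x = y then b else 0 := by
  simp [single, Pi.single_apply]

open Classical in
/-- The truncation of a vector to a finite set. -/
def trunc (F : Finset X) (ξ : L2 X B) : L2 X B :=
  mk (fun x => if x ∈ F then ξ.1 x else 0)
    (summable_of_ne_finset_zero (s := F) fun x hx => by simp [hx])

open Classical in
theorem trunc_val (F : Finset X) (ξ : L2 X B) (x : X) :
    (trunc F ξ).1 x = if x ∈ F then ξ.1 x else 0 := rfl

theorem norm_trunc_le (F : Finset X) (ξ : L2 X B) : ‖trunc F ξ‖ ≤ ‖ξ‖ := by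
  classical
  refine norm_le_of_forall_sum _ (norm_nonneg _) fun t => ?_
  refine le_trans (le_of_eq ?_) (norm_sum_le ξ (t.filter (· ∈ F)))
  congr 1
  rw [Finset.sum_filter]
  refine Finset.sum_congr rfl fun x _ => ?_
  rw [trunc_val]; split_ifs <;> simp

/-- `ip ξ` as a continuous linear map. -/
def ipL (ξ : L2 X B) : L2 X B →L[ℂ] B :=
  LinearMap.mkContinuous
    { toFun := ip ξ, map_add' := ip_add_right ξ, map_smul' := fun c η => ip_smul_right c ξ η }
    ‖ξ‖ (norm_ip_le ξ)

@[simp] theorem ipL_apply (ξ η : L2 X B) : ipL ξ η = ip ξ η := rfl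

theorem ip_single_left (x : X) (c : B) (η : L2 X B) : ip (single x c) η = star c * η.1 x := by
  classical
  rw [ip, tsum_eq_single x]
  · simp [single_val]
  · intro y hy; simp [single_val, hy]

theorem ip_single_right (x : X) (c : B) (η : L2 X B) : ip η (single x c) = star (η.1 x) * c := by
  rw [← star_ip, ip_single_left]; simp

theorem norm_single (y : X) (b : B) : ‖single y b‖ = ‖b‖ := by
  rw [norm_def, ip_single_left, single_val, if_pos rfl, CStarRing.norm_star_mul_self,
    Real.sqrt_mul_self (norm_nonneg _)]

theorem hasSum_single (ξ : L2 X B) : HasSum (fun x => single x (ξ.1 x)) ξ := by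
  classical
  have hs : ∀ s : Finset X, ∑ x ∈ s, single x (ξ.1 x) = trunc s ξ := by
    intro s
    ext z
    rw [← evalL_apply, map_sum]
    simp [single_val, trunc_val]
  rw [HasSum, SummationFilter.unconditional_filter, Metric.tendsto_atTop]
  intro ε hε
  obtain ⟨s, hs'⟩ := summable_iff_vanishing_norm.1 (summable_self ξ) ((ε / 2) ^ 2) (by positivity)
  refine ⟨s, fun t ht => ?_⟩
  rw [dist_eq_norm, hs, norm_sub_rev]
  refine lt_of_le_of_lt (norm_le_of_forall_sum _ (by positivity) fun u => ?_) (half_lt_self hε)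
  refine le_trans (le_of_eq ?_) (hs' (u.filter (· ∉ t)) ?_).le
  · congr 1
    rw [Finset.sum_filter]
    refine Finset.sum_congr rfl fun x _ => ?_
    rw [sub_val, trunc_val]; split_ifs <;> simp_all
  · rw [Finset.disjoint_left]
    intro x hx hxs
    exact (Finset.mem_filter.1 hx).2 (ht hxs)

end L2

variable {X B : Type*} [NonUnitalCStarAlgebra B]

/-- `IsMatrix T m`: the operator `T` on `ℓ²(X, B)` is given by the `X × X`-matrix `m` with entries
in `B`, that is, `(T (e_y b))_x = m_{x,y} b` for all `x, y ∈ X` and `b ∈ B`. -/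
def IsMatrix (T : Adj X B) (m : X → X → B) : Prop :=
  ∀ x y b, (T.1 (L2.single y b)).1 x = m x y * b

namespace IsMatrix

open L2

variable {T S : Adj X B} {m m' : X → X → B}

theorem hasSum (h : IsMatrix T m) (ξ : L2 X B) (x : X) :
    HasSum (fun y => m x y * ξ.1 y) ((T.1 ξ).1 x) := by
  have := (hasSum_single ξ).mapL ((evalL x).comp T.1)
  simpa only [ContinuousLinearMap.comp_apply, evalL_apply, h x] using this

theorem ext (h : IsMatrix T m) (h' : IsMatrix S m) : T = S := by
  refine Subtype.ext (ContinuousLinearMap.ext fun ξ => L2.ext fun x => ?_)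
  exact (h.hasSum ξ x).unique (h'.hasSum ξ x)

theorem unique (h : IsMatrix T m) (h' : IsMatrix T m') : m = m' := by
  funext x y
  rw [← sub_eq_zero, ← CStarRing.mul_star_self_eq_zero_iff, sub_mul, ← h, ← h', sub_self]

theorem norm_le (h : IsMatrix T m) (x y : X) : ‖m x y‖ ≤ ‖T‖ := by
  have h1 : ‖m x y * star (m x y)‖ ≤ ‖T‖ * ‖m x y‖ := by
    rw [← h]
    refine (norm_apply_le _ x).trans ((T.1.le_opNorm _).trans ?_)
    rw [norm_single, norm_star]; rfl
  rw [CStarRing.norm_self_mul_star] at h1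
  by_cases h0 : ‖m x y‖ = 0
  · rw [h0]; exact norm_nonneg _
  · exact le_of_mul_le_mul_right h1 (lt_of_le_of_ne (norm_nonneg _) (Ne.symm h0))

theorem zero : IsMatrix (0 : Adj X B) (fun _ _ => 0) := fun x y b => by
  rw [zero_mul]; rfl

theorem add (h : IsMatrix T m) (h' : IsMatrix S m') : IsMatrix (T + S) (fun x y => m x y + m' x y) :=
  fun x y b => by rw [add_mul, ← h, ← h']; rfl

theorem sub (h : IsMatrix T m) (h' : IsMatrix S m') : IsMatrix (T - S) (fun x y => m x y - m' x y) :=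
  fun x y b => by rw [sub_mul, ← h, ← h']; rfl

theorem smul (c : ℂ) (h : IsMatrix T m) : IsMatrix (c • T) (fun x y => c • m x y) :=
  fun x y b => by rw [smul_mul_assoc, ← h]; rfl

theorem star (h : IsMatrix T m) : IsMatrix (star T) (fun x y => star (m y x)) := by
  intro x y b
  have key : ∀ c, Star.star c * ((Star.star T).1 (single y b)).1 x =
      Star.star c * (Star.star (m y x) * b) := by
    intro c
    rw [← ip_single_left, ← T.isAdjointPair_star, ip_single_right, h, star_mul, mul_assoc]
  rw [← sub_eq_zero, ← CStarRing.star_mul_self_eq_zero_iff, mul_sub, key, sub_self]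

theorem mul (h : IsMatrix T m) (h' : IsMatrix S m') (r : X → Finset X)
    (hr : ∀ x y, y ∉ r x → m x y = 0) :
    IsMatrix (T * S) (fun x y => ∑ z ∈ r x, m x z * m' z y) := fun x y b => by
  have h1 := h.hasSum (S.1 (single y b)) x
  have h2 : HasSum (fun z => m x z * (S.1 (single y b)).1 z)
      (∑ z ∈ r x, m x z * (S.1 (single y b)).1 z) :=
    hasSum_sum_of_ne_finset_zero fun z hz => by rw [hr x z hz, zero_mul]
  have h3 := h1.unique h2
  change (T.1 (S.1 (single y b))).1 x = _
  rw [h3, Finset.sum_mul]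
  exact Finset.sum_congr rfl fun z _ => by rw [h', mul_assoc]

end IsMatrix

/-- A family of subsets of `X × X` (written as relations) that are allowed as supports of
matrices. Each has uniformly bounded row sizes, and the family is closed under the operations
that occur when matrices are added, multiplied and adjoined. -/
structure SupportFamily (X : Type*) where
  IsSupp : (X → X → Prop) → Prop
  empty : IsSupp fun _ _ => False
  mono : ∀ {R R' : X → X → Prop}, (∀ x y, R x y → R' x y) → IsSupp R' → IsSupp R
  union : ∀ {R R' : X → X → Prop}, IsSupp R → IsSupp R' → IsSupp fun x y => R x y ∨ R' x y
  inv : ∀ {R : X → X → Prop}, IsSupp R → IsSupp fun x y => R y x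
  comp : ∀ {R R' : X → X → Prop}, IsSupp R → IsSupp R' → IsSupp fun x y => ∃ z, R x z ∧ R' z y
  row_bdd : ∀ {R : X → X → Prop}, IsSupp R → ∃ k : ℕ, ∀ x, {y | R x y}.encard ≤ k

section Existence

theorem exists_rows {R : X → X → Prop} {k : ℕ} (h : ∀ x, {y | R x y}.encard ≤ k) :
    ∃ r : X → Finset X, (∀ x y, y ∈ r x ↔ R x y) ∧ ∀ x, (r x).card ≤ k := by
  have hf : ∀ x, {y | R x y}.Finite := fun x => Set.finite_of_encard_le_coe (h x)
  refine ⟨fun x => (hf x).toFinset, fun x y => by simp, fun x => ?_⟩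
  have := h x
  rw [(hf x).encard_eq_coe_toFinset_card] at this
  exact_mod_cast this

variable [PartialOrder B] [StarOrderedRing B]

theorem star_sum_mul_sum_le {ι : Type*} (s : Finset ι) (a : ι → B) :
    star (∑ i ∈ s, a i) * ∑ i ∈ s, a i ≤ (s.card : ℝ) • ∑ i ∈ s, star (a i) * a i := by
  have h : 0 ≤ ∑ i ∈ s, ∑ j ∈ s, star (a i - a j) * (a i - a j) :=
    Finset.sum_nonneg fun i _ => Finset.sum_nonneg fun j _ => star_mul_self_nonneg _
  have e : ∑ i ∈ s, ∑ j ∈ s, star (a i - a j) * (a i - a j) =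
      (2 : ℝ) • ((s.card : ℝ) • (∑ i ∈ s, star (a i) * a i)
        - star (∑ i ∈ s, a i) * ∑ i ∈ s, a i) := by
    simp only [star_sub, sub_mul, mul_sub, Finset.sum_sub_distrib, Finset.sum_const, star_sum,
      Finset.sum_mul_sum]
    rw [Finset.sum_comm (f := fun x y => star (a y) * a x), two_smul, ← Finset.smul_sum,
      Nat.cast_smul_eq_nsmul]
    abel
  rw [e] at h
  have h2 := smul_nonneg (show (0 : ℝ) ≤ 1 / 2 by norm_num) h
  rw [smul_smul] at h2
  norm_num at h2
  rwa [star_sum]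

theorem sum_rows_le {m : X → X → B} {C : ℝ} (hC : ∀ x y, ‖m x y‖ ≤ C)
    {r c : X → Finset X} {k : ℕ} (hrc : ∀ x y, y ∈ r x ↔ x ∈ c y)
    (hr : ∀ x, (r x).card ≤ k) (hc : ∀ x, (c x).card ≤ k) (ξ : X → B) (t : Finset X)
    [DecidableEq X] :
    ∑ x ∈ t, star (∑ y ∈ r x, m x y * ξ y) * ∑ y ∈ r x, m x y * ξ y ≤
      (k * C : ℝ) ^ 2 • ∑ y ∈ t.biUnion r, star (ξ y) * ξ y := by
  have hp : ∀ y, 0 ≤ star (ξ y) * ξ y := fun y => star_mul_self_nonneg _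
  have h1 : ∀ x, star (∑ y ∈ r x, m x y * ξ y) * ∑ y ∈ r x, m x y * ξ y ≤
      ((k : ℝ) * C ^ 2) • ∑ y ∈ r x, star (ξ y) * ξ y := by
    intro x
    refine (star_sum_mul_sum_le _ _).trans ?_
    rw [mul_smul]
    refine (smul_le_smul_of_nonneg_right (show ((r x).card : ℝ) ≤ k by exact_mod_cast hr x)
      (Finset.sum_nonneg fun y _ => star_mul_self_nonneg _)).trans ?_
    refine smul_le_smul_of_nonneg_left ?_ (Nat.cast_nonneg k)
    rw [Finset.smul_sum]
    refine Finset.sum_le_sum fun y _ => ?_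
    have h2 : star (m x y * ξ y) * (m x y * ξ y) = star (ξ y) * (star (m x y) * m x y) * ξ y := by
      simp [mul_assoc]
    rw [h2]
    refine (CStarAlgebra.star_left_conjugate_le_norm_smul).trans ?_
    refine smul_le_smul_of_nonneg_right ?_ (hp y)
    rw [CStarRing.norm_star_mul_self, ← sq]
    gcongr
    exact hC x y
  have h3 : ∑ x ∈ t, ∑ y ∈ r x, star (ξ y) * ξ y ≤ (k : ℝ) • ∑ y ∈ t.biUnion r, star (ξ y) * ξ y := by
    have : ∑ x ∈ t, ∑ y ∈ r x, star (ξ y) * ξ y =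
        ∑ y ∈ t.biUnion r, ∑ x ∈ t.filter (fun x => y ∈ r x), star (ξ y) * ξ y := by
      refine Finset.sum_comm' fun x y => ?_
      simp only [Finset.mem_filter, Finset.mem_biUnion]
      tauto
    rw [this, Finset.smul_sum]
    refine Finset.sum_le_sum fun y _ => ?_
    rw [Finset.sum_const, ← Nat.cast_smul_eq_nsmul ℝ]
    refine smul_le_smul_of_nonneg_right ?_ (hp y)
    have : t.filter (fun x => y ∈ r x) ⊆ c y := fun x hx =>
      (hrc x y).1 (Finset.mem_filter.1 hx).2
    exact_mod_cast (Finset.card_le_card this).trans (hc y)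
  calc _ ≤ ∑ x ∈ t, ((k : ℝ) * C ^ 2) • ∑ y ∈ r x, star (ξ y) * ξ y :=
        Finset.sum_le_sum fun x _ => h1 x
    _ = ((k : ℝ) * C ^ 2) • ∑ x ∈ t, ∑ y ∈ r x, star (ξ y) * ξ y := by rw [Finset.smul_sum]
    _ ≤ ((k : ℝ) * C ^ 2) • (k : ℝ) • ∑ y ∈ t.biUnion r, star (ξ y) * ξ y :=
        smul_le_smul_of_nonneg_left h3 (by positivity)
    _ = _ := by rw [smul_smul]; congr 1; ring

end Existence

theorem norm_sum_rows_le {m : X → X → B} {C : ℝ} (hC : ∀ x y, ‖m x y‖ ≤ C)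
    {r c : X → Finset X} {k : ℕ} (hrc : ∀ x y, y ∈ r x ↔ x ∈ c y)
    (hr : ∀ x, (r x).card ≤ k) (hc : ∀ x, (c x).card ≤ k) (ξ : X → B) (t : Finset X)
    [DecidableEq X] :
    ‖∑ x ∈ t, star (∑ y ∈ r x, m x y * ξ y) * ∑ y ∈ r x, m x y * ξ y‖ ≤
      (k * C : ℝ) ^ 2 * ‖∑ y ∈ t.biUnion r, star (ξ y) * ξ y‖ := by
  let _ := CStarAlgebra.spectralOrder B
  have := CStarAlgebra.spectralOrderedRing B
  refine (CStarAlgebra.norm_le_norm_of_nonneg_of_le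
    (Finset.sum_nonneg fun _ _ => star_mul_self_nonneg _)
    (sum_rows_le hC hrc hr hc ξ t)).trans_eq ?_
  rw [norm_smul, Real.norm_of_nonneg (by positivity)]

/-- A uniformly bounded matrix with uniformly bounded rows and columns defines a bounded operator. -/
theorem exists_clm {m : X → X → B} {C : ℝ} (hC0 : 0 ≤ C) (hC : ∀ x y, ‖m x y‖ ≤ C)
    {r c : X → Finset X} {k : ℕ} (hrc : ∀ x y, y ∈ r x ↔ x ∈ c y)
    (hr : ∀ x, (r x).card ≤ k) (hc : ∀ x, (c x).card ≤ k) :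
    ∃ T : L2 X B →L[ℂ] L2 X B, ∀ ξ x, (T ξ).1 x = ∑ y ∈ r x, m x y * ξ.1 y := by
  classical
  have hsum : ∀ ξ : L2 X B, Summable fun x =>
      star (∑ y ∈ r x, m x y * ξ.1 y) * ∑ y ∈ r x, m x y * ξ.1 y := by
    intro ξ
    rw [summable_iff_vanishing_norm]
    intro ε hε
    obtain ⟨s, hs⟩ := summable_iff_vanishing_norm.1 (L2.summable_self ξ)
      (ε / ((k * C) ^ 2 + 1)) (by positivity)
    refine ⟨s.biUnion c, fun t ht => ?_⟩
    refine lt_of_le_of_lt (norm_sum_rows_le hC hrc hr hc ξ.1 t) ?_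
    have h1 := hs (t.biUnion r) (by
      rw [Finset.disjoint_left] at ht ⊢
      intro y hy hys
      obtain ⟨x, hx, hxy⟩ := Finset.mem_biUnion.1 hy
      exact ht hx (Finset.mem_biUnion.2 ⟨y, hys, (hrc x y).1 hxy⟩))
    rw [lt_div_iff₀ (by positivity)] at h1
    nlinarith [norm_nonneg (∑ y ∈ t.biUnion r, star (ξ.1 y) * ξ.1 y), sq_nonneg (k * C)]
  refine ⟨LinearMap.mkContinuous
    { toFun := fun ξ => L2.mk (fun x => ∑ y ∈ r x, m x y * ξ.1 y) (hsum ξ)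
      map_add' := fun ξ η => L2.ext fun x => by
        simp [mul_add, Finset.sum_add_distrib]
      map_smul' := fun a ξ => L2.ext fun x => by
        simp [Finset.smul_sum, mul_smul_comm] } (k * C) fun ξ => ?_, fun ξ x => rfl⟩
  refine L2.norm_le_of_forall_sum _ (by positivity) fun t => ?_
  refine (norm_sum_rows_le hC hrc hr hc ξ.1 t).trans ?_
  rw [mul_pow _ ‖ξ‖]
  exact mul_le_mul_of_nonneg_left (L2.norm_sum_le ξ _) (by positivity)

theorem isAdjointPair_of_single {T S : L2 X B →L[ℂ] L2 X B}
    (h : ∀ x y b c, L2.ip (T (L2.single y b)) (L2.single x c) =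
      L2.ip (L2.single y b) (S (L2.single x c))) : IsAdjointPair T S := by
  have h1 : ∀ y b η, L2.ip (T (L2.single y b)) η = L2.ip (L2.single y b) (S η) := by
    intro y b η
    have e1 := (L2.hasSum_single η).mapL (L2.ipL (T (L2.single y b)))
    have e2 := (L2.hasSum_single η).mapL ((L2.ipL (L2.single y b)).comp S)
    simp only [ContinuousLinearMap.comp_apply, L2.ipL_apply, h] at e1 e2
    exact e1.unique e2
  intro ξ η
  have e1 := (L2.hasSum_single ξ).mapL ((L2.ipL η).comp T)
  have e2 := (L2.hasSum_single ξ).mapL (L2.ipL (S η))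
  simp only [ContinuousLinearMap.comp_apply, L2.ipL_apply] at e1 e2
  have : ∀ y b, L2.ip η (T (L2.single y b)) = L2.ip (S η) (L2.single y b) := fun y b => by
    rw [← L2.star_ip, h1, L2.star_ip]
  simp only [this] at e1
  rw [← L2.star_ip, e1.unique e2, L2.star_ip]

/-- A uniformly bounded matrix with controlled support defines an adjointable operator. -/
theorem SupportFamily.exists_adj (E : SupportFamily X) {m : X → X → B}
    (hm : E.IsSupp fun x y => m x y ≠ 0) {C : ℝ} (hC : ∀ x y, ‖m x y‖ ≤ C) :
    ∃ T : Adj X B, IsMatrix T m := by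
  classical
  obtain ⟨k₁, h₁⟩ := E.row_bdd hm
  obtain ⟨k₂, h₂⟩ := E.row_bdd (E.inv hm)
  obtain ⟨r, hr, hr'⟩ := exists_rows h₁
  obtain ⟨c, hc, hc'⟩ := exists_rows h₂
  have hC' : ∀ x y, ‖m x y‖ ≤ max C 0 := fun x y => (hC x y).trans (le_max_left _ _)
  have hrc : ∀ x y, y ∈ r x ↔ x ∈ c y := fun x y => by rw [hr, hc]
  have hrk : ∀ x, (r x).card ≤ max k₁ k₂ := fun x => (hr' x).trans (le_max_left _ _)
  have hck : ∀ x, (c x).card ≤ max k₁ k₂ := fun x => (hc' x).trans (le_max_right _ _)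
  obtain ⟨T, hT⟩ := exists_clm (le_max_right C 0) hC' hrc hrk hck
  obtain ⟨S, hS⟩ := exists_clm (m := fun x y => star (m y x)) (le_max_right C 0)
    (fun x y => by rw [norm_star]; exact hC' y x) (fun x y => (hrc y x).symm) hck hrk
  have hT' : ∀ x y b, (T (L2.single y b)).1 x = m x y * b := fun x y b => by
    rw [hT, Finset.sum_congr rfl (g := fun z => if z = y then m x y * b else 0)]
    · rw [Finset.sum_ite_eq']
      split_ifs with h
      · rfl
      · rw [hr, not_not] at h; rw [h, zero_mul]
    · intro z _; rw [L2.single_val]; split_ifs with h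
      · rw [h]
      · rw [mul_zero]
  have hS' : ∀ x y b, (S (L2.single y b)).1 x = star (m y x) * b := fun x y b => by
    rw [hS, Finset.sum_congr rfl (g := fun z => if z = y then star (m y x) * b else 0)]
    · rw [Finset.sum_ite_eq']
      split_ifs with h
      · rfl
      · rw [hc, not_not] at h; rw [h, star_zero, zero_mul]
    · intro z _; rw [L2.single_val]; split_ifs with h
      · rw [h]
      · rw [mul_zero]
  refine ⟨⟨T, S, isAdjointPair_of_single fun x y b c => ?_⟩, hT'⟩
  rw [L2.ip_single_right, L2.ip_single_left, hT', hS', star_mul, mul_assoc]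

end Matrices

section MatrixAlgebras

instance (X B : Type*) [NonUnitalCStarAlgebra B] : NonUnitalCStarAlgebra (Adj X B) := inferInstance
instance (X B : Type*) [NonUnitalCStarAlgebra B] : NormedRing (Adj X B) := inferInstance
instance (X B : Type*) [NonUnitalCStarAlgebra B] : Ring (Adj X B) := inferInstance
instance (X B : Type*) [NonUnitalCStarAlgebra B] : NonUnitalNonAssocSemiring (Adj X B) :=
  inferInstance
instance (X B : Type*) [NonUnitalCStarAlgebra B] : NormedAddCommGroup (Adj X B) := inferInstance
instance (X B : Type*) [NonUnitalCStarAlgebra B] : AddCommGroup (Adj X B) := inferInstance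
instance (X B : Type*) [NonUnitalCStarAlgebra B] : Module ℂ (Adj X B) := inferInstance

variable {X : Type*} (E : SupportFamily X)

theorem SupportFamily.rows {R : X → X → Prop} (h : E.IsSupp R) :
    ∃ r : X → Finset X, ∀ x y, y ∈ r x ↔ R x y := by
  obtain ⟨k, hk⟩ := E.row_bdd h
  obtain ⟨r, hr, -⟩ := exists_rows hk
  exact ⟨r, hr⟩

/-- The `⋆`-algebra of operators given by matrices with uniformly bounded entries in `B` and with
support in the family `E`. -/
def banded (B : Type*) [NonUnitalCStarAlgebra B] : NonUnitalStarSubalgebra ℂ (Adj X B) where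
  carrier := {T | ∃ m : X → X → B, IsMatrix T m ∧ E.IsSupp (fun x y => m x y ≠ 0) ∧
    ∃ C : ℝ, ∀ x y, ‖m x y‖ ≤ C}
  zero_mem' := ⟨_, .zero, E.mono (by simp) E.empty, 0, by simp⟩
  add_mem' := by
    rintro T S ⟨m, h, hs, C, hC⟩ ⟨m', h', hs', C', hC'⟩
    refine ⟨_, h.add h', E.mono (fun x y hxy => ?_) (E.union hs hs'), C + C', fun x y =>
      (norm_add_le _ _).trans (add_le_add (hC x y) (hC' x y))⟩
    by_contra hcon
    push Not at hcon
    exact hxy (by rw [hcon.1, hcon.2, add_zero])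
  smul_mem' := by
    rintro c T ⟨m, h, hs, C, hC⟩
    exact ⟨_, h.smul c, E.mono (fun x y hxy => right_ne_zero_of_smul hxy) hs, ‖c‖ * C,
      fun x y => by rw [norm_smul]; gcongr; exact hC x y⟩
  mul_mem' := by
    rintro T S ⟨m, h, hs, C, hC⟩ ⟨m', h', hs', C', hC'⟩
    obtain ⟨r, hr⟩ := E.rows hs
    have hmul := h.mul h' r (fun x y hxy => by rw [hr, not_not] at hxy; exact hxy)
    refine ⟨_, hmul, E.mono (fun x y hxy => ?_) (E.comp hs hs'), _, hmul.norm_le⟩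
    obtain ⟨z, -, hz⟩ := Finset.exists_ne_zero_of_sum_ne_zero hxy
    exact ⟨z, left_ne_zero_of_mul hz, right_ne_zero_of_mul hz⟩
  star_mem' := by
    rintro T ⟨m, h, hs, C, hC⟩
    exact ⟨_, h.star, E.mono (fun x y hxy => by simpa using hxy) (E.inv hs), C,
      fun x y => by rw [norm_star]; exact hC y x⟩

instance (B : Type*) [NonUnitalCStarAlgebra B] : NonUnitalNormedRing (banded E B) := inferInstance
instance (B : Type*) [NonUnitalCStarAlgebra B] : NonUnitalRing (banded E B) := inferInstance
instance (B : Type*) [NonUnitalCStarAlgebra B] : NonUnitalNonAssocSemiring (banded E B) :=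
  inferInstance
instance (B : Type*) [NonUnitalCStarAlgebra B] : AddCommGroup (banded E B) := inferInstance
instance (B : Type*) [NonUnitalCStarAlgebra B] : Add (banded E B) := inferInstance
instance (B : Type*) [NonUnitalCStarAlgebra B] : Mul (banded E B) := inferInstance
instance (B : Type*) [NonUnitalCStarAlgebra B] : Module ℂ (banded E B) := inferInstance
instance (B : Type*) [NonUnitalCStarAlgebra B] : Norm (banded E B) := inferInstance

/-- The norm closure of `banded E B` in the adjointable operators. -/
def matAlg (B : Type*) [NonUnitalCStarAlgebra B] : NonUnitalStarSubalgebra ℂ (Adj X B) :=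
  (banded E B).topologicalClosure

instance (B : Type*) [NonUnitalCStarAlgebra B] : IsClosed (matAlg E B : Set (Adj X B)) :=
  NonUnitalStarSubalgebra.isClosed_topologicalClosure _

variable {A B C : Type*} [NonUnitalCStarAlgebra A] [NonUnitalCStarAlgebra B]
  [NonUnitalCStarAlgebra C]

/-- `matAlg E B` as a C⋆-algebra. -/
def MatAlg (B : Type*) [NonUnitalCStarAlgebra B] : Type _ := matAlg E B

instance (B : Type*) [NonUnitalCStarAlgebra B] : NonUnitalCStarAlgebra (MatAlg E B) :=
  inferInstanceAs (NonUnitalCStarAlgebra (matAlg E B))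

theorem MatAlg.val_add (S T : MatAlg E B) : (S + T).1 = S.1 + T.1 := rfl
theorem MatAlg.val_sub (S T : MatAlg E B) : (S - T).1 = S.1 - T.1 := rfl
theorem MatAlg.val_mul (S T : MatAlg E B) : (S * T).1 = S.1 * T.1 := rfl
theorem MatAlg.val_smul (c : ℂ) (T : MatAlg E B) : (c • T).1 = c • T.1 := rfl
theorem MatAlg.val_star (T : MatAlg E B) : (star T).1 = star T.1 := rfl
theorem MatAlg.val_zero : (0 : MatAlg E B).1 = 0 := rfl
theorem MatAlg.norm_def (T : MatAlg E B) : ‖T‖ = ‖T.1‖ := rfl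
theorem MatAlg.isometry_val : Isometry (fun T : MatAlg E B => T.1) :=
  isometry_subtype_coe (s := (matAlg E B : Set (Adj X B)))
theorem MatAlg.tendsto_iff {ι : Type*} {l : Filter ι} {u : ι → MatAlg E B} {T : MatAlg E B} :
    Tendsto u l (𝓝 T) ↔ Tendsto (fun i => (u i).1) l (𝓝 T.1) :=
  (MatAlg.isometry_val E).isEmbedding.tendsto_nhds_iff

theorem mem_matAlg_iff {T : Adj X B} : T ∈ matAlg E B ↔
    ∃ u : ℕ → Adj X B, (∀ n, u n ∈ banded E B) ∧ Tendsto u atTop (𝓝 T) :=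
  mem_closure_iff_seq_limit

/-- A norm limit of matrices is a matrix, and the entries converge. -/
theorem exists_isMatrix_of_tendsto {u : ℕ → Adj X B} {T : Adj X B} {m : ℕ → X → X → B}
    (hu : ∀ n, IsMatrix (u n) (m n)) (hT : Tendsto u atTop (𝓝 T)) :
    ∃ m', IsMatrix T m' ∧ ∀ x y, Tendsto (fun n => m n x y) atTop (𝓝 (m' x y)) := by
  have hc : ∀ x y, ∃ b, Tendsto (fun n => m n x y) atTop (𝓝 b) := by
    intro x y
    refine cauchySeq_tendsto_of_complete (Metric.cauchySeq_iff.2 fun ε hε => ?_)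
    obtain ⟨N, hN⟩ := Metric.cauchySeq_iff.1 hT.cauchySeq ε hε
    refine ⟨N, fun i hi j hj => lt_of_le_of_lt ?_ (hN i hi j hj)⟩
    rw [dist_eq_norm, dist_eq_norm]
    exact ((hu i).sub (hu j)).norm_le x y
  choose m' hm' using hc
  refine ⟨m', fun x y b => ?_, hm'⟩
  have h1 : Tendsto (fun n => ((u n).1 (L2.single y b)).1 x) atTop
      (𝓝 ((T.1 (L2.single y b)).1 x)) := by
    have hcont : Continuous fun S : Adj X B => (S.1 (L2.single y b)).1 x :=
      (L2.evalL x).continuous.comp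
        ((ContinuousLinearMap.apply ℂ _ (L2.single y b)).continuous.comp continuous_subtype_val)
    exact (hcont.tendsto T).comp hT
  refine tendsto_nhds_unique h1 ?_
  simp only [(hu _) x y b]
  exact (hm' x y).mul_const b

theorem exists_isMatrix {T : Adj X B} (hT : T ∈ matAlg E B) : ∃ m, IsMatrix T m := by
  obtain ⟨u, hu, hT⟩ := (mem_matAlg_iff E).1 hT
  choose m hm _ _ using hu
  obtain ⟨m', h, -⟩ := exists_isMatrix_of_tendsto hm hT
  exact ⟨m', h⟩

section Map

variable (φ : A →⋆ₙₐ[ℂ] B)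

theorem exists_banded_map {T : Adj X A} (hT : T ∈ banded E A) :
    ∃ S ∈ banded E B, ∀ m, IsMatrix T m → IsMatrix S (fun x y => φ (m x y)) := by
  obtain ⟨m, h, hs, C, hC⟩ := hT
  have hs' : E.IsSupp (fun x y => φ (m x y) ≠ 0) :=
    E.mono (fun x y hxy (h0 : m x y = 0) => hxy (by rw [h0, map_zero])) hs
  have hC' : ∀ x y, ‖φ (m x y)‖ ≤ C := fun x y =>
    (NonUnitalStarAlgHom.norm_apply_le φ _).trans (hC x y)
  obtain ⟨S, hS⟩ := E.exists_adj hs' hC'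
  exact ⟨S, ⟨_, hS, hs', C, hC'⟩, fun m' h' => by rwa [h'.unique h]⟩

/-- Entrywise application of a `⋆`-homomorphism, on the dense subalgebra. -/
def bandedMap : banded E A →⋆ₙₐ[ℂ] Adj X B where
  toFun T := (exists_banded_map E φ T.2).choose
  map_smul' c T := by
    obtain ⟨m, hm, -⟩ := T.2
    refine ((exists_banded_map E φ (c • T).2).choose_spec.2 _ (hm.smul c)).ext ?_
    have := ((exists_banded_map E φ T.2).choose_spec.2 _ hm).smul c
    simp only [map_smul]
    exact this
  map_zero' := by
    refine ((exists_banded_map E φ (0 : banded E A).2).choose_spec.2 _ .zero).ext ?_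
    simpa only [map_zero] using IsMatrix.zero
  map_add' T T' := by
    obtain ⟨m, hm, -⟩ := T.2
    obtain ⟨m', hm', -⟩ := T'.2
    refine ((exists_banded_map E φ (T + T').2).choose_spec.2 _ (hm.add hm')).ext ?_
    have := ((exists_banded_map E φ T.2).choose_spec.2 _ hm).add
      ((exists_banded_map E φ T'.2).choose_spec.2 _ hm')
    simpa only [map_add] using this
  map_mul' T T' := by
    obtain ⟨m, hm, hs, -⟩ := T.2
    obtain ⟨m', hm', -⟩ := T'.2
    obtain ⟨r, hr⟩ := E.rows hs
    have hr' : ∀ x y, y ∉ r x → m x y = 0 := fun x y hxy => by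
      rw [hr, not_not] at hxy; exact hxy
    refine ((exists_banded_map E φ (T * T').2).choose_spec.2 _ (hm.mul hm' r hr')).ext ?_
    have := ((exists_banded_map E φ T.2).choose_spec.2 _ hm).mul
      ((exists_banded_map E φ T'.2).choose_spec.2 _ hm') r
      (fun x y hxy => by rw [hr' x y hxy, map_zero])
    simpa only [map_sum, map_mul] using this
  map_star' T := by
    obtain ⟨m, hm, -⟩ := T.2
    refine ((exists_banded_map E φ (star T).2).choose_spec.2 _ hm.star).ext ?_
    have := ((exists_banded_map E φ T.2).choose_spec.2 _ hm).star
    simpa only [map_star] using this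

theorem bandedMap_spec (T : banded E A) {m : X → X → A} (h : IsMatrix T.1 m) :
    IsMatrix (bandedMap E φ T) (fun x y => φ (m x y)) :=
  (exists_banded_map E φ T.2).choose_spec.2 m h

theorem bandedMap_mem (T : banded E A) : bandedMap E φ T ∈ banded E B :=
  (exists_banded_map E φ T.2).choose_spec.1

/-- Supports contained in a fixed finite square. -/
def squareFamily (F : Finset X) : SupportFamily X where
  IsSupp R := ∀ x y, R x y → x ∈ F ∧ y ∈ F
  empty := by simp
  mono h h' x y hxy := h' x y (h x y hxy)
  union h h' x y hxy := hxy.elim (h x y) (h' x y)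
  inv h x y hxy := (h y x hxy).symm
  comp h h' x y := fun ⟨z, h1, h2⟩ => ⟨(h x z h1).1, (h' z y h2).2⟩
  row_bdd {R} h := ⟨F.card, fun x => by
    rw [← Set.encard_coe_eq_coe_finsetCard]
    exact Set.encard_le_encard fun y hy => (h x y hy).2⟩

theorem isClosed_square (F : Finset X) : IsClosed (banded (squareFamily F) A : Set (Adj X A)) := by
  refine isClosed_of_closure_subset fun T hT => ?_
  obtain ⟨u, hu, hT⟩ := mem_closure_iff_seq_limit.1 hT
  choose m hm hs _ using hu
  obtain ⟨m', h, hl⟩ := exists_isMatrix_of_tendsto hm hT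
  refine ⟨m', h, fun x y hxy => ?_, _, h.norm_le⟩
  by_contra hF
  refine hxy (tendsto_nhds_unique (hl x y) ?_)
  have : ∀ n, m n x y = 0 := fun n => by
    by_contra h0; exact hF (hs n x y h0)
  simp [this]

theorem norm_bandedMap_square_le (F : Finset X) (T : banded (squareFamily F) A) :
    ‖bandedMap (squareFamily F) φ T‖ ≤ ‖T‖ := by
  have : IsClosed (banded (squareFamily F) A : Set (Adj X A)) := isClosed_square F
  exact NonUnitalStarAlgHom.norm_apply_le (bandedMap (squareFamily F) φ) T

theorem norm_bandedMap_le (T : banded E A) : ‖bandedMap E φ T‖ ≤ ‖T‖ := by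
  classical
  obtain ⟨m, hm, hs, C, hC⟩ := T.2
  obtain ⟨r, hr⟩ := E.rows hs
  have hr' : ∀ x y, y ∉ r x → m x y = 0 := fun x y hxy => by
    rw [hr, not_not] at hxy; exact hxy
  have hφ := bandedMap_spec E φ T hm
  refine ContinuousLinearMap.opNorm_le_bound _ (norm_nonneg _) fun ξ => ?_
  change ‖(bandedMap E φ T).1 ξ‖ ≤ ‖T‖ * ‖ξ‖
  refine L2.norm_le_of_forall_sum _ (by positivity) fun t => ?_
  set F := t ∪ t.biUnion r with hF
  set mF : X → X → A := fun x y => if x ∈ F ∧ y ∈ F then m x y else 0 with hmF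
  have hsF : (squareFamily F).IsSupp fun x y => mF x y ≠ 0 := fun x y hxy => by
    by_contra h0; exact hxy (if_neg h0)
  have hCF : ∀ x y, ‖mF x y‖ ≤ max C 0 := fun x y => by
    simp only [hmF]; split_ifs
    · exact (hC x y).trans (le_max_left _ _)
    · simp
  obtain ⟨TF, hTF⟩ := (squareFamily F).exists_adj hsF hCF
  let TF' : banded (squareFamily F) A := ⟨TF, mF, hTF, hsF, _, hCF⟩
  have hn : ‖TF'‖ ≤ ‖T‖ := by
    refine ContinuousLinearMap.opNorm_le_bound _ (norm_nonneg _) fun η => ?_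
    have e : TF.1 η = L2.trunc F (T.1.1 (L2.trunc F η)) := by
      ext x
      have h1 := hTF.hasSum η x
      rw [L2.trunc_val]
      split_ifs with hx
      · have h2 := hm.hasSum (L2.trunc F η) x
        refine h1.unique ?_
        convert h2 using 2 with y
        simp only [hmF, L2.trunc_val, hx, true_and]
        split_ifs <;> simp
      · refine h1.unique ?_
        convert hasSum_zero using 2 with y
        simp [hmF, hx]
    change ‖TF.1 η‖ ≤ _
    rw [e]
    refine (L2.norm_trunc_le _ _).trans ((T.1.1.le_opNorm _).trans ?_)
    exact mul_le_mul_of_nonneg_left (L2.norm_trunc_le _ _) (norm_nonneg _)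
  have hS := bandedMap_spec (squareFamily F) φ TF' hTF
  have hSn := (norm_bandedMap_square_le φ F TF').trans hn
  have e : ∀ x ∈ t, ((bandedMap E φ T).1 ξ).1 x =
      ((bandedMap (squareFamily F) φ TF').1 ξ).1 x := by
    intro x hx
    have h1 := hφ.hasSum ξ x
    have h2 := hS.hasSum ξ x
    refine h1.unique ?_
    convert h2 using 2 with y
    have hxF : x ∈ F := Finset.mem_union_left _ hx
    by_cases hy : y ∈ r x
    · have hyF : y ∈ F := Finset.mem_union_right _ (Finset.mem_biUnion.2 ⟨x, hx, hy⟩)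
      simp [hmF, hxF, hyF]
    · simp [hmF, hr' x y hy]
  rw [Finset.sum_congr rfl fun x hx => by rw [e x hx]]
  refine (L2.norm_sum_le _ t).trans ?_
  gcongr
  refine ((bandedMap (squareFamily F) φ TF').1.le_opNorm ξ).trans ?_
  exact mul_le_mul_of_nonneg_right hSn (norm_nonneg _)

theorem exists_matAlg_map {T : Adj X A} (hT : T ∈ matAlg E A) :
    ∃ S ∈ matAlg E B, ‖S‖ ≤ ‖T‖ ∧ ∀ m, IsMatrix T m → IsMatrix S (fun x y => φ (m x y)) := by
  obtain ⟨u, hu, hT⟩ := (mem_matAlg_iff E).1 hT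
  set v : ℕ → Adj X B := fun n => bandedMap E φ ⟨u n, hu n⟩ with hv
  have hc : CauchySeq v := by
    refine Metric.cauchySeq_iff.2 fun ε hε => ?_
    obtain ⟨N, hN⟩ := Metric.cauchySeq_iff.1 hT.cauchySeq ε hε
    refine ⟨N, fun i hi j hj => lt_of_le_of_lt ?_ (hN i hi j hj)⟩
    rw [dist_eq_norm, dist_eq_norm, hv]
    simp only [← map_sub]
    exact norm_bandedMap_le E φ _
  obtain ⟨S, hS⟩ := cauchySeq_tendsto_of_complete hc
  refine ⟨S, (mem_matAlg_iff E).2 ⟨v, fun n => bandedMap_mem E φ _, hS⟩, ?_, fun m hm => ?_⟩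
  · exact le_of_tendsto_of_tendsto' hS.norm hT.norm fun n => norm_bandedMap_le E φ ⟨u n, hu n⟩
  · choose μ hμ _ _ using fun n => hu n
    obtain ⟨m', h', hl⟩ := exists_isMatrix_of_tendsto hμ hT
    obtain ⟨m'', h'', hl'⟩ := exists_isMatrix_of_tendsto
      (fun n => bandedMap_spec E φ ⟨u n, hu n⟩ (hμ n)) hS
    convert h'' using 1
    funext x y
    rw [hm.unique h']
    have hcφ : Continuous φ :=
      AddMonoidHomClass.continuous_of_bound φ 1 fun a => by
        simpa using NonUnitalStarAlgHom.norm_apply_le φ a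
    exact tendsto_nhds_unique ((hcφ.tendsto _).comp (hl x y)) (hl' x y)

/-- The map `MatAlg E A → MatAlg E B` that applies `φ` to every matrix entry. -/
def matAlgFun (T : MatAlg E A) : MatAlg E B :=
  ⟨(exists_matAlg_map E φ T.2).choose, (exists_matAlg_map E φ T.2).choose_spec.1⟩

theorem matAlgFun_spec (T : MatAlg E A) {m : X → X → A} (h : IsMatrix T.1 m) :
    IsMatrix (matAlgFun E φ T).1 (fun x y => φ (m x y)) :=
  (exists_matAlg_map E φ T.2).choose_spec.2.2 m h

theorem norm_matAlgFun_le (T : MatAlg E A) : ‖matAlgFun E φ T‖ ≤ ‖T‖ :=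
  (exists_matAlg_map E φ T.2).choose_spec.2.1

theorem matAlgFun_eq {T : MatAlg E A} {m : X → X → A} (h : IsMatrix T.1 m) {S : MatAlg E B}
    (hS : IsMatrix S.1 (fun x y => φ (m x y))) : matAlgFun E φ T = S :=
  Subtype.ext ((matAlgFun_spec E φ T h).ext hS)

theorem matAlgFun_add (T T' : MatAlg E A) :
    matAlgFun E φ (T + T') = matAlgFun E φ T + matAlgFun E φ T' := by
  obtain ⟨m, hm⟩ := exists_isMatrix E T.2
  obtain ⟨m', hm'⟩ := exists_isMatrix E T'.2
  refine matAlgFun_eq E φ (T := T + T') (hm.add hm') ?_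
  simp only [map_add]
  exact (matAlgFun_spec E φ T hm).add (matAlgFun_spec E φ T' hm')

theorem matAlgFun_smul (c : ℂ) (T : MatAlg E A) :
    matAlgFun E φ (c • T) = c • matAlgFun E φ T := by
  obtain ⟨m, hm⟩ := exists_isMatrix E T.2
  refine matAlgFun_eq E φ (T := c • T) (hm.smul c) ?_
  simp only [map_smul]
  exact (matAlgFun_spec E φ T hm).smul c

theorem continuous_matAlgFun : Continuous (matAlgFun E φ) :=
  (LinearMap.mkContinuous
    ({ toFun := matAlgFun E φ, map_add' := matAlgFun_add E φ, map_smul' := matAlgFun_smul E φ } :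
      MatAlg E A →ₗ[ℂ] MatAlg E B) 1
    (fun T => (norm_matAlgFun_le E φ T).trans_eq (one_mul _).symm)).continuous

theorem matAlgFun_mul (T T' : MatAlg E A) :
    matAlgFun E φ (T * T') = matAlgFun E φ T * matAlgFun E φ T' := by
  obtain ⟨u, hu, hT⟩ := (mem_matAlg_iff E).1 T.2
  obtain ⟨u', hu', hT'⟩ := (mem_matAlg_iff E).1 T'.2
  have hle : banded E A ≤ matAlg E A := NonUnitalStarSubalgebra.le_topologicalClosure _
  set w : ℕ → MatAlg E A := fun n => ⟨u n, hle (hu n)⟩ with hw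
  set w' : ℕ → MatAlg E A := fun n => ⟨u' n, hle (hu' n)⟩ with hw'
  have hwT : Tendsto w atTop (𝓝 T) := (MatAlg.tendsto_iff E).2 hT
  have hwT' : Tendsto w' atTop (𝓝 T') := (MatAlg.tendsto_iff E).2 hT'
  have key : ∀ n, matAlgFun E φ (w n * w' n) = matAlgFun E φ (w n) * matAlgFun E φ (w' n) := by
    intro n
    obtain ⟨m, hm, hs, -⟩ := hu n
    obtain ⟨m', hm', -⟩ := hu' n
    obtain ⟨r, hr⟩ := E.rows hs
    have hr' : ∀ x y, y ∉ r x → m x y = 0 := fun x y hxy => by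
      rw [hr, not_not] at hxy; exact hxy
    refine matAlgFun_eq E φ (T := w n * w' n) (hm.mul hm' r hr') ?_
    have := (matAlgFun_spec E φ (w n) hm).mul (matAlgFun_spec E φ (w' n) hm') r
      (fun x y hxy => by rw [hr' x y hxy, map_zero])
    simp only [map_sum, map_mul]
    exact this
  have hc := continuous_matAlgFun E φ
  have h1 := (hc.tendsto _).comp (hwT.mul hwT')
  have h2 := ((hc.tendsto _).comp hwT).mul ((hc.tendsto _).comp hwT')
  refine tendsto_nhds_unique h1 ?_
  refine h2.congr fun n => ?_
  exact (key n).symm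

/-- The `⋆`-homomorphism `MatAlg E A → MatAlg E B` that applies `φ` to every matrix entry. -/
def matAlgMap : MatAlg E A →⋆ₙₐ[ℂ] MatAlg E B where
  toFun := matAlgFun E φ
  map_smul' := matAlgFun_smul E φ
  map_zero' := by simpa using matAlgFun_smul E φ 0 0
  map_add' := matAlgFun_add E φ
  map_mul' := matAlgFun_mul E φ
  map_star' T := by
    obtain ⟨m, hm⟩ := exists_isMatrix E T.2
    refine matAlgFun_eq E φ (T := star T) hm.star ?_
    simp only [map_star]
    exact (matAlgFun_spec E φ T hm).star

theorem matAlgMap_spec (T : MatAlg E A) {m : X → X → A} (h : IsMatrix T.1 m) :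
    IsMatrix (matAlgMap E φ T).1 (fun x y => φ (m x y)) := matAlgFun_spec E φ T h

theorem matAlgMap_eq {T : MatAlg E A} {m : X → X → A} (h : IsMatrix T.1 m) {S : MatAlg E B}
    (hS : IsMatrix S.1 (fun x y => φ (m x y))) : matAlgMap E φ T = S := matAlgFun_eq E φ h hS

end Map

theorem matAlgMap_id (T : MatAlg E A) : matAlgMap E (NonUnitalStarAlgHom.id ℂ A) T = T := by
  obtain ⟨m, hm⟩ := exists_isMatrix E T.2
  exact matAlgMap_eq E _ hm hm

theorem matAlgMap_comp (ψ : B →⋆ₙₐ[ℂ] C) (φ : A →⋆ₙₐ[ℂ] B) (T : MatAlg E A) :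
    matAlgMap E (ψ.comp φ) T = matAlgMap E ψ (matAlgMap E φ T) := by
  obtain ⟨m, hm⟩ := exists_isMatrix E T.2
  exact matAlgMap_eq E _ hm (matAlgMap_spec E ψ _ (matAlgMap_spec E φ T hm))

end MatrixAlgebras

section Functors

/-- A C⋆-algebra, not necessarily unital, as a bundled object. -/
structure CStarAlg : Type (u + 1) where
  carrier : Type u
  [inst : NonUnitalCStarAlgebra carrier]

instance : CoeSort CStarAlg.{u} (Type u) := ⟨CStarAlg.carrier⟩

attribute [instance] CStarAlg.inst

theorem starHom_continuous {A B : Type*} [NonUnitalCStarAlgebra A] [NonUnitalCStarAlgebra B]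
    (φ : A →⋆ₙₐ[ℂ] B) : Continuous φ :=
  AddMonoidHomClass.continuous_of_bound φ 1 fun a => by
    simpa using NonUnitalStarAlgHom.norm_apply_le φ a

/-- An endofunctor of the category of C⋆-algebras and `⋆`-homomorphisms. All endofunctors
considered here are given by entrywise or pointwise application of a `⋆`-homomorphism, followed by
passage to a quotient; therefore they respect linear relations between `⋆`-homomorphisms, and this
is made part of the structure. -/
structure Endofunctor : Type (u + 1) where
  obj : CStarAlg.{u} → CStarAlg.{u}
  map : ∀ {A B : CStarAlg.{u}}, (A →⋆ₙₐ[ℂ] B) → (obj A →⋆ₙₐ[ℂ] obj B)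
  map_id : ∀ A : CStarAlg.{u}, map (NonUnitalStarAlgHom.id ℂ A) = NonUnitalStarAlgHom.id ℂ (obj A)
  map_comp : ∀ {A B C : CStarAlg.{u}} (g : B →⋆ₙₐ[ℂ] C) (f : A →⋆ₙₐ[ℂ] B),
    map (g.comp f) = (map g).comp (map f)
  map_linear : ∀ {A B : CStarAlg.{u}} (n : ℕ) (f : Fin n → (A →⋆ₙₐ[ℂ] B)) (c : Fin n → ℂ),
    (∀ a, ∑ i, c i • f i a = 0) → ∀ a, ∑ i, c i • map (f i) a = 0

namespace Endofunctor

/-- The composition `B ↦ F (G B)`. -/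
def comp (F G : Endofunctor.{u}) : Endofunctor.{u} where
  obj B := F.obj (G.obj B)
  map f := F.map (G.map f)
  map_id A := by rw [G.map_id, F.map_id]
  map_comp g f := by rw [G.map_comp, F.map_comp]
  map_linear n f c h := F.map_linear n _ c (G.map_linear n f c h)

/-- The identity functor. -/
def ident : Endofunctor.{u} where
  obj B := B
  map f := f
  map_id _ := rfl
  map_comp _ _ := rfl
  map_linear _ _ _ h := h

/-- The functor `B ↦ F B / J B`, for a natural choice of ideals `J B` in `F B`. -/
def quot (F : Endofunctor.{u}) (J : ∀ B : CStarAlg.{u}, CStarIdeal (F.obj B))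
    (hJ : ∀ {A B : CStarAlg.{u}} (f : A →⋆ₙₐ[ℂ] B), ∀ a ∈ (J A).toSubmodule,
      F.map f a ∈ (J B).toSubmodule) : Endofunctor.{u} where
  obj B := ⟨(J B).Quot⟩
  map {A B} f := CStarIdeal.Quot.map (J := J A) (K := J B) (F.map f) (hJ f)
  map_id A := by
    ext x
    obtain ⟨a, rfl⟩ := CStarIdeal.Quot.mk_surjective _ x
    rw [CStarIdeal.Quot.map_mk, F.map_id]; rfl
  map_comp g f := by
    ext x
    obtain ⟨a, rfl⟩ := CStarIdeal.Quot.mk_surjective _ x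
    rw [CStarIdeal.Quot.map_mk, F.map_comp]; rfl
  map_linear {A B} n f c h x := by
    obtain ⟨a, rfl⟩ := CStarIdeal.Quot.mk_surjective (J A) x
    have := F.map_linear n f c h a
    have h2 := congrArg (CStarIdeal.Quot.mk (J B)) this
    simp only [map_sum, map_smul, map_zero] at h2
    exact h2

section

variable (F : Endofunctor.{u}) {A B C : CStarAlg.{u}}

theorem map_comp_apply (g : B →⋆ₙₐ[ℂ] C) (f : A →⋆ₙₐ[ℂ] B) (a : F.obj A) :
    F.map g (F.map f a) = F.map (g.comp f) a := by rw [F.map_comp]; rfl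

theorem map_zero_apply (a : F.obj A) : F.map (0 : A →⋆ₙₐ[ℂ] B) a = 0 := by
  have := F.map_linear 1 (fun _ => (0 : A →⋆ₙₐ[ℂ] B)) (fun _ => 1) (by simp) a
  simpa using this

theorem map_add_of {f g h : A →⋆ₙₐ[ℂ] B} (hf : ∀ a, f a = g a + h a) (a : F.obj A) :
    F.map f a = F.map g a + F.map h a := by
  have := F.map_linear 3 ![f, g, h] ![1, -1, -1]
    (by intro a; simp [Fin.sum_univ_three, hf]) a
  simp only [Fin.sum_univ_three, Matrix.cons_val_zero, Matrix.cons_val_one, Matrix.cons_val,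
    one_smul, neg_smul] at this
  rw [add_assoc, ← neg_add, ← sub_eq_add_neg, sub_eq_zero] at this
  exact this

theorem map_add_sub_of {f g h k : A →⋆ₙₐ[ℂ] B} (hf : ∀ a, f a = g a + h a - k a) (a : F.obj A) :
    F.map f a = F.map g a + F.map h a - F.map k a := by
  have := F.map_linear 4 ![f, k, g, h] ![1, 1, -1, -1]
    (by intro a; simp [Fin.sum_univ_four, hf]) a
  simp only [Fin.sum_univ_four, Matrix.cons_val_zero, Matrix.cons_val_one, Matrix.cons_val,
    one_smul, neg_smul] at this
  rw [eq_sub_iff_add_eq, ← sub_eq_zero, ← this]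
  abel

end

end Endofunctor

/-- The direct sum `B ⊕ C`. -/
def prodAlg (B C : CStarAlg.{u}) : CStarAlg.{u} := ⟨B × C⟩

section Product

variable (B C : CStarAlg.{u})

/-- The first projection. -/
def pr₁ : prodAlg B C →⋆ₙₐ[ℂ] B := NonUnitalStarAlgHom.fst ℂ B C
/-- The second projection. -/
def pr₂ : prodAlg B C →⋆ₙₐ[ℂ] C := NonUnitalStarAlgHom.snd ℂ B C
/-- The first inclusion. -/
def in₁ : B →⋆ₙₐ[ℂ] prodAlg B C := NonUnitalStarAlgHom.inl ℂ B C
/-- The second inclusion. -/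
def in₂ : C →⋆ₙₐ[ℂ] prodAlg B C := NonUnitalStarAlgHom.inr ℂ B C

theorem pr₁_in₁ : (pr₁ B C).comp (in₁ B C) = NonUnitalStarAlgHom.id ℂ B := rfl
theorem pr₂_in₂ : (pr₂ B C).comp (in₂ B C) = NonUnitalStarAlgHom.id ℂ C := rfl
theorem pr₁_in₂ : (pr₁ B C).comp (in₂ B C) = 0 := rfl
theorem pr₂_in₁ : (pr₂ B C).comp (in₁ B C) = 0 := rfl

theorem eq_add_in (x : prodAlg B C) : x = in₁ B C (pr₁ B C x) + in₂ B C (pr₂ B C x) :=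
  Prod.ext (add_zero x.1).symm (zero_add x.2).symm

variable {B C}

/-- The homomorphism into a direct sum with given components. -/
def pairHom {A : CStarAlg.{u}} (f : A →⋆ₙₐ[ℂ] B) (g : A →⋆ₙₐ[ℂ] C) : A →⋆ₙₐ[ℂ] prodAlg B C :=
  NonUnitalStarAlgHom.prod f g

end Product

namespace Endofunctor

variable (F : Endofunctor.{u}) (B C : CStarAlg.{u})

/-- The canonical map `F (B ⊕ C) → F B ⊕ F C`. -/
def lc : F.obj (prodAlg B C) →⋆ₙₐ[ℂ] prodAlg (F.obj B) (F.obj C) :=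
  pairHom (F.map (pr₁ B C)) (F.map (pr₂ B C))

theorem map_eq_add_in (x : F.obj (prodAlg B C)) :
    x = F.map (in₁ B C) (F.map (pr₁ B C) x) + F.map (in₂ B C) (F.map (pr₂ B C) x) := by
  have := F.map_add_of (f := NonUnitalStarAlgHom.id ℂ (prodAlg B C))
    (g := (in₁ B C).comp (pr₁ B C)) (h := (in₂ B C).comp (pr₂ B C)) (eq_add_in B C) x
  rw [F.map_id] at this
  simp only [← map_comp_apply] at this
  exact this

theorem lc_injective : Function.Injective (F.lc B C) := by
  intro x y h
  have h1 : F.map (pr₁ B C) x = F.map (pr₁ B C) y := congrArg Prod.fst h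
  have h2 : F.map (pr₂ B C) x = F.map (pr₂ B C) y := congrArg Prod.snd h
  rw [F.map_eq_add_in B C x, F.map_eq_add_in B C y, h1, h2]

theorem lc_add_in (x : F.obj B) (y : F.obj C) :
    F.lc B C (F.map (in₁ B C) x + F.map (in₂ B C) y) = (x, y) := by
  refine Prod.ext ?_ ?_
  · change F.map (pr₁ B C) _ = x
    rw [map_add, map_comp_apply, map_comp_apply, pr₁_in₁, pr₁_in₂, F.map_id, map_zero_apply,
      add_zero]
    rfl
  · change F.map (pr₂ B C) _ = y
    rw [map_add, map_comp_apply, map_comp_apply, pr₂_in₁, pr₂_in₂, F.map_id, map_zero_apply,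
      zero_add]
    rfl

theorem lc_bijective : Function.Bijective (F.lc B C) :=
  ⟨F.lc_injective B C, fun p => ⟨_, F.lc_add_in B C p.1 p.2⟩⟩

/-- The canonical isomorphism `F (B ⊕ C) ≅ F B ⊕ F C`. -/
def lcEquiv : F.obj (prodAlg B C) ≃⋆ₐ[ℂ] prodAlg (F.obj B) (F.obj C) :=
  StarAlgEquiv.ofBijective (F.lc B C) (F.lc_bijective B C)

/-- The inverse `F B ⊕ F C → F (B ⊕ C)` of the canonical isomorphism. -/
def prodInv : prodAlg (F.obj B) (F.obj C) →⋆ₙₐ[ℂ] F.obj (prodAlg B C) :=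
  ((F.lcEquiv B C).symm : prodAlg (F.obj B) (F.obj C) →⋆ₙₐ[ℂ] F.obj (prodAlg B C))

theorem prodInv_apply (p : prodAlg (F.obj B) (F.obj C)) :
    F.prodInv B C p = F.map (in₁ B C) p.1 + F.map (in₂ B C) p.2 := by
  refine F.lc_injective B C ?_
  rw [lc_add_in]
  exact (F.lcEquiv B C).apply_symm_apply p

end Endofunctor

/-- The cylinder `I B = C([0,1], B)`. -/
def cyl (B : CStarAlg.{u}) : CStarAlg.{u} := ⟨C(unitInterval, B)⟩

section Cylinder

variable (B : CStarAlg.{u})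

/-- Evaluation at `t`. -/
def ev (t : unitInterval) : cyl B →⋆ₙₐ[ℂ] B where
  toFun f := (show C(unitInterval, B) from f) t
  map_smul' _ _ := rfl
  map_zero' := rfl
  map_add' _ _ := rfl
  map_mul' _ _ := rfl
  map_star' _ := rfl

/-- The inclusion of constant functions. -/
def const : B →⋆ₙₐ[ℂ] cyl B where
  toFun b := ContinuousMap.const unitInterval b
  map_smul' _ _ := rfl
  map_zero' := rfl
  map_add' _ _ := rfl
  map_mul' _ _ := rfl
  map_star' _ := rfl

/-- Reparametrization of the cylinder. -/
def reparam (r : C(unitInterval, unitInterval)) : cyl B →⋆ₙₐ[ℂ] cyl B where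
  toFun f := (show C(unitInterval, B) from f).comp r
  map_smul' _ _ := rfl
  map_zero' := rfl
  map_add' _ _ := rfl
  map_mul' _ _ := rfl
  map_star' _ := rfl

variable {B}

theorem cyl_ext {f g : cyl B} (h : ∀ t, ev B t f = ev B t g) : f = g := ContinuousMap.ext h

theorem ev_reparam (r : C(unitInterval, unitInterval)) (t : unitInterval) :
    (ev B t).comp (reparam B r) = ev B (r t) := rfl

theorem ev_const (t : unitInterval) : (ev B t).comp (const B) = NonUnitalStarAlgHom.id ℂ B := rfl

end Cylinder

section Homotopy

variable (A : CStarAlg.{u}) (F : Endofunctor.{u}) (B : CStarAlg.{u})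

variable {A F B} in
/-- `F`-homotopy of `⋆`-homomorphisms `A → F B`: there is a `⋆`-homomorphism `Φ : A → F (I B)`
with `F(ev₀) ∘ Φ = φ₀` and `F(ev₁) ∘ Φ = φ₁`. -/
def FHomotopic (φ₀ φ₁ : A →⋆ₙₐ[ℂ] F.obj B) : Prop :=
  ∃ Φ : A →⋆ₙₐ[ℂ] F.obj (cyl B),
    (F.map (ev B 0)).comp Φ = φ₀ ∧ (F.map (ev B 1)).comp Φ = φ₁

namespace FHomotopic

variable {A F B}

theorem refl (φ : A →⋆ₙₐ[ℂ] F.obj B) : FHomotopic φ φ := by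
  refine ⟨(F.map (const B)).comp φ, ?_, ?_⟩ <;>
  · rw [← NonUnitalStarAlgHom.comp_assoc, ← F.map_comp, ev_const, F.map_id]; rfl

/-- Time reversal. -/
def revMap : C(unitInterval, unitInterval) := ⟨unitInterval.symm, unitInterval.continuous_symm⟩

theorem symm {φ ψ : A →⋆ₙₐ[ℂ] F.obj B} (h : FHomotopic φ ψ) : FHomotopic ψ φ := by
  obtain ⟨Φ, h0, h1⟩ := h
  refine ⟨(F.map (reparam B revMap)).comp Φ, ?_, ?_⟩
  · rw [← NonUnitalStarAlgHom.comp_assoc, ← F.map_comp, ev_reparam, ← h1]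
    congr 3; exact unitInterval.symm_zero
  · rw [← NonUnitalStarAlgHom.comp_assoc, ← F.map_comp, ev_reparam, ← h0]
    congr 3; exact unitInterval.symm_one

/-- Piecewise linear reparametrization. -/
def affMap (a b : ℝ) : C(unitInterval, unitInterval) :=
  ⟨fun t => Set.projIcc 0 1 zero_le_one (a * t + b), by fun_prop⟩

theorem affMap_apply (a b : ℝ) (t : unitInterval) :
    ((affMap a b t : unitInterval) : ℝ) = max 0 (min 1 (a * t + b)) := by
  simp [affMap, Set.projIcc]

theorem affMap_eq {a b : ℝ} {t : unitInterval} (h0 : 0 ≤ a * t + b) (h1 : a * t + b ≤ 1) :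
    ((affMap a b t : unitInterval) : ℝ) = a * t + b := by
  rw [affMap_apply, min_eq_right h1, max_eq_right h0]

theorem affMap_one {a b : ℝ} {t : unitInterval} (h : 1 ≤ a * t + b) : affMap a b t = 1 := by
  ext; rw [affMap_apply, min_eq_left h]; simp

theorem affMap_zero {a b : ℝ} {t : unitInterval} (h : a * t + b ≤ 0) : affMap a b t = 0 := by
  ext; rw [affMap_apply]
  rw [max_eq_left]; · rfl
  exact (min_le_right _ _).trans h

theorem trans {φ ψ χ : A →⋆ₙₐ[ℂ] F.obj B} (h : FHomotopic φ ψ) (h' : FHomotopic ψ χ) :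
    FHomotopic φ χ := by
  obtain ⟨Φ, hΦ0, hΦ1⟩ := h
  obtain ⟨Ψ, hΨ0, hΨ1⟩ := h'
  set a := reparam B (affMap 2 0) with ha
  set b := reparam B (affMap 2 (-1)) with hb
  set r₁ := reparam B (affMap (1 / 2) 0) with hr₁
  set r₂ := reparam B (affMap (1 / 2) (1 / 2)) with hr₂
  have t0 : ∀ t : unitInterval, (0 : ℝ) ≤ t := fun t => t.2.1
  have t1 : ∀ t : unitInterval, (t : ℝ) ≤ 1 := fun t => t.2.2
  let θ : A → F.obj (cyl B) := fun x =>
    F.map a (Φ x) + F.map b (Ψ x) - F.map (const B) (ψ x)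
  have hψ : ∀ x, ψ x = F.map (ev B 1) (Φ x) := fun x => by rw [← hΦ1]; rfl
  have hψ' : ∀ x, ψ x = F.map (ev B 0) (Ψ x) := fun x => by rw [← hΨ0]; rfl
  -- the compositions with the two restriction maps
  have e1a : r₁.comp a = NonUnitalStarAlgHom.id ℂ (cyl B) := by
    ext f; refine cyl_ext fun t => ?_
    change ev B (affMap 2 0 (affMap (1 / 2) 0 t)) f = ev B t f
    congr 2; ext; have e := affMap_eq (a := 1 / 2) (b := 0) (t := t) (by linarith [t0 t])
      (by linarith [t1 t])
    rw [affMap_eq, e]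
    · ring
    · rw [e]; linarith [t0 t]
    · rw [e]; linarith [t1 t]
  have e1b : r₁.comp b = (const B).comp (ev B 0) := by
    ext f; refine cyl_ext fun t => ?_
    change ev B (affMap 2 (-1) (affMap (1 / 2) 0 t)) f = ev B 0 f
    congr 2; apply affMap_zero; rw [affMap_apply]
    rw [min_eq_right (by linarith [t1 t]), max_eq_right (by linarith [t0 t])]
    linarith [t1 t]
  have e2a : r₂.comp a = (const B).comp (ev B 1) := by
    ext f; refine cyl_ext fun t => ?_
    change ev B (affMap 2 0 (affMap (1 / 2) (1 / 2) t)) f = ev B 1 f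
    congr 2; apply affMap_one; rw [affMap_apply]
    rw [min_eq_right (by linarith [t1 t]), max_eq_right (by linarith [t0 t])]
    linarith [t0 t]
  have e2b : r₂.comp b = NonUnitalStarAlgHom.id ℂ (cyl B) := by
    ext f; refine cyl_ext fun t => ?_
    change ev B (affMap 2 (-1) (affMap (1 / 2) (1 / 2) t)) f = ev B t f
    congr 2; ext; have e := affMap_eq (a := 1 / 2) (b := 1 / 2) (t := t) (by linarith [t0 t])
      (by linarith [t1 t])
    rw [affMap_eq, e]
    · ring
    · rw [e]; linarith [t0 t]
    · rw [e]; linarith [t1 t]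
  have R1 : ∀ x, F.map r₁ (θ x) = Φ x := fun x => by
    have ec' : r₁.comp ((const B).comp (ev B 0)) = (const B).comp (ev B 0) := rfl
    simp only [θ, map_sub, map_add, Endofunctor.map_comp_apply, e1a, e1b, ec', hψ']
    rw [F.map_id]; exact add_sub_cancel_right _ _
  have R2 : ∀ x, F.map r₂ (θ x) = Ψ x := fun x => by
    have ec' : r₂.comp ((const B).comp (ev B 1)) = (const B).comp (ev B 1) := rfl
    simp only [θ, map_sub, map_add, Endofunctor.map_comp_apply, e2a, e2b, ec', hψ]
    rw [F.map_id]; exact add_sub_cancel_left _ _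
  -- joint injectivity of the two restriction maps
  have hid : ∀ f : cyl B, NonUnitalStarAlgHom.id ℂ (cyl B) f =
      (a.comp r₁) f + (b.comp r₂) f - ((const B).comp ((ev B 0).comp r₂)) f := by
    intro f; refine cyl_ext fun t => ?_
    change ev B t f = ev B (affMap (1 / 2) 0 (affMap 2 0 t)) f
      + ev B (affMap (1 / 2) (1 / 2) (affMap 2 (-1) t)) f - ev B (affMap (1 / 2) (1 / 2) 0) f
    have z0 : ((0 : unitInterval) : ℝ) = 0 := rfl
    rcases le_total (t : ℝ) (1 / 2) with ht | ht
    · have e1 : affMap (1 / 2) 0 (affMap 2 0 t) = t := by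
        ext; simp only [affMap_apply]
        rw [min_eq_right (a := 1) (b := 2 * (t : ℝ) + 0) (by linarith),
          max_eq_right (a := 0) (b := 2 * (t : ℝ) + 0) (by linarith [t0 t])]
        rw [min_eq_right (by linarith [t1 t]), max_eq_right (by linarith [t0 t])]
        ring
      have e2 : affMap 2 (-1) t = 0 := affMap_zero (by linarith)
      rw [e1, e2, add_sub_cancel_right]
    · have e1 : affMap (1 / 2) (1 / 2) (affMap 2 (-1) t) = t := by
        ext; simp only [affMap_apply]
        rw [min_eq_right (a := 1) (b := 2 * (t : ℝ) + -1) (by linarith [t1 t]),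
          max_eq_right (a := 0) (b := 2 * (t : ℝ) + -1) (by linarith)]
        rw [min_eq_right (by linarith [t1 t]), max_eq_right (by linarith [t0 t])]
        ring
      have e2 : affMap (1 / 2) 0 (affMap 2 0 t) = affMap (1 / 2) (1 / 2) 0 := by
        have : affMap 2 0 t = 1 := affMap_one (by linarith)
        rw [this]
        ext; simp only [affMap_apply, z0]; norm_num
      rw [e1, e2, add_sub_cancel_left]
  have inj : ∀ {x y : F.obj (cyl B)}, F.map r₁ x = F.map r₁ y → F.map r₂ x = F.map r₂ y →
      x = y := by
    intro x y h1 h2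
    have key : ∀ z : F.obj (cyl B), z = F.map a (F.map r₁ z) + F.map b (F.map r₂ z)
        - F.map ((const B).comp (ev B 0)) (F.map r₂ z) := fun z => by
      have := F.map_add_sub_of hid z
      rw [F.map_id] at this
      simp only [Endofunctor.map_comp_apply]
      exact this
    rw [key x, key y, h1, h2]
  let Θ : A →⋆ₙₐ[ℂ] F.obj (cyl B) :=
    { toFun := θ
      map_smul' := fun c x => inj (by simp only [map_smul, R1, MonoidHom.id_apply])
        (by simp only [map_smul, R2, MonoidHom.id_apply])
      map_zero' := inj (by simp only [map_zero, R1]) (by simp only [map_zero, R2])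
      map_add' := fun x y => inj (by simp only [map_add, R1]) (by simp only [map_add, R2])
      map_mul' := fun x y => inj (by simp only [map_mul, R1]) (by simp only [map_mul, R2])
      map_star' := fun x => inj (by simp only [map_star, R1]) (by simp only [map_star, R2]) }
  refine ⟨Θ, ?_, ?_⟩
  · have : ev B 0 = (ev B 0).comp r₁ := by
      rw [hr₁, ev_reparam]; congr 1
      exact (affMap_zero (by simp)).symm
    rw [this, F.map_comp, ← hΦ0]
    ext x; exact congrArg (F.map (ev B 0)) (R1 x)
  · have : ev B 1 = (ev B 1).comp r₂ := by
      rw [hr₂, ev_reparam]; congr 1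
      exact (affMap_one (by simp; norm_num)).symm
    rw [this, F.map_comp, ← hΨ1]
    ext x; exact congrArg (F.map (ev B 1)) (R2 x)

end FHomotopic

/-- `F`-homotopy is an equivalence relation on `⋆`-homomorphisms `A → F B`. -/
def homotopySetoid : Setoid (A →⋆ₙₐ[ℂ] F.obj B) where
  r := FHomotopic
  iseqv := ⟨FHomotopic.refl, FHomotopic.symm, FHomotopic.trans⟩

/-- The set `[A, F, B]` of `F`-homotopy classes of `⋆`-homomorphisms `A → F B`. -/
def HomotopyClass : Type u := Quotient (homotopySetoid A F B)

variable {A F B} in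
/-- The class of a `⋆`-homomorphism. -/
def HomotopyClass.mk (φ : A →⋆ₙₐ[ℂ] F.obj B) : HomotopyClass A F B :=
  Quotient.mk (homotopySetoid A F B) φ

end Homotopy

end Functors

section ConcreteFunctors

open scoped NNReal BoundedContinuousFunction

section Asymptotic

/-- The algebra `𝔗 B = C_b([0,∞), B)` of bounded continuous functions. -/
def pathAlg (B : CStarAlg.{u}) : CStarAlg.{u} := ⟨ℝ≥0 →ᵇ B⟩

/-- Composition of a bounded continuous function with a `⋆`-homomorphism. -/
def pathMap {A B : CStarAlg.{u}} (φ : A →⋆ₙₐ[ℂ] B) : pathAlg A →⋆ₙₐ[ℂ] pathAlg B where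
  toFun f := BoundedContinuousFunction.ofNormedAddCommGroup
    (fun t => φ ((show ℝ≥0 →ᵇ A from f) t))
    ((starHom_continuous φ).comp (show ℝ≥0 →ᵇ A from f).continuous) ‖(show ℝ≥0 →ᵇ A from f)‖
    (fun t => (NonUnitalStarAlgHom.norm_apply_le φ _).trans
      (BoundedContinuousFunction.norm_coe_le_norm _ t))
  map_smul' c _ := BoundedContinuousFunction.ext fun _ => map_smul φ c _
  map_zero' := BoundedContinuousFunction.ext fun _ => map_zero φ
  map_add' _ _ := BoundedContinuousFunction.ext fun _ => map_add φ _ _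
  map_mul' _ _ := BoundedContinuousFunction.ext fun _ => map_mul φ _ _
  map_star' _ := BoundedContinuousFunction.ext fun _ => map_star φ _

/-- Evaluation of a bounded continuous function. -/
def pathEv {B : CStarAlg.{u}} (t : ℝ≥0) : pathAlg B →⋆ₙₐ[ℂ] B where
  toFun f := (show ℝ≥0 →ᵇ B from f) t
  map_smul' _ _ := rfl
  map_zero' := rfl
  map_add' _ _ := rfl
  map_mul' _ _ := rfl
  map_star' _ := rfl

theorem pathAlg_ext {B : CStarAlg.{u}} {f g : pathAlg B} (h : ∀ t, pathEv t f = pathEv t g) :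
    f = g := BoundedContinuousFunction.ext h

theorem norm_pathEv_le {B : CStarAlg.{u}} (f : pathAlg B) (t : ℝ≥0) : ‖pathEv t f‖ ≤ ‖f‖ :=
  BoundedContinuousFunction.norm_coe_le_norm (show ℝ≥0 →ᵇ B from f) t

/-- The functor `𝔗`. -/
def pathFunctor : Endofunctor.{u} where
  obj := pathAlg
  map := pathMap
  map_id _ := rfl
  map_comp _ _ := rfl
  map_linear n f c h a := pathAlg_ext fun t => by
    rw [map_sum, map_zero]
    exact h (pathEv t a)

/-- The ideal `𝔗₀ B = C_0([0,∞), B)` of functions that vanish at infinity. -/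
def nullIdeal (B : CStarAlg.{u}) : CStarIdeal (pathAlg B) where
  carrier := {f | Tendsto (fun t => pathEv t f) atTop (𝓝 0)}
  zero_mem' := by simp
  add_mem' := fun {f g} hf hg => by
    have : Tendsto (fun t => pathEv t f + pathEv t g) atTop (𝓝 (0 + 0)) := hf.add hg
    simpa only [Set.mem_ofPred_eq, map_add, add_zero] using this
  smul_mem' := fun c f hf => by
    have : Tendsto (fun t => c • pathEv t f) atTop (𝓝 (c • 0)) := hf.const_smul c
    simpa only [Set.mem_ofPred_eq, map_smul, smul_zero] using this
  isClosed' := by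
    refine isClosed_of_closure_subset fun f hf => ?_
    refine Metric.tendsto_nhds.2 fun ε hε => ?_
    obtain ⟨g, hg, hfg⟩ := Metric.mem_closure_iff.1 hf (ε / 2) (half_pos hε)
    filter_upwards [Metric.tendsto_nhds.1 hg (ε / 2) (half_pos hε)] with t ht
    have h1 := norm_pathEv_le (f - g) t
    rw [dist_eq_norm] at hfg
    rw [dist_zero_right] at ht ⊢
    have h2 : pathEv t f = pathEv t (f - g) + pathEv t g := by rw [map_sub, sub_add_cancel]
    rw [h2]
    exact (norm_add_le _ _).trans_lt (by linarith)
  mul_left_mem := fun f {j} hj => by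
    refine squeeze_zero_norm (a := fun t => ‖f‖ * ‖pathEv t j‖) (fun t => ?_) ?_
    · rw [map_mul]
      exact (norm_mul_le _ _).trans
        (mul_le_mul_of_nonneg_right (norm_pathEv_le f t) (norm_nonneg _))
    · have := (tendsto_norm_zero.comp hj).const_mul ‖f‖
      simpa using this
  mul_right_mem := fun f {j} hj => by
    refine squeeze_zero_norm (a := fun t => ‖pathEv t j‖ * ‖f‖) (fun t => ?_) ?_
    · rw [map_mul]
      exact (norm_mul_le _ _).trans
        (mul_le_mul_of_nonneg_left (norm_pathEv_le f t) (norm_nonneg _))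
    · have := (tendsto_norm_zero.comp hj).mul_const ‖f‖
      simpa using this
  star_mem' := fun {j} hj => by
    have : Tendsto (fun t => star (pathEv t j)) atTop (𝓝 (star 0)) := hj.star
    simpa only [Set.mem_ofPred_eq, map_star, star_zero] using this

/-- The asymptotic algebra functor `𝔄 = 𝔗 / 𝔗₀`. -/
def asymFunctor : Endofunctor.{u} :=
  pathFunctor.quot nullIdeal fun {A B} φ f hf => by
    have : Tendsto (fun t => φ (pathEv t f)) atTop (𝓝 (φ 0)) :=
      ((starHom_continuous φ).tendsto 0).comp hf
    rw [map_zero] at this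
    exact this

/-- The inclusion of constant functions `B → 𝔗 B`. -/
def pathConst (B : CStarAlg.{u}) : B →⋆ₙₐ[ℂ] pathAlg B where
  toFun b := BoundedContinuousFunction.const ℝ≥0 b
  map_smul' _ _ := rfl
  map_zero' := rfl
  map_add' _ _ := rfl
  map_mul' _ _ := rfl
  map_star' _ := rfl

/-- The canonical map `α_B : B → 𝔄 B`, which sends `b` to the class of the constant function. -/
def asymUnit (B : CStarAlg.{u}) : B →⋆ₙₐ[ℂ] asymFunctor.obj B :=
  (CStarIdeal.Quot.mk (nullIdeal B)).comp (pathConst B)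

theorem asymUnit_natural {A B : CStarAlg.{u}} (f : A →⋆ₙₐ[ℂ] B) :
    (asymFunctor.map f).comp (asymUnit A) = (asymUnit B).comp f := rfl

/-- The iterates `𝔄ⁿ`, with `𝔄ⁿ⁺¹ = 𝔄 ∘ 𝔄ⁿ`. -/
def asymIter : ℕ → Endofunctor.{u}
  | 0 => Endofunctor.ident
  | n + 1 => asymFunctor.comp (asymIter n)

end Asymptotic

section Matrix

/-- The functor that sends `B` to the closure of the `B`-valued, uniformly bounded matrices with
support in the family `E`, and a `⋆`-homomorphism to its entrywise application. -/
def matFunctor {X : Type v} (E : SupportFamily X) : Endofunctor.{max u v} where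
  obj B := ⟨MatAlg E B⟩
  map φ := matAlgMap E φ
  map_id A := NonUnitalStarAlgHom.ext fun T => matAlgMap_id E T
  map_comp g f := NonUnitalStarAlgHom.ext fun T => matAlgMap_comp E g f T
  map_linear {A B} n f c h T := by
    obtain ⟨m, hm⟩ := exists_isMatrix E T.2
    have key : ∀ s : Finset (Fin n), IsMatrix (∑ i ∈ s, c i • matAlgMap E (f i) T).1
        (fun x y => ∑ i ∈ s, c i • f i (m x y)) := by
      classical
      intro s
      induction s using Finset.induction_on with
      | empty => exact IsMatrix.zero
      | insert i s hi ih =>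
        simp only [Finset.sum_insert hi]
        exact ((matAlgMap_spec E (f i) T hm).smul (c i)).add ih
    have h2 := key Finset.univ
    simp only [h] at h2
    exact Subtype.ext (h2.ext IsMatrix.zero)

/-- Finite supports. -/
def finiteFamily (X : Type v) : SupportFamily X where
  IsSupp R := ∃ F : Finset X, ∀ x y, R x y → x ∈ F ∧ y ∈ F
  empty := ⟨∅, by simp⟩
  mono h := fun ⟨F, hF⟩ => ⟨F, fun x y hxy => hF x y (h x y hxy)⟩
  union := by
    classical
    rintro R R' ⟨F, hF⟩ ⟨F', hF'⟩
    refine ⟨F ∪ F', fun x y hxy => ?_⟩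
    simp only [Finset.mem_union]
    rcases hxy with h | h
    · exact ⟨.inl (hF x y h).1, .inl (hF x y h).2⟩
    · exact ⟨.inr (hF' x y h).1, .inr (hF' x y h).2⟩
  inv := fun ⟨F, hF⟩ => ⟨F, fun x y hxy => (hF y x hxy).symm⟩
  comp := by
    classical
    rintro R R' ⟨F, hF⟩ ⟨F', hF'⟩
    refine ⟨F ∪ F', fun x y ⟨z, h1, h2⟩ => ?_⟩
    simp only [Finset.mem_union]
    exact ⟨.inl (hF x z h1).1, .inr (hF' z y h2).2⟩
  row_bdd := fun ⟨F, hF⟩ => ⟨F.card, fun x => by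
    rw [← Set.encard_coe_eq_coe_finsetCard]
    exact Set.encard_le_encard fun y hy => (hF x y hy).2⟩

/-- The functor `𝕂`, which sends `B` to the closure `𝕂 B` of the finitely supported
`ℕ × ℕ`-matrices with entries in `B`. -/
def compactFunctor : Endofunctor.{u} := matFunctor.{u, 0} (finiteFamily ℕ)

/-- Bounded geometry: for every radius, the balls have uniformly bounded cardinality. -/
class BoundedGeometry (X : Type v) [MetricSpace X] : Prop where
  card_ball_le : ∀ R : ℝ, 0 < R → ∃ k : ℕ, ∀ x : X, (Metric.closedBall x R).encard ≤ k

/-- Supports of finite propagation. -/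
def propagationFamily (X : Type v) [MetricSpace X] [BoundedGeometry X] : SupportFamily X where
  IsSupp R := ∃ r : ℝ, ∀ x y, R x y → dist x y ≤ r
  empty := ⟨0, by simp⟩
  mono h := fun ⟨r, hr⟩ => ⟨r, fun x y hxy => hr x y (h x y hxy)⟩
  union := fun ⟨r, hr⟩ ⟨r', hr'⟩ => ⟨max r r', fun x y hxy =>
    hxy.elim (fun h => (hr x y h).trans (le_max_left _ _))
      (fun h => (hr' x y h).trans (le_max_right _ _))⟩
  inv := fun ⟨r, hr⟩ => ⟨r, fun x y hxy => by rw [dist_comm]; exact hr y x hxy⟩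
  comp := fun ⟨r, hr⟩ ⟨r', hr'⟩ => ⟨r + r', fun x y ⟨z, h1, h2⟩ =>
    (dist_triangle x z y).trans (add_le_add (hr x z h1) (hr' z y h2))⟩
  row_bdd := fun {R} ⟨r, hr⟩ => by
    obtain ⟨k, hk⟩ := BoundedGeometry.card_ball_le (X := X) (max r 1) (by positivity)
    refine ⟨k, fun x => (Set.encard_le_encard fun y hy => ?_).trans (hk x)⟩
    rw [Metric.mem_closedBall, dist_comm]
    exact (hr x y hy).trans (le_max_left _ _)

/-- The uniform Roe functor `𝔐ᵘ_X`. -/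
def roeFunctor (X : Type u) [MetricSpace X] [BoundedGeometry X] : Endofunctor.{u} :=
  matFunctor.{u, u} (propagationFamily X)

variable {X : Type u} [MetricSpace X] [BoundedGeometry X] (X₀ : Set X)

/-- The matrices in `𝔐ᵘ_X B` that are supported in `N_R(X₀) × N_R(X₀)` for some `R > 0`. -/
def supportedNear (B : CStarAlg.{u}) : Set ((roeFunctor X).obj B) :=
  {T | ∃ R : ℝ, 0 < R ∧ ∃ m : X → X → B, IsMatrix T.1 m ∧
    ∀ x y, m x y ≠ 0 → x ∈ Metric.thickening R X₀ ∧ y ∈ Metric.thickening R X₀}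

theorem supportedNear_mul (B : CStarAlg.{u}) {S T : (roeFunctor X).obj B}
    (hS : S.1 ∈ banded (propagationFamily X) B) (hT : T ∈ supportedNear X₀ B) :
    S * T ∈ supportedNear X₀ B := by
  obtain ⟨n, hn, hs, -⟩ := hS
  obtain ⟨R, hR, m, hm, hmR⟩ := hT
  obtain ⟨r, hr⟩ := (propagationFamily X).rows hs
  have hmul := hn.mul hm r (fun x y hxy => by rw [hr, not_not] at hxy; exact hxy)
  obtain ⟨d, hd⟩ := hs
  refine ⟨R + max d 0, by positivity, _, hmul, fun x y hxy => ?_⟩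
  obtain ⟨z, -, hz⟩ := Finset.exists_ne_zero_of_sum_ne_zero hxy
  obtain ⟨h1, h2⟩ := hmR z y (right_ne_zero_of_mul hz)
  refine ⟨?_, Metric.thickening_mono (by simp) _ h2⟩
  obtain ⟨w, hw, hzw⟩ := Metric.mem_thickening_iff.1 h1
  refine Metric.mem_thickening_iff.2 ⟨w, hw, (dist_triangle x z w).trans_lt ?_⟩
  have := hd x z (left_ne_zero_of_mul hz)
  have := le_max_left d 0
  linarith

theorem star_mem_supportedNear (B : CStarAlg.{u}) {T : (roeFunctor X).obj B}
    (hT : T ∈ supportedNear X₀ B) : star T ∈ supportedNear X₀ B := by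
  obtain ⟨R, hR, m, hm, hmR⟩ := hT
  exact ⟨R, hR, _, hm.star, fun x y hxy => (hmR y x (star_ne_zero.1 hxy)).symm⟩

theorem star_mem_closure_supportedNear (B : CStarAlg.{u}) {T : (roeFunctor X).obj B}
    (hT : T ∈ closure (supportedNear X₀ B)) : star T ∈ closure (supportedNear X₀ B) :=
  map_mem_closure continuous_star hT fun _ h => star_mem_supportedNear X₀ B h

theorem mul_mem_closure_supportedNear (B : CStarAlg.{u}) (S : (roeFunctor X).obj B)
    {T : (roeFunctor X).obj B} (hT : T ∈ closure (supportedNear X₀ B)) :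
    S * T ∈ closure (supportedNear X₀ B) := by
  have hS : S ∈ closure {S : (roeFunctor X).obj B | S.1 ∈ banded (propagationFamily X) B} := by
    obtain ⟨w, hw, hS⟩ := (mem_matAlg_iff (propagationFamily X)).1 S.2
    have hle : banded (propagationFamily X) B ≤ matAlg (propagationFamily X) B :=
      NonUnitalStarSubalgebra.le_topologicalClosure _
    let w' : ℕ → MatAlg (propagationFamily X) B := fun n => ⟨w n, hle (hw n)⟩
    exact mem_closure_iff_seq_limit.2 ⟨w', hw, (MatAlg.tendsto_iff _).2 hS⟩
  exact map_mem_closure₂ continuous_mul hS hT fun _ h _ h' => supportedNear_mul X₀ B h h'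

/-- The ideal `𝔐ᵘ_{X ⊃ X₀} B`, the closure of the set of matrices supported near `X₀ × X₀`. -/
def relIdeal (B : CStarAlg.{u}) : CStarIdeal ((roeFunctor X).obj B) where
  carrier := closure (supportedNear X₀ B)
  zero_mem' := subset_closure ⟨1, one_pos, _, IsMatrix.zero, by simp⟩
  add_mem' := fun hS hT => map_mem_closure₂ continuous_add hS hT (by
    rintro S ⟨R, hR, m, hm, h⟩ T ⟨R', hR', m', hm', h'⟩
    refine ⟨max R R', lt_max_of_lt_left hR, _, hm.add hm', fun x y hxy => ?_⟩
    have i := Metric.thickening_mono (le_max_left R R') X₀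
    have i' := Metric.thickening_mono (le_max_right R R') X₀
    by_cases h0 : m x y = 0
    · have h1 : m' x y ≠ 0 := fun h1 => hxy (by rw [h0, h1, add_zero])
      exact ⟨i' (h' x y h1).1, i' (h' x y h1).2⟩
    · exact ⟨i (h x y h0).1, i (h x y h0).2⟩)
  smul_mem' := fun c _ hT => map_mem_closure (continuous_const_smul c) hT (by
    rintro T ⟨R, hR, m, hm, h⟩
    exact ⟨R, hR, _, hm.smul c, fun x y hxy => h x y (right_ne_zero_of_smul hxy)⟩)
  isClosed' := isClosed_closure
  mul_left_mem := fun S _ hT => mul_mem_closure_supportedNear X₀ B S hT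
  mul_right_mem := fun S T hT => by
    have := star_mem_closure_supportedNear X₀ B (mul_mem_closure_supportedNear X₀ B (star S)
      (star_mem_closure_supportedNear X₀ B hT))
    simpa only [star_mul, star_star] using this
  star_mem' := fun hT => star_mem_closure_supportedNear X₀ B hT

/-- The relative uniform Roe functor `𝔑ᵘ_{X, X₀} = 𝔐ᵘ_X / 𝔐ᵘ_{X ⊃ X₀}`. -/
def relRoeFunctor : Endofunctor.{u} :=
  (roeFunctor X).quot (relIdeal X₀) fun {A B} φ _ hT =>
    map_mem_closure (starHom_continuous ((roeFunctor X).map φ)) hT (by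
      rintro T ⟨R, hR, m, hm, h⟩
      exact ⟨R, hR, _, matAlgMap_spec _ φ T hm, fun x y hxy =>
        h x y fun h0 => hxy (by rw [h0, map_zero])⟩)

end Matrix

end ConcreteFunctors

section Isometries

section Shift

variable {X B : Type*} [NonUnitalCStarAlgebra B]

theorem extend_eq_zero {g : X → X} {ξ : X → B} {x : X} (hx : x ∉ Set.range g) :
    Function.extend g ξ 0 x = 0 := by
  rw [Function.extend_apply' _ _ _ (fun h => hx h)]; rfl

theorem summable_extend {g : X → X} (hg : Function.Injective g) (ξ : L2 X B) :
    Summable fun x => star (Function.extend g ξ.1 0 x) * Function.extend g ξ.1 0 x := by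
  rw [← hg.summable_iff]
  · refine ξ.2.congr fun x => ?_
    simp only [Function.comp_apply, hg.extend_apply]
  · intro x hx
    rw [extend_eq_zero hx, mul_zero]

theorem ip_extend {g : X → X} (hg : Function.Injective g) (ξ η : L2 X B) :
    L2.ip (L2.mk _ (summable_extend hg ξ)) η = ∑' x, star (ξ.1 x) * η.1 (g x) := by
  rw [L2.ip, ← hg.tsum_eq]
  · simp only [L2.mk_val, hg.extend_apply]
  · intro x hx
    by_contra h
    refine hx ?_
    simp only [L2.mk_val, extend_eq_zero h, star_zero, zero_mul]

/-- The isometry `e_x ↦ e_{g x}` of `ℓ²(X, B)`, for an injective map `g`. -/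
def shiftL {g : X → X} (hg : Function.Injective g) : L2 X B →L[ℂ] L2 X B :=
  LinearMap.mkContinuous
    { toFun := fun ξ => L2.mk (Function.extend g ξ.1 0) (summable_extend hg ξ)
      map_add' := fun ξ η => L2.ext fun x => by
        by_cases hx : x ∈ Set.range g
        · obtain ⟨i, rfl⟩ := hx
          simp only [L2.add_val, L2.mk_val, hg.extend_apply]
        · simp only [L2.add_val, L2.mk_val, extend_eq_zero hx, add_zero]
      map_smul' := fun c ξ => L2.ext fun x => by
        by_cases hx : x ∈ Set.range g
        · obtain ⟨i, rfl⟩ := hx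
          simp only [L2.smul_val, L2.mk_val, hg.extend_apply, RingHom.id_apply]
        · simp only [L2.smul_val, L2.mk_val, extend_eq_zero hx, smul_zero, RingHom.id_apply] } 1
    (fun ξ => by
      rw [one_mul]
      refine le_of_eq ?_
      rw [L2.norm_def, L2.norm_def]
      congr 2
      refine (ip_extend hg ξ _).trans ?_
      refine tsum_congr fun x => ?_
      simp only [LinearMap.coe_mk, AddHom.coe_mk, L2.mk_val, hg.extend_apply])

/-- The adjoint of `shiftL`. -/
def pullL {g : X → X} (hg : Function.Injective g) : L2 X B →L[ℂ] L2 X B :=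
  LinearMap.mkContinuous
    { toFun := fun ξ => L2.mk (fun x => ξ.1 (g x)) (ξ.2.comp_injective hg)
      map_add' := fun _ _ => rfl
      map_smul' := fun _ _ => rfl } 1
    (fun ξ => by
      refine L2.norm_le_of_forall_sum _ (by positivity) fun t => ?_
      rw [one_mul]
      refine le_trans (le_of_eq ?_) (L2.norm_sum_le ξ (t.map ⟨g, hg⟩))
      rw [Finset.sum_map]; rfl)

/-- The isometry `e_x ↦ e_{g x}` as an adjointable operator. -/
def shift {g : X → X} (hg : Function.Injective g) : Adj X B :=
  ⟨shiftL hg, pullL hg, fun ξ η => ip_extend hg ξ η⟩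

theorem shift_val {g : X → X} (hg : Function.Injective g) (ξ : L2 X B) (x : X) :
    ((shift hg).1 ξ).1 x = Function.extend g ξ.1 0 x := rfl

theorem star_shift_val {g : X → X} (hg : Function.Injective g) (ξ : L2 X B) (x : X) :
    ((star (shift hg : Adj X B)).1 ξ).1 x = ξ.1 (g x) := by
  have : star (shift hg : Adj X B) = ⟨pullL hg, shiftL hg,
      IsAdjointPair.symm fun ξ η => ip_extend hg ξ η⟩ :=
    Adj.star_eq_of (fun ξ η => ip_extend hg ξ η)
  rw [this]; rfl

theorem Adj.ext_val {S T : Adj X B} (h : ∀ ξ x, (S.1 ξ).1 x = (T.1 ξ).1 x) : S = T :=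
  Subtype.ext (ContinuousLinearMap.ext fun ξ => L2.ext (h ξ))

theorem shift_mul_shift {g h : X → X} (hg : Function.Injective g) (hh : Function.Injective h) :
    (shift hg * shift hh : Adj X B) = shift (hg.comp hh) := by
  refine Adj.ext_val fun ξ x => ?_
  change Function.extend g (Function.extend h ξ.1 0) 0 x = Function.extend (g ∘ h) ξ.1 0 x
  by_cases hx : x ∈ Set.range g
  · obtain ⟨i, rfl⟩ := hx
    rw [hg.extend_apply]
    by_cases hi : i ∈ Set.range h
    · obtain ⟨j, rfl⟩ := hi
      rw [hh.extend_apply]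
      exact ((hg.comp hh).extend_apply ξ.1 0 j).symm
    · rw [extend_eq_zero hi, extend_eq_zero]
      rintro ⟨j, hj⟩
      exact hi ⟨j, hg hj⟩
  · rw [extend_eq_zero hx, extend_eq_zero]
    rintro ⟨j, rfl⟩
    exact hx ⟨_, rfl⟩

theorem shift_id : (shift Function.injective_id : Adj X B) = 1 := by
  refine Adj.ext_val fun ξ x => ?_
  exact Function.injective_id.extend_apply ξ.1 0 x

end Shift

section Conj

variable {X B : Type*} [NonUnitalCStarAlgebra B]

theorem Adj.map_op_smul (V : Adj X B) (b : Bᵐᵒᵖ) (ξ : L2 X B) : V.1 (b • ξ) = b • V.1 ξ := by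
  refine IsAdjointPair.ext_ip fun ζ => ?_
  rw [L2.ip_op_smul_right, ← V.isAdjointPair_star.symm, L2.ip_op_smul_right,
    V.isAdjointPair_star.symm]

theorem L2.single_mul (y : X) (a b : B) : L2.single y (a * b) = MulOpposite.op b • L2.single y a := by
  classical
  ext x
  change _ = (L2.single y a).1 x * b
  rw [L2.single_val, L2.single_val]; split_ifs <;> simp

theorem Adj.single_mul (V : Adj X B) (y : X) (a b : B) (x : X) :
    (V.1 (L2.single y (a * b))).1 x = (V.1 (L2.single y a)).1 x * b := by
  rw [L2.single_mul, V.map_op_smul]; rfl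

/-- The columns of the operator `V` are finitely supported. -/
def ColFinite (V : Adj X B) : Prop :=
  ∀ y, ∃ F : Finset X, ∀ b x, x ∉ F → (V.1 (L2.single y b)).1 x = 0

theorem mul_mem_banded {V : Adj X B} (hV : ColFinite V) {T : Adj X B}
    (hT : T ∈ banded (finiteFamily X) B) : V * T ∈ banded (finiteFamily X) B := by
  classical
  obtain ⟨m, hm, ⟨F, hF⟩, -⟩ := hT
  choose G hG using hV
  have hF' : ∀ x y, ¬ (x ∈ F ∧ y ∈ F) → m x y = 0 := fun x y h => by
    by_contra h0; exact h (hF x y h0)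
  have key : IsMatrix (V * T) fun x j => ∑ i ∈ F, (V.1 (L2.single i (m i j))).1 x := by
    intro x j b
    have e : T.1 (L2.single j b) = ∑ i ∈ F, L2.single i (m i j * b) := by
      ext z
      rw [hm z j b]
      rw [← L2.evalL_apply z, map_sum]
      simp only [L2.evalL_apply, L2.single_val]
      rw [Finset.sum_ite_eq]
      split_ifs with h
      · rfl
      · rw [hF' z j (fun h' => h h'.1), zero_mul]
    change (V.1 (T.1 (L2.single j b))).1 x = _
    rw [e, map_sum, ← L2.evalL_apply x, map_sum, Finset.sum_mul]
    exact Finset.sum_congr rfl fun i _ => V.single_mul i _ b x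
  refine ⟨_, key, ⟨F.biUnion G ∪ F, fun x y hxy => ?_⟩, _, key.norm_le⟩
  obtain ⟨i, hi, h0⟩ := Finset.exists_ne_zero_of_sum_ne_zero hxy
  refine ⟨Finset.mem_union_left _ (Finset.mem_biUnion.2 ⟨i, hi, ?_⟩), Finset.mem_union_right _ ?_⟩
  · by_contra h; exact h0 (hG i _ x h)
  · by_contra h
    refine h0 ?_
    rw [hF' i y (fun h' => h h'.2)]
    have : L2.single i (0 : B) = 0 := by
      ext z; rw [L2.single_val]; simp
    rw [this, map_zero]; rfl

theorem conj_mem {V : Adj X B} (hV : ColFinite V) {T : Adj X B}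
    (hT : T ∈ matAlg (finiteFamily X) B) : V * T * star V ∈ matAlg (finiteFamily X) B := by
  refine map_mem_closure (f := fun T : Adj X B => V * T * star V) ?_ hT fun S hS => ?_
  · exact (continuous_const.mul continuous_id).mul continuous_const
  · have h1 := mul_mem_banded hV hS
    have h2 := mul_mem_banded hV (star_mem h1)
    have h3 := star_mem h2
    rw [star_mul, star_star] at h3
    exact h3

/-- The map `T ↦ V T V⋆` on `𝕂 B`. -/
def conj {V : Adj X B} (hV : ColFinite V) :
    MatAlg (finiteFamily X) B →ₗ[ℂ] MatAlg (finiteFamily X) B where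
  toFun T := ⟨V * T.1 * star V, conj_mem hV T.2⟩
  map_add' S T := Subtype.ext (by
    change V * (S.1 + T.1) * star V = V * S.1 * star V + V * T.1 * star V
    rw [mul_add, add_mul])
  map_smul' c T := Subtype.ext (by
    change V * (c • T.1) * star V = c • (V * T.1 * star V)
    rw [mul_smul_comm, smul_mul_assoc])

theorem conj_val {V : Adj X B} (hV : ColFinite V) (T : MatAlg (finiteFamily X) B) :
    (conj hV T).1 = V * T.1 * star V := rfl

theorem conj_star {V : Adj X B} (hV : ColFinite V) (T : MatAlg (finiteFamily X) B) :
    conj hV (star T) = star (conj hV T) := Subtype.ext (by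
  rw [conj_val, MatAlg.val_star, MatAlg.val_star, conj_val, star_mul, star_mul, star_star,
    mul_assoc])

theorem conj_mul {V : Adj X B} (hV : ColFinite V) (h : star V * V = 1)
    (S T : MatAlg (finiteFamily X) B) : conj hV S * conj hV T = conj hV (S * T) := Subtype.ext (by
  rw [MatAlg.val_mul, conj_val, conj_val, conj_val, MatAlg.val_mul]
  calc V * S.1 * star V * (V * T.1 * star V) = V * S.1 * (star V * V) * T.1 * star V := by
        simp only [mul_assoc]
    _ = _ := by rw [h, mul_one, mul_assoc V])

theorem conj_mul_of_ortho {V W : Adj X B} (hV : ColFinite V) (hW : ColFinite W)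
    (h : star V * W = 0) (S T : MatAlg (finiteFamily X) B) : conj hV S * conj hW T = 0 :=
  Subtype.ext (by
  rw [MatAlg.val_mul, conj_val, conj_val, MatAlg.val_zero]
  calc V * S.1 * star V * (W * T.1 * star W) = V * S.1 * (star V * W) * T.1 * star W := by
        simp only [mul_assoc]
    _ = 0 := by rw [h, mul_zero, zero_mul, zero_mul])

theorem colFinite_shift {g : X → X} (hg : Function.Injective g) :
    ColFinite (shift hg : Adj X B) := fun y => ⟨{g y}, fun b x hx => by
  classical
  rw [shift_val]
  by_cases h : x ∈ Set.range g
  · obtain ⟨i, rfl⟩ := h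
    rw [hg.extend_apply, L2.single_val, if_neg]
    rintro rfl; simp at hx
  · exact extend_eq_zero h⟩

theorem conj_conj {g h : X → X} (hg : Function.Injective g) (hh : Function.Injective h)
    (T : MatAlg (finiteFamily X) B) :
    conj (colFinite_shift hg) (conj (colFinite_shift hh) T) =
      conj (colFinite_shift (hg.comp hh)) T := Subtype.ext (by
  rw [conj_val, conj_val, conj_val, ← shift_mul_shift hg hh, star_mul]
  simp only [mul_assoc])

theorem conj_id (T : MatAlg (finiteFamily X) B) :
    conj (colFinite_shift Function.injective_id) T = T := Subtype.ext (by
  rw [conj_val, shift_id, star_one, one_mul, mul_one])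

theorem isMatrix_conj_shift {g : X → X} (hg : Function.Injective g) {T : Adj X B} {m : X → X → B}
    (hm : IsMatrix T m) : IsMatrix (shift hg * T * star (shift hg))
      (fun x y => Function.extend g (fun i => Function.extend g (m i) 0 y) 0 x) := by
  classical
  intro x y b
  change Function.extend g (T.1 ((star (shift hg : Adj X B)).1 (L2.single y b))).1 0 x =
    Function.extend g (fun i => Function.extend g (m i) 0 y) 0 x * b
  by_cases hx : x ∈ Set.range g
  · obtain ⟨i, rfl⟩ := hx
    rw [hg.extend_apply, hg.extend_apply]
    by_cases hy : y ∈ Set.range g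
    · obtain ⟨j, rfl⟩ := hy
      have e : (star (shift hg : Adj X B)).1 (L2.single (g j) b) = L2.single j b := by
        ext z
        rw [star_shift_val, L2.single_val, L2.single_val]
        simp only [hg.eq_iff]
      rw [hg.extend_apply, ← hm, e]
    · have : (star (shift hg : Adj X B)).1 (L2.single y b) = 0 := by
        ext z
        rw [star_shift_val, L2.single_val, if_neg]
        · rfl
        · rintro rfl; exact hy ⟨_, rfl⟩
      rw [this, map_zero, extend_eq_zero hy, zero_mul]; rfl
  · rw [extend_eq_zero hx, extend_eq_zero hx, zero_mul]

theorem matAlgMap_conj_shift {A : Type*} [NonUnitalCStarAlgebra A] (f : A →⋆ₙₐ[ℂ] B) {g : X → X}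
    (hg : Function.Injective g) (T : MatAlg (finiteFamily X) A) :
    matAlgMap (finiteFamily X) f (conj (colFinite_shift hg) T) =
      conj (colFinite_shift hg) (matAlgMap (finiteFamily X) f T) := by
  obtain ⟨m, hm⟩ := exists_isMatrix _ T.2
  refine matAlgMap_eq _ f (T := conj (colFinite_shift hg) T) (isMatrix_conj_shift hg hm) ?_
  have e : (fun x y => f (Function.extend g (fun i => Function.extend g (m i) 0 y) 0 x)) =
      fun x y => Function.extend g (fun i => Function.extend g (fun j => f (m i j)) 0 y) 0 x := ?_
  · rw [e]
    exact isMatrix_conj_shift hg (matAlgMap_spec _ f T hm)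
  funext x y
  by_cases hx : x ∈ Set.range g
  · obtain ⟨i, rfl⟩ := hx
    rw [hg.extend_apply, hg.extend_apply]
    by_cases hy : y ∈ Set.range g
    · obtain ⟨j, rfl⟩ := hy
      rw [hg.extend_apply, hg.extend_apply]
    · rw [extend_eq_zero hy, extend_eq_zero hy, map_zero]
  · rw [extend_eq_zero hx, extend_eq_zero hx, map_zero]

/-- The entrywise application of a `⋆`-homomorphism to vectors. -/
def L2.mapVec {A : Type*} [NonUnitalCStarAlgebra A] (e : A →⋆ₙₐ[ℂ] B) (ξ : L2 X A) : L2 X B :=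
  L2.mk (fun x => e (ξ.1 x)) (by
    have := ξ.2.map e (starHom_continuous e)
    refine this.congr fun x => ?_
    rw [Function.comp_apply, map_mul, map_star])

theorem matAlgMap_mapVec {A : Type*} [NonUnitalCStarAlgebra A] (E : SupportFamily X)
    (e : A →⋆ₙₐ[ℂ] B) (T : MatAlg E A) (ξ : L2 X A) :
    (matAlgMap E e T).1.1 (L2.mapVec e ξ) = L2.mapVec e (T.1.1 ξ) := by
  obtain ⟨m, hm⟩ := exists_isMatrix E T.2
  ext x
  have h1 := (matAlgMap_spec E e T hm).hasSum (L2.mapVec e ξ) x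
  have h2 := (hm.hasSum ξ x).map e (starHom_continuous e)
  refine h1.unique (h2.congr_fun ?_)
  intro y
  exact (map_mul e _ _).symm

theorem MatAlg.ext_single (E : SupportFamily X) {S T : MatAlg E B}
    (h : ∀ y b, S.1.1 (L2.single y b) = T.1.1 (L2.single y b)) : S = T := by
  obtain ⟨m, hm⟩ := exists_isMatrix E T.2
  have hS : IsMatrix S.1 m := fun x y b => by rw [h]; exact hm x y b
  exact Subtype.ext (hS.ext hm)

theorem matAlgMap_conj {A : Type*} [NonUnitalCStarAlgebra A] (e : A →⋆ₙₐ[ℂ] B)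
    (he : Function.Surjective e) {W : Adj X A} {V : Adj X B} (hW : ColFinite W) (hV : ColFinite V)
    (h1 : ∀ ξ, V.1 (L2.mapVec e ξ) = L2.mapVec e (W.1 ξ))
    (h2 : ∀ ξ, (star V).1 (L2.mapVec e ξ) = L2.mapVec e ((star W).1 ξ))
    (T : MatAlg (finiteFamily X) A) :
    matAlgMap (finiteFamily X) e (conj hW T) = conj hV (matAlgMap (finiteFamily X) e T) := by
  classical
  refine MatAlg.ext_single _ fun y b => ?_
  obtain ⟨a, rfl⟩ := he b
  have hs : L2.single y (e a) = L2.mapVec e (L2.single y a) := by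
    ext x
    change _ = e ((L2.single y a).1 x)
    rw [L2.single_val, L2.single_val]; split_ifs <;> simp
  rw [hs, matAlgMap_mapVec]
  change L2.mapVec e (W.1 (T.1.1 ((star W).1 (L2.single y a)))) =
    V.1 ((matAlgMap (finiteFamily X) e T).1.1 ((star V).1 (L2.mapVec e (L2.single y a))))
  rw [h2, matAlgMap_mapVec, h1]

end Conj

section AdSum

variable {D B : CStarAlg.{u}} {S : Type} [Fintype S]

/-- A finite family of isometries with pairwise orthogonal ranges and finitely supported columns. -/
structure OrthoFamily (S : Type) (B : CStarAlg.{u}) where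
  op : S → Adj ℕ B
  colFinite : ∀ s, ColFinite (op s)
  iso : ∀ s, star (op s) * op s = 1
  ortho : ∀ s s', s ≠ s' → star (op s) * op s' = 0

/-- The map `T ↦ V T V⋆` on `𝕂 B`. -/
def conjK {V : Adj ℕ B} (hV : ColFinite V) :
    compactFunctor.obj B →ₗ[ℂ] compactFunctor.obj B := conj hV

theorem conjK_star {V : Adj ℕ B} (hV : ColFinite V) (T : compactFunctor.obj B) :
    conjK hV (star T) = star (conjK hV T) := conj_star hV T

theorem conjK_mul {V : Adj ℕ B} (hV : ColFinite V) (h : star V * V = 1)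
    (S T : compactFunctor.obj B) : conjK hV S * conjK hV T = conjK hV (S * T) := conj_mul hV h S T

theorem conjK_mul_of_ortho {V W : Adj ℕ B} (hV : ColFinite V) (hW : ColFinite W)
    (h : star V * W = 0) (S T : compactFunctor.obj B) : conjK hV S * conjK hW T = 0 :=
  conj_mul_of_ortho hV hW h S T

/-- The homomorphism `d ↦ ∑ₛ Vₛ pₛ(d) Vₛ⋆` into `𝕂 B`, for an orthogonal family of isometries
`Vₛ` and homomorphisms `pₛ` into `𝕂 B`. -/
def adSum (V : OrthoFamily S B) (p : S → (D →⋆ₙₐ[ℂ] compactFunctor.obj B)) :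
    D →⋆ₙₐ[ℂ] compactFunctor.obj B where
  toFun d := ∑ s, conjK (V.colFinite s) (p s d)
  map_smul' c d := by simp only [map_smul, MonoidHom.id_apply, Finset.smul_sum]
  map_zero' := by simp only [map_zero, Finset.sum_const_zero]
  map_add' d d' := by simp only [map_add, Finset.sum_add_distrib]
  map_mul' d d' := by
    classical
    rw [Finset.sum_mul_sum]
    refine Finset.sum_congr rfl fun s _ => ?_
    rw [Finset.sum_eq_single s]
    · rw [conjK_mul _ (V.iso s), map_mul]
    · intro s' _ hs
      exact conjK_mul_of_ortho _ _ (V.ortho s s' hs.symm) _ _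
    · simp
  map_star' d := by
    rw [star_sum]
    refine Finset.sum_congr rfl fun s _ => ?_
    rw [map_star, conjK_star]

theorem adSum_apply (V : OrthoFamily S B) (p : S → (D →⋆ₙₐ[ℂ] compactFunctor.obj B)) (d : D) :
    adSum V p d = ∑ s, conjK (V.colFinite s) (p s d) := rfl

/-- The family of isometries `e_i ↦ e_{g(s, i)}`, for a family of injective maps with pairwise
disjoint ranges. -/
def shiftFamily (B : CStarAlg.{u}) (g : S → ℕ → ℕ)
    (hg : ∀ s s' i j, g s i = g s' j → s = s' ∧ i = j) : OrthoFamily S B where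
  op s := shift (g := g s) fun i j h => (hg s s i j h).2
  colFinite s := colFinite_shift _
  iso s := Adj.ext_val fun ξ x => by
    have hi : Function.Injective (g s) := fun i j h => (hg s s i j h).2
    refine (star_shift_val hi _ x).trans ?_
    exact hi.extend_apply ξ.1 0 x
  ortho s s' hs := Adj.ext_val fun ξ x => by
    have hi : Function.Injective (g s) := fun i j h => (hg s s i j h).2
    refine (star_shift_val hi _ x).trans ?_
    refine extend_eq_zero ?_
    rintro ⟨j, hj⟩
    exact hs (hg _ _ _ _ hj).1.symm

end AdSum

end Isometries

section Rotation

section Diag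

variable {B : CStarAlg.{u}}

/-- Multiplication of a `B`-valued function on `[0,1]` by a real function. -/
def weight (r : C(unitInterval, ℝ)) (f : cyl B) : cyl B :=
  (⟨fun t => (r t : ℂ) • ev B t f, by
    have : Continuous fun t => ev B t f := (show C(unitInterval, B) from f).continuous
    fun_prop⟩ : C(unitInterval, B))

theorem ev_weight (r : C(unitInterval, ℝ)) (f : cyl B) (t : unitInterval) :
    ev B t (weight r f) = (r t : ℂ) • ev B t f := rfl

theorem weight_zero (r : C(unitInterval, ℝ)) : weight r (0 : cyl B) = 0 :=
  cyl_ext fun t => by rw [ev_weight, map_zero, smul_zero]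

theorem weight_add (r : C(unitInterval, ℝ)) (f g : cyl B) :
    weight r (f + g) = weight r f + weight r g :=
  cyl_ext fun t => by simp only [ev_weight, map_add, smul_add]

theorem weight_smul (r : C(unitInterval, ℝ)) (c : ℂ) (f : cyl B) :
    weight r (c • f) = c • weight r f :=
  cyl_ext fun t => by simp only [ev_weight, map_smul]; rw [smul_comm]

theorem star_weight_mul (r : C(unitInterval, ℝ)) (f g : cyl B) :
    star (weight r f) * g = star f * weight r g :=
  cyl_ext fun t => by
    simp only [ev_weight, map_mul, map_star, star_smul, smul_mul_assoc, mul_smul_comm]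
    simp

theorem weight_weight_add {c s : C(unitInterval, ℝ)} (h : ∀ t, c t ^ 2 + s t ^ 2 = 1)
    (f : cyl B) : weight c (weight c f) + weight s (weight s f) = f :=
  cyl_ext fun t => by
    simp only [ev_weight, map_add, smul_smul, ← add_smul]
    have : (c t : ℂ) * c t + s t * s t = 1 := by
      rw [← sq, ← sq]; exact_mod_cast h t
    rw [this, one_smul]

theorem weight_weight_zero {c s : C(unitInterval, ℝ)} (h : ∀ t, c t * s t = 0)
    (f : cyl B) : weight c (weight s f) = 0 :=
  cyl_ext fun t => by
    simp only [ev_weight, smul_smul, map_zero]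
    have : (c t : ℂ) * s t = 0 := by exact_mod_cast h t
    rw [this, zero_smul]

theorem star_weight_add {c s : C(unitInterval, ℝ)} (h : ∀ t, c t ^ 2 + s t ^ 2 = 1)
    (f : cyl B) :
    star (weight c f) * weight c f + star (weight s f) * weight s f = star f * f := by
  rw [star_weight_mul, star_weight_mul, ← mul_add, weight_weight_add h]

/-- The diagonal operator with entries `c x`. -/
def diagL {X : Type*} (c s : X → C(unitInterval, ℝ)) (h : ∀ x t, c x t ^ 2 + s x t ^ 2 = 1) :
    L2 X (cyl B) →L[ℂ] L2 X (cyl B) :=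
  LinearMap.mkContinuous
    { toFun := fun ξ => L2.mk (fun x => weight (c x) (ξ.1 x)) (by
        let _ := CStarAlgebra.spectralOrder (cyl B)
        have := CStarAlgebra.spectralOrderedRing (cyl B)
        refine summable_of_le_of_nonneg (fun x => star_mul_self_nonneg _) (fun x => ?_) ξ.2
        rw [← star_weight_add (h x) (ξ.1 x)]
        exact le_add_of_nonneg_right (star_mul_self_nonneg _))
      map_add' := fun ξ η => L2.ext fun x => weight_add _ _ _
      map_smul' := fun a ξ => L2.ext fun x => weight_smul _ _ _ } 1
    (fun ξ => by
      let _ := CStarAlgebra.spectralOrder (cyl B)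
      have := CStarAlgebra.spectralOrderedRing (cyl B)
      refine L2.norm_le_of_forall_sum _ (by positivity) fun t => ?_
      rw [one_mul]
      refine le_trans ?_ (L2.norm_sum_le ξ t)
      refine CStarAlgebra.norm_le_norm_of_nonneg_of_le
        (Finset.sum_nonneg fun x _ => star_mul_self_nonneg _) (Finset.sum_le_sum fun x _ => ?_)
      rw [← star_weight_add (h x) (ξ.1 x)]
      exact le_add_of_nonneg_right (star_mul_self_nonneg _))

theorem isAdjointPair_diagL {X : Type*} (c s : X → C(unitInterval, ℝ))
    (h : ∀ x t, c x t ^ 2 + s x t ^ 2 = 1) :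
    IsAdjointPair (diagL (B := B) c s h) (diagL c s h) := fun _ _ =>
  tsum_congr fun x => star_weight_mul (c x) _ _

/-- The diagonal operator as an adjointable operator. -/
def diag {X : Type*} (c s : X → C(unitInterval, ℝ)) (h : ∀ x t, c x t ^ 2 + s x t ^ 2 = 1) :
    Adj X (cyl B) := ⟨diagL c s h, diagL c s h, isAdjointPair_diagL c s h⟩

theorem diag_val {X : Type*} (c s : X → C(unitInterval, ℝ)) (h : ∀ x t, c x t ^ 2 + s x t ^ 2 = 1)
    (ξ : L2 X (cyl B)) (x : X) : ((diag c s h).1 ξ).1 x = weight (c x) (ξ.1 x) := rfl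

theorem star_diag {X : Type*} (c s : X → C(unitInterval, ℝ))
    (h : ∀ x t, c x t ^ 2 + s x t ^ 2 = 1) : star (diag c s h : Adj X (cyl B)) = diag c s h :=
  Adj.star_eq_of (isAdjointPair_diagL c s h)

end Diag

section Angle

/-- A ramp from `0` to `1` on the interval `[1/(n+2), 1/(n+1)]`. -/
def ramp (n : ℕ) : C(unitInterval, ℝ) :=
  ⟨fun t => max 0 (min 1 (((n : ℝ) + 1) * (n + 2) * t - (n + 1))), by fun_prop⟩

/-- The cosine of the rotation angle at stage `n`. -/
def cosR (n : ℕ) : C(unitInterval, ℝ) := ⟨fun t => Real.cos (Real.pi / 2 * ramp n t), by fun_prop⟩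

/-- The sine of the rotation angle at stage `n`. -/
def sinR (n : ℕ) : C(unitInterval, ℝ) := ⟨fun t => Real.sin (Real.pi / 2 * ramp n t), by fun_prop⟩

theorem cosR_sinR (n : ℕ) (t : unitInterval) : cosR n t ^ 2 + sinR n t ^ 2 = 1 :=
  Real.cos_sq_add_sin_sq _

theorem sinR_cosR (n : ℕ) (t : unitInterval) : sinR n t ^ 2 + cosR n t ^ 2 = 1 :=
  Real.sin_sq_add_cos_sq _

theorem ramp_zero (n : ℕ) : ramp n 0 = 0 := by
  change max 0 (min 1 (((n : ℝ) + 1) * (n + 2) * (0 : ℝ) - (n + 1))) = (0 : ℝ)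
  rw [max_eq_left]
  refine (min_le_right _ _).trans ?_
  have : (0 : ℝ) ≤ n := Nat.cast_nonneg n
  linarith

theorem ramp_one (n : ℕ) : ramp n 1 = 1 := by
  change max 0 (min 1 (((n : ℝ) + 1) * (n + 2) * (1 : ℝ) - (n + 1))) = (1 : ℝ)
  have : (0 : ℝ) ≤ n := Nat.cast_nonneg n
  rw [min_eq_left (by nlinarith), max_eq_right zero_le_one]

theorem cosR_zero (n : ℕ) : cosR n 0 = 1 := by
  change Real.cos (Real.pi / 2 * ramp n 0) = 1
  rw [ramp_zero, mul_zero, Real.cos_zero]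

theorem sinR_zero (n : ℕ) : sinR n 0 = 0 := by
  change Real.sin (Real.pi / 2 * ramp n 0) = 0
  rw [ramp_zero, mul_zero, Real.sin_zero]

theorem cosR_one (n : ℕ) : cosR n 1 = 0 := by
  change Real.cos (Real.pi / 2 * ramp n 1) = 0
  rw [ramp_one, mul_one, Real.cos_pi_div_two]

theorem sinR_one (n : ℕ) : sinR n 1 = 1 := by
  change Real.sin (Real.pi / 2 * ramp n 1) = 1
  rw [ramp_one, mul_one, Real.sin_pi_div_two]

theorem sinR_mul_cosR {n m : ℕ} (h : n < m) (t : unitInterval) : sinR n t * cosR m t = 0 := by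
  by_cases h0 : ramp n t = 0
  · have : sinR n t = 0 := by
      change Real.sin (Real.pi / 2 * ramp n t) = 0
      rw [h0, mul_zero, Real.sin_zero]
    rw [this, zero_mul]
  · have h1 : 0 < ((n : ℝ) + 1) * (n + 2) * t - (n + 1) := by
      by_contra hcon
      refine h0 ?_
      change max 0 (min 1 (((n : ℝ) + 1) * (n + 2) * t - (n + 1))) = (0 : ℝ)
      exact max_eq_left ((min_le_right _ _).trans (not_lt.1 hcon))
    have hn : (0 : ℝ) ≤ n := Nat.cast_nonneg n
    have hm : (n : ℝ) + 1 ≤ m := by exact_mod_cast h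
    have h2 : 1 < ((n : ℝ) + 2) * t := by
      by_contra hcon
      nlinarith
    have ht : (0 : ℝ) ≤ t := t.2.1
    have h3 : 1 ≤ ((m : ℝ) + 1) * t := by nlinarith
    have h4 : ramp m t = 1 := by
      change max 0 (min 1 (((m : ℝ) + 1) * (m + 2) * t - (m + 1))) = (1 : ℝ)
      rw [min_eq_left (by nlinarith), max_eq_right zero_le_one]
    have : cosR m t = 0 := by
      change Real.cos (Real.pi / 2 * ramp m t) = 0
      rw [h4, mul_one, Real.cos_pi_div_two]
    rw [this, mul_zero]

end Angle

section Family

variable {B : CStarAlg.{u}} {S : Type} [Fintype S]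

/-- A path of isometries from `e_i ↦ e_{g i}` to `e_i ↦ e_{k i}`. -/
def rotOp (B : CStarAlg.{u}) {g k : ℕ → ℕ} (hg : Function.Injective g)
    (hk : Function.Injective k) : Adj ℕ (cyl B) :=
  shift hg * diag (fun i => cosR (g i)) (fun i => sinR (g i)) (fun _ t => cosR_sinR _ t) +
    shift hk * diag (fun i => sinR (g i)) (fun i => cosR (g i)) (fun _ t => sinR_cosR _ t)

variable {g k : ℕ → ℕ} (hg : Function.Injective g) (hk : Function.Injective k)

theorem rotOp_val (ξ : L2 ℕ (cyl B)) (x : ℕ) : ((rotOp B hg hk).1 ξ).1 x =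
    Function.extend g (fun i => weight (cosR (g i)) (ξ.1 i)) 0 x +
      Function.extend k (fun i => weight (sinR (g i)) (ξ.1 i)) 0 x := rfl

theorem star_rotOp_val (ξ : L2 ℕ (cyl B)) (i : ℕ) : ((star (rotOp B hg hk)).1 ξ).1 i =
    weight (cosR (g i)) (ξ.1 (g i)) + weight (sinR (g i)) (ξ.1 (k i)) := by
  rw [rotOp, star_add, star_mul, star_mul, star_diag, star_diag]
  change weight (cosR (g i)) (((star (shift hg : Adj ℕ (cyl B))).1 ξ).1 i) +
    weight (sinR (g i)) (((star (shift hk : Adj ℕ (cyl B))).1 ξ).1 i) = _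
  rw [star_shift_val, star_shift_val]

theorem colFinite_rotOp : ColFinite (rotOp B hg hk) := fun y => ⟨{g y, k y}, fun b x hx => by
  classical
  have h0 : ∀ i, i ≠ y → (L2.single y b).1 i = 0 := fun i hi => by
    rw [L2.single_val, if_neg hi]
  simp only [Finset.mem_insert, Finset.mem_singleton, not_or] at hx
  have e1 : Function.extend g (fun i => weight (cosR (g i)) ((L2.single y b).1 i)) 0 x = 0 := by
    by_cases h : x ∈ Set.range g
    · obtain ⟨i, rfl⟩ := h
      rw [hg.extend_apply, h0 i (fun h => hx.1 (by rw [h])), weight_zero]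
    · exact extend_eq_zero h
  have e2 : Function.extend k (fun i => weight (sinR (g i)) ((L2.single y b).1 i)) 0 x = 0 := by
    by_cases h : x ∈ Set.range k
    · obtain ⟨i, rfl⟩ := h
      rw [hk.extend_apply, h0 i (fun h => hx.2 (by rw [h])), weight_zero]
    · exact extend_eq_zero h
  rw [rotOp_val, e1, e2, add_zero]⟩

theorem rotOp_mapVec (t : unitInterval) {V : Adj ℕ B} {f : ℕ → ℕ} (hf : Function.Injective f)
    (hV : V = shift hf)
    (h : (∀ n, cosR n t = 1) ∧ (∀ n, sinR n t = 0) ∧ f = g ∨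
      (∀ n, cosR n t = 0) ∧ (∀ n, sinR n t = 1) ∧ f = k) :
    (∀ ξ, V.1 (L2.mapVec (ev B t) ξ) = L2.mapVec (ev B t) ((rotOp B hg hk).1 ξ)) ∧
    (∀ ξ, (star V).1 (L2.mapVec (ev B t) ξ) = L2.mapVec (ev B t) ((star (rotOp B hg hk)).1 ξ)) := by
  subst hV
  have ext0 : ∀ {l : ℕ → ℕ} (hl : Function.Injective l) (w : ℕ → C(unitInterval, ℝ))
      (hw : ∀ i, w i t = 0) (ξ : L2 ℕ (cyl B)) (x : ℕ),
      ev B t (Function.extend l (fun i => weight (w i) (ξ.1 i)) 0 x) = 0 := by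
    intro l hl w hw ξ x
    by_cases hx : x ∈ Set.range l
    · obtain ⟨i, rfl⟩ := hx
      rw [hl.extend_apply, ev_weight, hw, Complex.ofReal_zero, zero_smul]
    · rw [extend_eq_zero hx, map_zero]
  have ext1 : ∀ {l : ℕ → ℕ} (hl : Function.Injective l) (w : ℕ → C(unitInterval, ℝ))
      (hw : ∀ i, w i t = 1) (ξ : L2 ℕ (cyl B)) (x : ℕ),
      ev B t (Function.extend l (fun i => weight (w i) (ξ.1 i)) 0 x) =
        Function.extend l (fun i => ev B t (ξ.1 i)) 0 x := by
    intro l hl w hw ξ x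
    by_cases hx : x ∈ Set.range l
    · obtain ⟨i, rfl⟩ := hx
      rw [hl.extend_apply, hl.extend_apply, ev_weight, hw, Complex.ofReal_one, one_smul]
    · rw [extend_eq_zero hx, extend_eq_zero hx, map_zero]
  rcases h with ⟨hc, hs, rfl⟩ | ⟨hc, hs, rfl⟩
  · refine ⟨fun ξ => L2.ext fun x => ?_, fun ξ => L2.ext fun x => ?_⟩
    · change Function.extend f (fun i => ev B t (ξ.1 i)) 0 x =
        ev B t (((rotOp B hg hk).1 ξ).1 x)
      rw [rotOp_val, map_add, ext0 hk _ (fun i => hs _), ext1 hg _ (fun i => hc _), add_zero]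
    · rw [star_shift_val]
      change ev B t (ξ.1 (f x)) = ev B t (((star (rotOp B hg hk)).1 ξ).1 x)
      rw [star_rotOp_val, map_add, ev_weight, ev_weight, hc, hs]
      simp
  · refine ⟨fun ξ => L2.ext fun x => ?_, fun ξ => L2.ext fun x => ?_⟩
    · change Function.extend f (fun i => ev B t (ξ.1 i)) 0 x =
        ev B t (((rotOp B hg hk).1 ξ).1 x)
      rw [rotOp_val, map_add, ext0 hg _ (fun i => hc _), ext1 hk _ (fun i => hs _), zero_add]
    · rw [star_shift_val]
      change ev B t (ξ.1 (f x)) = ev B t (((star (rotOp B hg hk)).1 ξ).1 x)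
      rw [star_rotOp_val, map_add, ev_weight, ev_weight, hc, hs]
      simp

variable (B)

/-- The family of paths of isometries from `e_i ↦ e_{g(s, i)}` to `e_i ↦ e_{k(s, i)}`. -/
def rotFamily (g k : S → ℕ → ℕ) (hg : ∀ s s' i j, g s i = g s' j → s = s' ∧ i = j)
    (hk : ∀ s s' i j, k s i = k s' j → s = s' ∧ i = j) (hgk : ∀ s i, g s i < k s i) :
    OrthoFamily S (cyl B) :=
  have ig : ∀ s, Function.Injective (g s) := fun s i j h => (hg s s i j h).2
  have ik : ∀ s, Function.Injective (k s) := fun s i j h => (hk s s i j h).2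
  have c1 : ∀ s s' i (ξ : L2 ℕ (cyl B)), weight (cosR (g s i))
      (Function.extend (k s') (fun j => weight (sinR (g s' j)) (ξ.1 j)) 0 (g s i)) = 0 := by
    intro s s' i ξ
    by_cases hx : g s i ∈ Set.range (k s')
    · obtain ⟨j, hj⟩ := hx
      rw [← hj, (ik s').extend_apply, hj]
      refine weight_weight_zero (fun t => ?_) _
      rw [mul_comm]
      exact sinR_mul_cosR ((hgk s' j).trans_eq hj) t
    · rw [extend_eq_zero hx, weight_zero]
  have c2 : ∀ s s' i (ξ : L2 ℕ (cyl B)), weight (sinR (g s i))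
      (Function.extend (g s') (fun j => weight (cosR (g s' j)) (ξ.1 j)) 0 (k s i)) = 0 := by
    intro s s' i ξ
    by_cases hx : k s i ∈ Set.range (g s')
    · obtain ⟨j, hj⟩ := hx
      rw [← hj, (ig s').extend_apply]
      refine weight_weight_zero (fun t => ?_) _
      exact sinR_mul_cosR ((hgk s i).trans_eq hj.symm) t
    · rw [extend_eq_zero hx, weight_zero]
  { op := fun s => rotOp B (ig s) (ik s)
    colFinite := fun s => colFinite_rotOp (ig s) (ik s)
    iso := fun s => Adj.ext_val fun ξ i => by
      refine (star_rotOp_val (ig s) (ik s) ((rotOp B (ig s) (ik s)).1 ξ) i).trans ?_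
      rw [rotOp_val, rotOp_val, weight_add, weight_add, c1, c2, (ig s).extend_apply,
        (ik s).extend_apply, add_zero, zero_add]
      exact weight_weight_add (cosR_sinR _) _
    ortho := fun s s' hs => Adj.ext_val fun ξ i => by
      refine (star_rotOp_val (ig s) (ik s) ((rotOp B (ig s') (ik s')).1 ξ) i).trans ?_
      rw [rotOp_val, rotOp_val, weight_add, weight_add, c1, c2, extend_eq_zero, extend_eq_zero,
        weight_zero, weight_zero, add_zero, add_zero]
      · rfl
      · rintro ⟨j, hj⟩; exact hs (hk _ _ _ _ hj).1.symm
      · rintro ⟨j, hj⟩; exact hs (hg _ _ _ _ hj).1.symm }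

variable {B} {D : CStarAlg.{u}}

theorem ev_surjective (t : unitInterval) : Function.Surjective (ev B t) :=
  fun b => ⟨const B b, rfl⟩

theorem adSum_homotopic_of_lt (p : S → (D →⋆ₙₐ[ℂ] compactFunctor.obj B)) (g k : S → ℕ → ℕ)
    (hg : ∀ s s' i j, g s i = g s' j → s = s' ∧ i = j)
    (hk : ∀ s s' i j, k s i = k s' j → s = s' ∧ i = j) (hgk : ∀ s i, g s i < k s i) :
    FHomotopic (F := compactFunctor) (adSum (shiftFamily B g hg) p)
      (adSum (shiftFamily B k hk) p) := by
  have ig : ∀ s, Function.Injective (g s) := fun s i j h => (hg s s i j h).2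
  have ik : ∀ s, Function.Injective (k s) := fun s i j h => (hk s s i j h).2
  have hc : ∀ t T, compactFunctor.map (ev B t) (compactFunctor.map (const B) T) = T := by
    intro t T
    rw [Endofunctor.map_comp_apply, ev_const, compactFunctor.map_id]; rfl
  refine ⟨adSum (rotFamily B g k hg hk hgk) fun s => (compactFunctor.map (const B)).comp (p s),
    ?_, ?_⟩
  · ext1 d
    refine (map_sum (compactFunctor.map (ev B 0)) _ _).trans (Finset.sum_congr rfl fun s _ => ?_)
    obtain ⟨h1, h2⟩ := rotOp_mapVec (B := B) (ig s) (ik s) 0 (ig s) rfl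
      (Or.inl ⟨cosR_zero, sinR_zero, rfl⟩)
    refine (matAlgMap_conj (ev B 0) (ev_surjective 0) _ (colFinite_shift (ig s)) h1 h2 _).trans ?_
    exact congrArg (conjK (colFinite_shift (ig s))) (hc 0 (p s d))
  · ext1 d
    refine (map_sum (compactFunctor.map (ev B 1)) _ _).trans (Finset.sum_congr rfl fun s _ => ?_)
    obtain ⟨h1, h2⟩ := rotOp_mapVec (B := B) (ig s) (ik s) 1 (ik s) rfl
      (Or.inr ⟨cosR_one, sinR_one, rfl⟩)
    refine (matAlgMap_conj (ev B 1) (ev_surjective 1) _ (colFinite_shift (ik s)) h1 h2 _).trans ?_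
    exact congrArg (conjK (colFinite_shift (ik s))) (hc 1 (p s d))

theorem adSum_homotopic (p : S → (D →⋆ₙₐ[ℂ] compactFunctor.obj B)) (g k : S → ℕ → ℕ)
    (hg : ∀ s s' i j, g s i = g s' j → s = s' ∧ i = j)
    (hk : ∀ s s' i j, k s i = k s' j → s = s' ∧ i = j) :
    FHomotopic (F := compactFunctor) (adSum (shiftFamily B g hg) p)
      (adSum (shiftFamily B k hk) p) := by
  let l : S → ℕ → ℕ := fun s i => Nat.pair (g s i) (k s i) + 1
  have hl : ∀ s s' i j, l s i = l s' j → s = s' ∧ i = j := fun s s' i j h =>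
    hg s s' i j (Nat.pair_eq_pair.1 (Nat.succ_injective h)).1
  exact (adSum_homotopic_of_lt p g l hg hl
      fun s i => Nat.lt_succ_of_le (Nat.left_le_pair _ _)).trans
    (adSum_homotopic_of_lt p k l hk hl
      fun s i => Nat.lt_succ_of_le (Nat.right_le_pair _ _)).symm

end Family

end Rotation

section Sum

/-- The two injections `i ↦ 2 i` and `i ↦ 2 i + 1` of `ℕ`. -/
def evenOdd : Fin 2 → ℕ → ℕ := fun s i => 2 * i + s

theorem evenOdd_inj (s s' : Fin 2) (i j : ℕ) (h : evenOdd s i = evenOdd s' j) : s = s' ∧ i = j := by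
  unfold evenOdd at h
  constructor
  · ext; omega
  · omega

/-- The homomorphism `μ_B : 𝕂 B ⊕ 𝕂 B → 𝕂 B`, `(S, T) ↦ V₀ S V₀⋆ + V₁ T V₁⋆`, where `V₀` and `V₁`
are the isometries `e_i ↦ e_{2i}` and `e_i ↦ e_{2i+1}`. This is the diagonal inclusion into
`M₂ ⊗ 𝕂 B` followed by the isomorphism `M₂ ⊗ 𝕂 B ≅ 𝕂 B` that comes from a bijection
`{0, 1} × ℕ ≅ ℕ`. -/
def mu (B : CStarAlg.{u}) :
    prodAlg (compactFunctor.obj B) (compactFunctor.obj B) →⋆ₙₐ[ℂ] compactFunctor.obj B :=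
  adSum (shiftFamily B evenOdd evenOdd_inj) ![pr₁ _ _, pr₂ _ _]

variable {A B : CStarAlg.{u}} (F : Endofunctor.{u})

theorem inj_of {S : Type} {g : S → ℕ → ℕ} (hg : ∀ s s' i j, g s i = g s' j → s = s' ∧ i = j)
    (s : S) : Function.Injective (g s) := fun i j h => (hg s s i j h).2

/-- `T ↦ V T V⋆` on `𝕂 B`, where `V` is the isometry `e_i ↦ e_{g i}`. -/
def shiftK (B : CStarAlg.{u}) {g : ℕ → ℕ} (hg : Function.Injective g) :
    compactFunctor.obj B →ₗ[ℂ] compactFunctor.obj B := conjK (colFinite_shift hg)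

theorem shiftK_shiftK {g h : ℕ → ℕ} (hg : Function.Injective g) (hh : Function.Injective h)
    (T : compactFunctor.obj B) : shiftK B hg (shiftK B hh T) = shiftK B (hg.comp hh) T :=
  conj_conj hg hh T

theorem shiftK_id (T : compactFunctor.obj B) : shiftK B Function.injective_id T = T := conj_id T

theorem map_shiftK {C : CStarAlg.{u}} (f : B →⋆ₙₐ[ℂ] C) {g : ℕ → ℕ} (hg : Function.Injective g)
    (T : compactFunctor.obj B) :
    compactFunctor.map f (shiftK B hg T) = shiftK C hg (compactFunctor.map f T) :=
  matAlgMap_conj_shift f hg T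

theorem adSum_shift {S : Type} [Fintype S] {D : CStarAlg.{u}} (g : S → ℕ → ℕ)
    (hg : ∀ s s' i j, g s i = g s' j → s = s' ∧ i = j)
    (p : S → (D →⋆ₙₐ[ℂ] compactFunctor.obj B)) (d : D) :
    adSum (shiftFamily B g hg) p d = ∑ s, shiftK B (inj_of hg s) (p s d) := rfl

theorem mu_apply (x : prodAlg (compactFunctor.obj B) (compactFunctor.obj B)) :
    mu B x = shiftK B (inj_of evenOdd_inj 0) (pr₁ _ _ x) +
      shiftK B (inj_of evenOdd_inj 1) (pr₂ _ _ x) := by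
  rw [mu, adSum_shift, Fin.sum_univ_two]; rfl

/-- The homomorphism `μ ∘ in₁`. -/
def muL (B : CStarAlg.{u}) : compactFunctor.obj B →⋆ₙₐ[ℂ] compactFunctor.obj B :=
  (mu B).comp (in₁ _ _)

/-- The homomorphism `μ ∘ in₂`. -/
def muR (B : CStarAlg.{u}) : compactFunctor.obj B →⋆ₙₐ[ℂ] compactFunctor.obj B :=
  (mu B).comp (in₂ _ _)

theorem muL_apply (x : compactFunctor.obj B) : muL B x = shiftK B (inj_of evenOdd_inj 0) x := by
  change mu B (in₁ _ _ x) = _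
  rw [mu_apply]
  change _ + shiftK B (inj_of evenOdd_inj 1) 0 = _
  rw [map_zero, add_zero]; rfl

theorem muR_apply (x : compactFunctor.obj B) : muR B x = shiftK B (inj_of evenOdd_inj 1) x := by
  change mu B (in₂ _ _ x) = _
  rw [mu_apply]
  change shiftK B (inj_of evenOdd_inj 0) 0 + _ = _
  rw [map_zero, zero_add]; rfl

theorem muL_natural {C : CStarAlg.{u}} (f : B →⋆ₙₐ[ℂ] C) :
    (compactFunctor.map f).comp (muL B) = (muL C).comp (compactFunctor.map f) := by
  ext1 T
  change compactFunctor.map f (muL B T) = muL C (compactFunctor.map f T)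
  rw [muL_apply, muL_apply, map_shiftK]

theorem muR_natural {C : CStarAlg.{u}} (f : B →⋆ₙₐ[ℂ] C) :
    (compactFunctor.map f).comp (muR B) = (muR C).comp (compactFunctor.map f) := by
  ext1 T
  change compactFunctor.map f (muR B T) = muR C (compactFunctor.map f T)
  rw [muR_apply, muR_apply, map_shiftK]

/-- The sum of two `⋆`-homomorphisms `φ, ψ : A → F 𝕂 B`: the composition
`A → F 𝕂 B ⊕ F 𝕂 B ≅ F (𝕂 B ⊕ 𝕂 B) → F 𝕂 B` of `(φ, ψ)`, the inverse of the canonical isomorphism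
and `F μ_B`. -/
def sumHom (φ ψ : A →⋆ₙₐ[ℂ] F.obj (compactFunctor.obj B)) :
    A →⋆ₙₐ[ℂ] F.obj (compactFunctor.obj B) :=
  (F.map (mu B)).comp
    ((F.prodInv (compactFunctor.obj B) (compactFunctor.obj B)).comp
      (pairHom (B := F.obj (compactFunctor.obj B)) (C := F.obj (compactFunctor.obj B)) φ ψ))

variable {F}

theorem sumHom_apply (φ ψ : A →⋆ₙₐ[ℂ] F.obj (compactFunctor.obj B)) (a : A) :
    sumHom F φ ψ a = F.map (muL B) (φ a) + F.map (muR B) (ψ a) := by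
  change F.map (mu B) (F.prodInv _ _ _) = _
  rw [F.prodInv_apply, map_add, F.map_comp_apply, F.map_comp_apply]
  rfl

theorem map_sumHom {C : CStarAlg.{u}} (f : B →⋆ₙₐ[ℂ] C)
    (φ ψ : A →⋆ₙₐ[ℂ] F.obj (compactFunctor.obj B)) :
    (F.map (compactFunctor.map f)).comp (sumHom F φ ψ) =
      sumHom F ((F.map (compactFunctor.map f)).comp φ)
        ((F.map (compactFunctor.map f)).comp ψ) := by
  ext1 a
  rw [sumHom_apply]
  change F.map (compactFunctor.map f) (sumHom F φ ψ a) =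
    F.map (muL C) (F.map (compactFunctor.map f) (φ a)) +
      F.map (muR C) (F.map (compactFunctor.map f) (ψ a))
  rw [sumHom_apply, map_add, F.map_comp_apply, F.map_comp_apply, muL_natural, muR_natural,
    F.map_comp_apply, F.map_comp_apply]

theorem FHomotopic.sum {φ φ' ψ ψ' : A →⋆ₙₐ[ℂ] F.obj (compactFunctor.obj B)}
    (h : FHomotopic (F := F.comp compactFunctor) (B := B) φ φ')
    (h' : FHomotopic (F := F.comp compactFunctor) (B := B) ψ ψ') :
    FHomotopic (F := F.comp compactFunctor) (B := B) (sumHom F φ ψ) (sumHom F φ' ψ') := by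
  obtain ⟨Φ, h0, h1⟩ := h
  obtain ⟨Ψ, h0', h1'⟩ := h'
  refine ⟨sumHom F Φ Ψ, ?_, ?_⟩
  · refine (map_sumHom (ev B 0) Φ Ψ).trans ?_
    exact congrArg₂ (sumHom F) h0 h0'
  · refine (map_sumHom (ev B 1) Φ Ψ).trans ?_
    exact congrArg₂ (sumHom F) h1 h1'

/-- Homotopic homomorphisms `D → 𝕂 B` induce homotopic homomorphisms. -/
theorem FHomotopic.whisker {D : CStarAlg.{u}} {f g : D →⋆ₙₐ[ℂ] compactFunctor.obj B}
    (h : FHomotopic (F := compactFunctor) f g) (θ : A →⋆ₙₐ[ℂ] F.obj D)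
    {φ ψ : A →⋆ₙₐ[ℂ] F.obj (compactFunctor.obj B)} (hφ : ∀ a, φ a = F.map f (θ a))
    (hψ : ∀ a, ψ a = F.map g (θ a)) :
    FHomotopic (F := F.comp compactFunctor) (B := B) φ ψ := by
  obtain ⟨H, h0, h1⟩ := h
  refine ⟨(F.map H).comp θ, ?_, ?_⟩
  · ext1 a
    refine Eq.trans ?_ (hφ a).symm
    rw [← h0]
    exact F.map_comp_apply _ _ _
  · ext1 a
    refine Eq.trans ?_ (hψ a).symm
    rw [← h1]
    exact F.map_comp_apply _ _ _

theorem sumHom_comm (φ ψ : A →⋆ₙₐ[ℂ] F.obj (compactFunctor.obj B)) :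
    FHomotopic (F := F.comp compactFunctor) (B := B) (sumHom F φ ψ) (sumHom F ψ φ) := by
  let K := compactFunctor.obj B
  let θ : A →⋆ₙₐ[ℂ] F.obj (prodAlg K K) :=
    (F.prodInv K K).comp (pairHom (B := F.obj K) (C := F.obj K) φ ψ)
  have hθ : ∀ a, θ a = F.map (in₁ K K) (φ a) + F.map (in₂ K K) (ψ a) := fun a =>
    F.prodInv_apply _ _ _
  let p : Fin 2 → (prodAlg K K →⋆ₙₐ[ℂ] K) := ![pr₁ _ _, pr₂ _ _]
  let g' : Fin 2 → ℕ → ℕ := fun s => evenOdd (Fin.rev s)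
  have hg' : ∀ s s' i j, g' s i = g' s' j → s = s' ∧ i = j := fun s s' i j h => by
    obtain ⟨h1, h2⟩ := evenOdd_inj _ _ _ _ h
    exact ⟨Fin.rev_injective h1, h2⟩
  refine FHomotopic.whisker (adSum_homotopic p evenOdd g' evenOdd_inj hg') θ (fun a => rfl)
    fun a => ?_
  have e1 : (adSum (shiftFamily B g' hg') p).comp (in₁ K K) = muR B := by
    ext1 x
    change adSum (shiftFamily B g' hg') p (in₁ K K x) = _
    rw [adSum_shift, Fin.sum_univ_two, muR_apply]
    change shiftK B _ x + shiftK B _ 0 = _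
    rw [map_zero, add_zero]
  have e2 : (adSum (shiftFamily B g' hg') p).comp (in₂ K K) = muL B := by
    ext1 x
    change adSum (shiftFamily B g' hg') p (in₂ K K x) = _
    rw [adSum_shift, Fin.sum_univ_two, muL_apply]
    change shiftK B _ 0 + shiftK B _ x = _
    rw [map_zero, zero_add]
  rw [sumHom_apply, hθ, map_add, F.map_comp_apply, F.map_comp_apply, e1, e2, add_comm]

theorem sumHom_zero (φ : A →⋆ₙₐ[ℂ] F.obj (compactFunctor.obj B)) :
    FHomotopic (F := F.comp compactFunctor) (B := B) (sumHom F φ 0) φ := by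
  let K := compactFunctor.obj B
  let p : Fin 1 → (K →⋆ₙₐ[ℂ] K) := fun _ => NonUnitalStarAlgHom.id ℂ K
  let g : Fin 1 → ℕ → ℕ := fun _ => evenOdd 0
  let g' : Fin 1 → ℕ → ℕ := fun _ => id
  have hg : ∀ s s' i j, g s i = g s' j → s = s' ∧ i = j := fun s s' i j h =>
    ⟨Subsingleton.elim _ _, (evenOdd_inj _ _ _ _ h).2⟩
  have hg' : ∀ s s' i j, g' s i = g' s' j → s = s' ∧ i = j := fun s s' i j h =>
    ⟨Subsingleton.elim _ _, h⟩
  have e1 : adSum (shiftFamily B g hg) p = muL B := by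
    ext1 x
    rw [adSum_shift, Fin.sum_univ_one, muL_apply]; rfl
  have e2 : adSum (shiftFamily B g' hg') p = NonUnitalStarAlgHom.id ℂ K := by
    ext1 x
    rw [adSum_shift, Fin.sum_univ_one]
    exact shiftK_id x
  refine FHomotopic.whisker (adSum_homotopic p g g' hg hg') φ (fun a => ?_) fun a => ?_
  · rw [sumHom_apply, e1]
    change _ + F.map (muR B) 0 = _
    rw [map_zero, add_zero]
  · rw [e2, F.map_id]; rfl

theorem sumHom_assoc (φ ψ χ : A →⋆ₙₐ[ℂ] F.obj (compactFunctor.obj B)) :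
    FHomotopic (F := F.comp compactFunctor) (B := B) (sumHom F (sumHom F φ ψ) χ)
      (sumHom F φ (sumHom F ψ χ)) := by
  let K := compactFunctor.obj B
  let D := prodAlg (prodAlg K K) K
  let θ₁ : A →⋆ₙₐ[ℂ] F.obj (prodAlg K K) :=
    (F.prodInv K K).comp (pairHom (B := F.obj K) (C := F.obj K) φ ψ)
  let θ : A →⋆ₙₐ[ℂ] F.obj D :=
    (F.prodInv (prodAlg K K) K).comp (pairHom (B := F.obj (prodAlg K K)) (C := F.obj K) θ₁ χ)
  let j₁ : K →⋆ₙₐ[ℂ] D := (in₁ (prodAlg K K) K).comp (in₁ K K)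
  let j₂ : K →⋆ₙₐ[ℂ] D := (in₁ (prodAlg K K) K).comp (in₂ K K)
  let j₃ : K →⋆ₙₐ[ℂ] D := in₂ (prodAlg K K) K
  have hθ : ∀ a, θ a = F.map j₁ (φ a) + F.map j₂ (ψ a) + F.map j₃ (χ a) := fun a => by
    refine (F.prodInv_apply _ _ _).trans ?_
    change F.map (in₁ (prodAlg K K) K) (F.prodInv K K _) + _ = _
    rw [F.prodInv_apply, map_add, F.map_comp_apply, F.map_comp_apply]; rfl
  let p : Fin 3 → (D →⋆ₙₐ[ℂ] K) :=
    ![(pr₁ K K).comp (pr₁ (prodAlg K K) K), (pr₂ K K).comp (pr₁ (prodAlg K K) K),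
      pr₂ (prodAlg K K) K]
  let g : Fin 3 → ℕ → ℕ := ![evenOdd 0 ∘ evenOdd 0, evenOdd 0 ∘ evenOdd 1, evenOdd 1]
  let g' : Fin 3 → ℕ → ℕ := ![evenOdd 0, evenOdd 1 ∘ evenOdd 0, evenOdd 1 ∘ evenOdd 1]
  have hg : ∀ s s' i j, g s i = g s' j → s = s' ∧ i = j := by
    intro s s' i j h
    fin_cases s <;> fin_cases s' <;> simp [g, evenOdd] at h ⊢ <;> omega
  have hg' : ∀ s s' i j, g' s i = g' s' j → s = s' ∧ i = j := by
    intro s s' i j h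
    fin_cases s <;> fin_cases s' <;> simp [g', evenOdd] at h ⊢ <;> omega
  have key : ∀ (k : Fin 3 → ℕ → ℕ) (hk : ∀ s s' i j, k s i = k s' j → s = s' ∧ i = j)
      (f₁ f₂ f₃ : K →⋆ₙₐ[ℂ] K), (∀ x, f₁ x = shiftK B (inj_of hk 0) x) →
      (∀ x, f₂ x = shiftK B (inj_of hk 1) x) → (∀ x, f₃ x = shiftK B (inj_of hk 2) x) →
      ∀ a, F.map (adSum (shiftFamily B k hk) p) (θ a) =
        F.map f₁ (φ a) + F.map f₂ (ψ a) + F.map f₃ (χ a) := by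
    intro k hk f₁ f₂ f₃ h₁ h₂ h₃ a
    have e1 : (adSum (shiftFamily B k hk) p).comp j₁ = f₁ := by
      ext1 x
      change adSum (shiftFamily B k hk) p (j₁ x) = _
      rw [adSum_shift, Fin.sum_univ_three, h₁]
      change shiftK B _ x + shiftK B _ 0 + shiftK B _ 0 = _
      rw [map_zero, map_zero, add_zero, add_zero]
    have e2 : (adSum (shiftFamily B k hk) p).comp j₂ = f₂ := by
      ext1 x
      change adSum (shiftFamily B k hk) p (j₂ x) = _
      rw [adSum_shift, Fin.sum_univ_three, h₂]
      change shiftK B _ 0 + shiftK B _ x + shiftK B _ 0 = _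
      rw [map_zero, map_zero, add_zero, zero_add]
    have e3 : (adSum (shiftFamily B k hk) p).comp j₃ = f₃ := by
      ext1 x
      change adSum (shiftFamily B k hk) p (j₃ x) = _
      rw [adSum_shift, Fin.sum_univ_three, h₃]
      change shiftK B _ 0 + shiftK B _ 0 + shiftK B _ x = _
      rw [map_zero, map_zero, add_zero, zero_add]
    rw [hθ, map_add, map_add, F.map_comp_apply, F.map_comp_apply, F.map_comp_apply, e1, e2, e3]
  refine FHomotopic.whisker (adSum_homotopic p g g' hg hg') θ (fun a => ?_) fun a => ?_
  · rw [key g hg ((muL B).comp (muL B)) ((muL B).comp (muR B)) (muR B)]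
    · rw [sumHom_apply, sumHom_apply, map_add, F.map_comp_apply, F.map_comp_apply]
    · intro x
      change muL B (muL B x) = _
      rw [muL_apply, muL_apply, shiftK_shiftK]; rfl
    · intro x
      change muL B (muR B x) = _
      rw [muL_apply, muR_apply, shiftK_shiftK]; rfl
    · intro x
      rw [muR_apply]; rfl
  · rw [key g' hg' (muL B) ((muR B).comp (muL B)) ((muR B).comp (muR B))]
    · rw [sumHom_apply, sumHom_apply, map_add, F.map_comp_apply, F.map_comp_apply, add_assoc]
    · intro x
      rw [muL_apply]; rfl
    · intro x
      change muR B (muL B x) = _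
      rw [muR_apply, muL_apply, shiftK_shiftK]; rfl
    · intro x
      change muR B (muR B x) = _
      rw [muR_apply, muR_apply, shiftK_shiftK]; rfl

theorem HomotopyClass.sound {F : Endofunctor.{u}} {φ ψ : A →⋆ₙₐ[ℂ] F.obj B}
    (h : FHomotopic φ ψ) : HomotopyClass.mk φ = HomotopyClass.mk ψ := Quotient.sound h

theorem HomotopyClass.ind {F : Endofunctor.{u}} {P : HomotopyClass A F B → Prop}
    (h : ∀ φ, P (HomotopyClass.mk φ)) (x : HomotopyClass A F B) : P x := Quotient.ind h x

instance : Zero (HomotopyClass A (F.comp compactFunctor) B) := ⟨HomotopyClass.mk 0⟩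

instance : Add (HomotopyClass A (F.comp compactFunctor) B) :=
  ⟨Quotient.map₂ (sumHom F) fun _ _ h _ _ h' => FHomotopic.sum h h'⟩

theorem HomotopyClass.mk_add (φ ψ : A →⋆ₙₐ[ℂ] F.obj (compactFunctor.obj B)) :
    HomotopyClass.mk (F := F.comp compactFunctor) (B := B) φ +
        HomotopyClass.mk (F := F.comp compactFunctor) (B := B) ψ =
      HomotopyClass.mk (F := F.comp compactFunctor) (B := B) (sumHom F φ ψ) := rfl

/-- The commutative monoid `[A, F 𝕂, B]`. -/
instance : AddCommMonoid (HomotopyClass A (F.comp compactFunctor) B) where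
  add_assoc x y z := by
    induction x using HomotopyClass.ind
    induction y using HomotopyClass.ind
    induction z using HomotopyClass.ind
    exact HomotopyClass.sound (sumHom_assoc _ _ _)
  add_comm x y := by
    induction x using HomotopyClass.ind
    induction y using HomotopyClass.ind
    exact HomotopyClass.sound (sumHom_comm _ _)
  zero_add x := by
    induction x using HomotopyClass.ind
    exact HomotopyClass.sound ((sumHom_comm _ _).trans (sumHom_zero _))
  add_zero x := by
    induction x using HomotopyClass.ind
    exact HomotopyClass.sound (sumHom_zero _)
  nsmul := nsmulRec

end Sum

section SeqColimit

variable (G : ℕ → Type u) [∀ i, AddCommMonoid (G i)] (f : ∀ i, G i →+ G (i + 1))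

/-- The composition `G i → G (i + 1) → ⋯ → G j`. -/
def seqMap (i j : ℕ) (h : i ≤ j) : G i →+ G j :=
  Nat.leRecOn (C := fun j => G i →+ G j) h (fun {k} g => (f k).comp g) (AddMonoidHom.id _)

theorem seqMap_self (i : ℕ) : seqMap G f i i le_rfl = AddMonoidHom.id _ :=
  Nat.leRecOn_self _

theorem seqMap_succ (i j : ℕ) (h : i ≤ j) :
    seqMap G f i (j + 1) (Nat.le_succ_of_le h) = (f j).comp (seqMap G f i j h) :=
  Nat.leRecOn_succ h _

instance : DirectedSystem G (fun i j h => seqMap G f i j h) where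
  map_self i x := by rw [seqMap_self]; rfl
  map_map k j i hij hjk x := by
    induction k, hjk using Nat.le_induction with
    | base => rw [seqMap_self]; rfl
    | succ k hjk ih =>
      rw [seqMap_succ _ _ _ _ hjk, seqMap_succ _ _ _ _ (hij.trans hjk)]
      exact congrArg (f k) ih

/-- The colimit of a sequence `G 0 → G 1 → G 2 → ⋯` of commutative monoids. -/
abbrev SeqColimit : Type u := DirectLimit G (fun i j h => seqMap G f i j h)

/-- The canonical map from a term of the sequence to the colimit. -/
def SeqColimit.of (i : ℕ) (x : G i) : SeqColimit G f := Quotient.mk _ ⟨i, x⟩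

end SeqColimit

section Transition

variable (A : CStarAlg.{u}) (N G : Endofunctor.{u}) (B : CStarAlg.{u})

/-- The map `[A, N G 𝕂, B] → [A, N 𝔄 G 𝕂, B]`, `[φ] ↦ [N(α_{G 𝕂 B}) ∘ φ]`. -/
def insertAsym : HomotopyClass A ((N.comp G).comp compactFunctor) B →+
    HomotopyClass A ((N.comp (asymFunctor.comp G)).comp compactFunctor) B where
  toFun := Quotient.map
    (fun φ => (N.map (asymUnit (G.obj (compactFunctor.obj B)))).comp φ) (by
      rintro φ ψ ⟨Φ, h0, h1⟩
      have nat : ∀ t, ((N.comp (asymFunctor.comp G)).map (compactFunctor.map (ev B t))).comp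
          (N.map (asymUnit (G.obj (compactFunctor.obj (cyl B))))) =
          (N.map (asymUnit (G.obj (compactFunctor.obj B)))).comp
            ((N.comp G).map (compactFunctor.map (ev B t))) := fun t =>
        (N.map_comp _ _).symm.trans
          ((congrArg N.map (asymUnit_natural (G.map (compactFunctor.map (ev B t))))).trans
            (N.map_comp _ _))
      refine ⟨(N.map (asymUnit (G.obj (compactFunctor.obj (cyl B))))).comp Φ, ?_, ?_⟩
      · rw [← h0]
        exact congrArg (fun f => NonUnitalStarAlgHom.comp f Φ) (nat 0)
      · rw [← h1]
        exact congrArg (fun f => NonUnitalStarAlgHom.comp f Φ) (nat 1))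
  map_zero' := congrArg (HomotopyClass.mk
      (F := (N.comp (asymFunctor.comp G)).comp compactFunctor) (B := B))
    (NonUnitalStarAlgHom.ext fun _ => map_zero (N.map (asymUnit (G.obj (compactFunctor.obj B)))))
  map_add' x y := by
    induction x using HomotopyClass.ind with | _ φ
    induction y using HomotopyClass.ind with | _ ψ
    refine congrArg (HomotopyClass.mk
      (F := (N.comp (asymFunctor.comp G)).comp compactFunctor) (B := B))
      (NonUnitalStarAlgHom.ext fun a => ?_)
    have nat : ∀ (f : compactFunctor.obj B →⋆ₙₐ[ℂ] compactFunctor.obj B) x,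
        N.map (asymUnit (G.obj (compactFunctor.obj B))) ((N.comp G).map f x) =
          (N.comp (asymFunctor.comp G)).map f
            (N.map (asymUnit (G.obj (compactFunctor.obj B))) x) := fun f x =>
      (N.map_comp_apply _ _ _).trans
        ((congrArg (fun h => N.map h x) (asymUnit_natural (G.map f)).symm).trans
          (N.map_comp_apply _ _ _).symm)
    refine Eq.trans ?_ (sumHom_apply (F := N.comp (asymFunctor.comp G)) (B := B)
      ((N.map (asymUnit (G.obj (compactFunctor.obj B)))).comp φ)
      ((N.map (asymUnit (G.obj (compactFunctor.obj B)))).comp ψ) a).symm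
    refine (congrArg (N.map (asymUnit (G.obj (compactFunctor.obj B))))
      (sumHom_apply (F := N.comp G) (B := B) φ ψ a)).trans ?_
    refine (map_add (N.map (asymUnit (G.obj (compactFunctor.obj B)))) _ _).trans ?_
    exact congrArg₂ (· + ·) (nat (muL B) (φ a)) (nat (muR B) (ψ a))

theorem insertAsym_mk (φ : A →⋆ₙₐ[ℂ] ((N.comp G).comp compactFunctor).obj B) :
    insertAsym A N G B (HomotopyClass.mk φ) = HomotopyClass.mk
      (F := (N.comp (asymFunctor.comp G)).comp compactFunctor)
      ((N.map (asymUnit (G.obj (compactFunctor.obj B)))).comp φ) := rfl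

variable {X : Type u} [MetricSpace X] [BoundedGeometry X] (X₀ : Set X)

/-- The commutative monoid `[A, 𝔑ᵘ_{X, X₀} 𝔄ⁿ 𝕂, B]`. -/
abbrev RoeClass (n : ℕ) : Type u :=
  HomotopyClass A (((relRoeFunctor X₀).comp (asymIter n)).comp compactFunctor) B

/-- The canonical homomorphism `[A, 𝔑ᵘ_{X, X₀} 𝔄ⁿ 𝕂, B] → [A, 𝔑ᵘ_{X, X₀} 𝔄ⁿ⁺¹ 𝕂, B]`,
`[φ] ↦ [𝔑ᵘ_{X, X₀}(α_{𝔄ⁿ 𝕂 B}) ∘ φ]`. -/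
def transition (n : ℕ) : RoeClass A B X₀ n →+ RoeClass A B X₀ (n + 1) :=
  insertAsym A (relRoeFunctor X₀) (asymIter n) B

/-- The colimit of the sequence
`[A, 𝔑ᵘ_{X, X₀} 𝔄 𝕂, B] → [A, 𝔑ᵘ_{X, X₀} 𝔄² 𝕂, B] → [A, 𝔑ᵘ_{X, X₀} 𝔄³ 𝕂, B] → ⋯`
of commutative monoids. -/
abbrev RoeColimit : Type u :=
  SeqColimit (fun i => RoeClass A B X₀ (i + 1)) (fun i => transition A B X₀ (i + 1))

/-- The canonical map from the first term of the sequence to the colimit. -/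
def toColimit (x : RoeClass A B X₀ 1) : RoeColimit A B X₀ :=
  SeqColimit.of (fun i => RoeClass A B X₀ (i + 1)) (fun i => transition A B X₀ (i + 1)) 0 x

end Transition

end RoeAsym

end

/-! Write 𝔑 and 𝔐 for the relative and the absolute Roe functor, 𝔗E = C_b([0,∞),E), and H = 𝔄ⁿ𝕂, E =
HB. The task is to compare homomorphisms A → 𝔑𝔄E with homomorphisms A → 𝔑𝔄²E. An element of 𝔄²E is
represented by a function f(u)(v) of two variables, and the inverse of the transition map restricts
f to a graph: f ↦ (t ↦ f(t)(r(t))), with r continuous and growing fast.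

No single r works for all of 𝔄²E: r must send the functions that vanish in 𝔄²E to functions that
vanish in 𝔄E. Countably many such functions can be treated at once (`exists_adapted`), and
separability of A reduces to this case. The image of A lifts to a separable subalgebra of 𝔐𝔗²E. An
element of the kernel of 𝔐𝔗²E → 𝔑𝔄²E is the sum of an element of the ideal supported near X₀ and a
matrix all of whose entries vanish in 𝔄²E; as X is countable, that matrix has countably many
entries. A countable dense part of the kernel thus involves only countably many functions, and a
homomorphism on 𝔗²E that kills these functions induces a homomorphism on A (`exists_induced`). No
uniformity over the matrix entries is needed, because the Roe functor stands outside.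

Surjectivity (`exists_fHomotopic_asymUnit`): the family (t₁,t,s) ↦ f(max(t₁,st))(max(t,r(st))), s in
[0,1], joins f to its restriction to the graph of r. For s = 0 and large t it is f(t₁)(t); for s = 1
and t ≥ t₁ it is f(t)(r(t)), which no longer depends on t₁ and therefore comes from 𝔄E. For large t
the second argument dominates r of the first, so the functions that r was chosen for remain null
throughout.

Injectivity (`fHomotopic_of_asymUnit`): a homotopy in 𝔑𝔄²H(IB) is restricted to a graph in the same
way. Its ends come from homomorphisms φ, ψ into 𝔑𝔄E; after a further enlargement of r, the ends of
the restriction are φ and ψ with the variable t replaced by r(t). The family f(max(t,s r(t))) undoes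
this replacement up to homotopy (`fHomotopic_stretch`).

The families above take values in the cylinder I(HB), while an F-homotopy needs H(IB). The passage
between them is `HasExchange`, which holds for 𝔄 and for 𝕂 by compactness of [0,1] and is never
needed for the Roe functor. -/

noncomputable section

namespace RoeAsym

/-! ### Images, sections and separable lifts for `⋆`-homomorphisms. -/

section ClosedRange

variable {P Q : Type*} [NonUnitalCStarAlgebra P] [NonUnitalCStarAlgebra Q]

/-- The kernel of a `⋆`-homomorphism, as a closed ideal. -/
def kerIdeal (φ : P →⋆ₙₐ[ℂ] Q) : CStarIdeal P where
  carrier := {p | φ p = 0}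
  zero_mem' := map_zero φ
  add_mem' := fun {a b} (ha : φ a = 0) (hb : φ b = 0) => by
    change φ (a + b) = 0
    rw [map_add, ha, hb, add_zero]
  smul_mem' := fun c a (ha : φ a = 0) => by
    change φ (c • a) = 0
    rw [map_smul, ha, smul_zero]
  isClosed' := isClosed_singleton.preimage (starHom_continuous φ)
  mul_left_mem := fun a {j} (hj : φ j = 0) => by
    change φ (a * j) = 0
    rw [map_mul, hj, mul_zero]
  mul_right_mem := fun a {j} (hj : φ j = 0) => by
    change φ (j * a) = 0
    rw [map_mul, hj, zero_mul]
  star_mem' := fun {j} (hj : φ j = 0) => by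
    change φ (star j) = 0
    rw [map_star, hj, star_zero]

/-- The zero ideal. -/
def zeroIdeal (Q : Type*) [NonUnitalCStarAlgebra Q] : CStarIdeal Q :=
  kerIdeal (NonUnitalStarAlgHom.id ℂ Q)

/-- The range of a `⋆`-homomorphism of C⋆-algebras is closed. -/
theorem isClosed_range_starHom (φ : P →⋆ₙₐ[ℂ] Q) : IsClosed (Set.range φ) := by
  -- The map induced on P modulo its kernel is injective, hence isometric, and so has closed range.
  -- Dividing Q by the zero ideal presents it as a map of quotients, which `CStarIdeal.Quot.map`
  -- supplies.
  let q : Q →⋆ₙₐ[ℂ] (zeroIdeal Q).Quot := CStarIdeal.Quot.mk (zeroIdeal Q)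
  have hq : Isometry q := NonUnitalStarAlgHom.isometry q fun a b h =>
    sub_eq_zero.1 ((CStarIdeal.Quot.mk_eq_iff (zeroIdeal Q)).1 h)
  let ψ : (kerIdeal φ).Quot →⋆ₙₐ[ℂ] (zeroIdeal Q).Quot :=
    CStarIdeal.Quot.map (J := kerIdeal φ) (K := zeroIdeal Q) φ fun _ h => h
  have hψ : Isometry ψ := by
    refine NonUnitalStarAlgHom.isometry ψ fun x y h => ?_
    obtain ⟨a, rfl⟩ := CStarIdeal.Quot.mk_surjective _ x
    obtain ⟨b, rfl⟩ := CStarIdeal.Quot.mk_surjective _ y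
    refine (CStarIdeal.Quot.mk_eq_iff _).2 ?_
    change φ (a - b) = 0
    rw [map_sub]
    exact (CStarIdeal.Quot.mk_eq_iff (zeroIdeal Q)).1 h
  have h1 : IsClosed (Set.range ψ) := hψ.isClosedEmbedding.isClosed_range
  convert h1.preimage hq.continuous using 1
  ext y
  constructor
  · rintro ⟨p, rfl⟩
    exact ⟨CStarIdeal.Quot.mk _ p, rfl⟩
  · rintro ⟨x, hx⟩
    obtain ⟨a, rfl⟩ := CStarIdeal.Quot.mk_surjective _ x
    exact ⟨a, hq.injective hx⟩

/-- The image of a closed `⋆`-subalgebra under a `⋆`-homomorphism is closed. -/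
theorem isClosed_image_starHom (φ : P →⋆ₙₐ[ℂ] Q) (S : NonUnitalStarSubalgebra ℂ P)
    (hS : IsClosed (S : Set P)) : IsClosed (φ '' S) := by
  have : IsClosed (S : Set P) := hS
  have h := isClosed_range_starHom (φ.comp (NonUnitalStarSubalgebraClass.subtype S))
  convert h using 1
  ext y
  constructor
  · rintro ⟨p, hp, rfl⟩
    exact ⟨⟨p, hp⟩, rfl⟩
  · rintro ⟨p, rfl⟩
    exact ⟨p, p.2, rfl⟩

/-- A `⋆`-homomorphism of C⋆-algebras with dense range is surjective. -/
theorem surjective_of_denseRange (φ : P →⋆ₙₐ[ℂ] Q) (h : DenseRange φ) :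
    Function.Surjective φ := by
  rw [← Set.range_eq_univ, ← (isClosed_range_starHom φ).closure_eq]
  exact h.closure_range

/-- A surjective `⋆`-homomorphism admits preimages of controlled norm, and `0` for `0`. -/
theorem exists_bounded_section (φ : P →⋆ₙₐ[ℂ] Q) (h : Function.Surjective φ) :
    ∃ (s : Q → P) (C : ℝ), 0 < C ∧ s 0 = 0 ∧ ∀ y, φ (s y) = y ∧ ‖s y‖ ≤ C * ‖y‖ := by
  let f : P →L[ℂ] Q :=
    { toFun := φ, map_add' := map_add φ, map_smul' := map_smul φ, cont := starHom_continuous φ }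
  -- This is the open mapping theorem; its norm bound already forces the preimage of 0 to be 0.
  obtain ⟨C, hC, hs⟩ := f.exists_preimage_norm_le h
  choose s hs using hs
  refine ⟨s, C, hC, ?_, hs⟩
  have := (hs 0).2
  rwa [norm_zero, mul_zero, norm_le_zero_iff] at this

/-- Let `π : P → Q` and `σ : P → R` be `⋆`-homomorphisms, and `D` a `⋆`-subalgebra of `P` on which
the kernel of `π` is contained in that of `σ`. A `⋆`-homomorphism `φ` into `π(D)` induces one
into `R`. -/
theorem exists_factor {A R : Type*} [NonUnitalCStarAlgebra A] [NonUnitalCStarAlgebra R]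
    (π : P →⋆ₙₐ[ℂ] Q) (σ : P →⋆ₙₐ[ℂ] R) (D : NonUnitalStarSubalgebra ℂ P)
    (hσ : ∀ d ∈ D, π d = 0 → σ d = 0) (φ : A →⋆ₙₐ[ℂ] Q) (hφ : ∀ a, ∃ d ∈ D, π d = φ a) :
    ∃ ψ : A →⋆ₙₐ[ℂ] R, ∀ a, ∀ d ∈ D, π d = φ a → σ d = ψ a := by
  choose l hlD hl using hφ
  -- The value of σ does not depend on the lift within D. Each algebraic identity for ψ then follows
  -- by comparing two lifts of the same element.
  have key : ∀ a, ∀ d ∈ D, π d = φ a → σ d = σ (l a) := fun a d hd h => by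
    rw [← sub_eq_zero, ← map_sub]
    exact hσ _ (sub_mem hd (hlD a)) (by rw [map_sub, h, hl, sub_self])
  refine ⟨{ toFun := fun a => σ (l a)
            map_smul' := fun c a => ?_
            map_zero' := ?_
            map_add' := fun a b => ?_
            map_mul' := fun a b => ?_
            map_star' := fun a => ?_ }, key⟩
  · rw [← key _ (c • l a) (SMulMemClass.smul_mem c (hlD a)) (by simp only [map_smul, hl]), map_smul]
    rfl
  · change σ (l 0) = 0
    rw [← key 0 0 (zero_mem _) (by simp), map_zero]
  · change σ (l (a + b)) = σ (l a) + σ (l b)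
    rw [← key _ (l a + l b) (add_mem (hlD a) (hlD b)) (by simp only [map_add, hl]), map_add]
  · rw [← key _ (l a * l b) (mul_mem (hlD a) (hlD b)) (by simp only [map_mul, hl]), map_mul]
  · rw [← key _ (star (l a)) (star_mem (hlD a)) (by simp only [map_star, hl]), map_star]

/-- Products of nonempty finite lists of generators form a subsemigroup, parametrized by a first
factor and a list of further ones. This makes the algebra generated by countably many elements
separable. -/
theorem countable_subsemigroup_closure {S : Type*} [Semigroup S] {t : Set S} (ht : t.Countable) :
    (Subsemigroup.closure t : Set S).Countable := by
  have : Countable t := ht.to_subtype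
  let f : t × List t → S := fun p => (p.2.map Subtype.val).foldl (· * ·) p.1.1
  let T : Subsemigroup S :=
    { carrier := Set.range f
      mul_mem' := by
        rintro _ _ ⟨⟨a, l⟩, rfl⟩ ⟨⟨b, m⟩, rfl⟩
        refine ⟨⟨a, l ++ b :: m⟩, ?_⟩
        simp only [f, List.map_append, List.map_cons, List.foldl_append, List.foldl_cons]
        exact List.foldl_assoc }
  have hT : Subsemigroup.closure t ≤ T :=
    Subsemigroup.closure_le.2 fun a ha => ⟨(⟨a, ha⟩, []), rfl⟩
  exact (Set.countable_range f).mono hT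

open NonUnitalStarAlgebra in
/-- The image of a separable C⋆-algebra lifts, along a surjective `⋆`-homomorphism, to a separable
`⋆`-subalgebra. -/
theorem exists_separable_lift {A : Type*} [NonUnitalCStarAlgebra A]
    [TopologicalSpace.SeparableSpace A] (π : P →⋆ₙₐ[ℂ] Q) (hπ : Function.Surjective π)
    (φ : A →⋆ₙₐ[ℂ] Q) : ∃ D : NonUnitalStarSubalgebra ℂ P,
      TopologicalSpace.IsSeparable (D : Set P) ∧ ∀ a, ∃ d ∈ D, π d = φ a := by
  obtain ⟨s, hs, hd⟩ := TopologicalSpace.exists_countable_dense A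
  choose l hl using fun a => hπ (φ a)
  let D := (NonUnitalStarAlgebra.adjoin ℂ (l '' s)).topologicalClosure
  refine ⟨D, ?_, fun a => ?_⟩
  · refine TopologicalSpace.IsSeparable.closure ?_
    -- The generated `⋆`-algebra is the linear span of the semigroup generated by the chosen lifts
    -- and their adjoints.
    have h1 : (l '' s ∪ star (l '' s)).Countable := by
      refine (hs.image l).union ?_
      rw [← Set.image_star]
      exact (hs.image l).image _
    have h2 := (countable_subsemigroup_closure h1).isSeparable.span (R := ℂ)
    rw [← adjoin_eq_span] at h2
    exact h2
  -- D lifts φ only on the dense set by construction; closedness of π(D) extends this to all of A.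
  · have hc : IsClosed (π '' D) :=
      isClosed_image_starHom π D (NonUnitalStarSubalgebra.isClosed_topologicalClosure _)
    have : φ a ∈ closure (π '' D) := by
      refine map_mem_closure (starHom_continuous φ) (hd a) fun b hb => ?_
      exact ⟨l b, NonUnitalStarSubalgebra.le_topologicalClosure _
        (subset_adjoin ℂ _ ⟨b, hb, rfl⟩), hl b⟩
    rw [hc.closure_eq] at this
    exact this

end ClosedRange

/-! ### Compression of operators to a subset of the index set. -/

section Cut

variable {X B : Type*} [NonUnitalCStarAlgebra B]

open Classical in
/-- The restriction of vectors to a subset. -/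
def cutL (Y : Set X) : L2 X B →L[ℂ] L2 X B :=
  LinearMap.mkContinuous
    { toFun := fun ξ => L2.mk (fun x => if x ∈ Y then ξ.1 x else 0) (by
        refine (ξ.2.indicator Y).congr fun x => ?_
        rw [Set.indicator_apply]
        split_ifs <;> simp)
      map_add' := fun ξ η => L2.ext fun x => by
        simp only [L2.mk_val, L2.add_val]; split_ifs <;> simp
      map_smul' := fun c ξ => L2.ext fun x => by
        simp only [L2.mk_val, L2.smul_val, RingHom.id_apply]; split_ifs <;> simp } 1
    (fun ξ => by
      rw [one_mul]
      refine L2.norm_le_of_forall_sum _ (norm_nonneg _) fun t => ?_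
      refine le_trans (le_of_eq ?_) (L2.norm_sum_le ξ (t.filter (· ∈ Y)))
      congr 1
      rw [Finset.sum_filter]
      refine Finset.sum_congr rfl fun x _ => ?_
      simp only [LinearMap.coe_mk, AddHom.coe_mk, L2.mk_val]
      split_ifs <;> simp)

open Classical in
theorem cutL_val (Y : Set X) (ξ : L2 X B) (x : X) :
    (cutL Y ξ).1 x = if x ∈ Y then ξ.1 x else 0 := rfl

theorem isAdjointPair_cutL (Y : Set X) : IsAdjointPair (cutL (B := B) Y) (cutL Y) := fun ξ η =>
  tsum_congr fun x => by rw [cutL_val, cutL_val]; split_ifs <;> simp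

/-- The projection onto the vectors supported in a subset. -/
def cut (Y : Set X) : Adj X B := ⟨cutL Y, cutL Y, isAdjointPair_cutL Y⟩

open Classical in
theorem isMatrix_cut {T : Adj X B} {m : X → X → B} (h : IsMatrix T m) (Y : Set X) :
    IsMatrix (cut Y * T * cut Y) fun x y => if x ∈ Y ∧ y ∈ Y then m x y else 0 := by
  intro x y b
  have e : cutL Y (L2.single y b) = if y ∈ Y then L2.single y b else 0 := by
    ext z
    rw [cutL_val]
    by_cases hz : z = y
    · subst hz; split_ifs <;> rfl
    · rw [L2.single_val, if_neg hz, ite_self]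
      split_ifs
      · rw [L2.single_val, if_neg hz]
      · rfl
  change (cutL Y (T.1 (cutL Y (L2.single y b)))).1 x = _
  rw [cutL_val, e]
  by_cases hx : x ∈ Y <;> by_cases hy : y ∈ Y <;> simp [hx, hy, h x y b]

/-- Compression never enlarges the support of a matrix and is norm continuous, so it passes from
banded matrices to the closure. -/
theorem cut_mem_matAlg (E : SupportFamily X) (Y : Set X) {T : Adj X B} (hT : T ∈ matAlg E B) :
    cut Y * T * cut Y ∈ matAlg E B := by
  classical
  refine map_mem_closure (f := fun T : Adj X B => cut Y * T * cut Y) ?_ hT fun S hS => ?_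
  · exact (continuous_const.mul continuous_id).mul continuous_const
  · obtain ⟨m, hm, hs, -⟩ := hS
    have h := isMatrix_cut hm Y
    refine ⟨_, h, E.mono (fun x y hxy => ?_) hs, _, h.norm_le⟩
    intro h0
    simp [h0] at hxy

end Cut

/-! ### Entrywise lifting of matrices along a surjection. -/

section Lifting

variable {X : Type*} (E : SupportFamily X) {P Q : Type*} [NonUnitalCStarAlgebra P]
  [NonUnitalCStarAlgebra Q]

/-- Entrywise application of a surjective `⋆`-homomorphism is surjective. -/
theorem matAlgMap_surjective (q : P →⋆ₙₐ[ℂ] Q) (hq : Function.Surjective q) :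
    Function.Surjective (matAlgMap E q) := by
  -- Since the range is closed, it suffices to lift the dense set of banded matrices, and these lift
  -- entry by entry.
  refine surjective_of_denseRange _ fun T => ?_
  obtain ⟨s, C, hC, hs0, hs⟩ := exists_bounded_section q hq
  obtain ⟨u, hu, hT⟩ := (mem_matAlg_iff E).1 T.2
  have hle : banded E P ≤ matAlg E P := NonUnitalStarSubalgebra.le_topologicalClosure _
  have hle' : banded E Q ≤ matAlg E Q := NonUnitalStarSubalgebra.le_topologicalClosure _
  let w : ℕ → MatAlg E Q := fun n => ⟨u n, hle' (hu n)⟩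
  have hw : Tendsto w atTop (𝓝 T) := (MatAlg.tendsto_iff E).2 hT
  refine mem_closure_of_tendsto hw (Eventually.of_forall fun n => ?_)
  obtain ⟨m, hm, hsupp, K, hK⟩ := hu n
  -- The normalization s 0 = 0 keeps the support, and the linear bound on s keeps the entries
  -- uniformly bounded.
  have h1 : E.IsSupp fun x y => s (m x y) ≠ 0 :=
    E.mono (fun x y hxy (h0 : m x y = 0) => hxy (by rw [h0, hs0])) hsupp
  have h2 : ∀ x y, ‖s (m x y)‖ ≤ C * K := fun x y =>
    (hs _).2.trans (mul_le_mul_of_nonneg_left (hK x y) hC.le)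
  obtain ⟨S, hS⟩ := E.exists_adj h1 h2
  refine ⟨⟨S, hle ⟨_, hS, h1, _, h2⟩⟩, matAlgMap_eq E q hS ?_⟩
  simpa only [(hs _).1] using hm

theorem matAlgMap_eq_zero (q : P →⋆ₙₐ[ℂ] Q) {T : MatAlg E P} {m : X → X → P} (h : IsMatrix T.1 m)
    (h0 : ∀ x y, q (m x y) = 0) : matAlgMap E q T = 0 := by
  refine matAlgMap_eq E q h ?_
  simp only [h0]
  exact IsMatrix.zero

theorem apply_eq_zero_of_matAlgMap_eq_zero (q : P →⋆ₙₐ[ℂ] Q) {T : MatAlg E P} {m : X → X → P}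
    (h : IsMatrix T.1 m) (h0 : matAlgMap E q T = 0) (x y : X) : q (m x y) = 0 := by
  have h1 := matAlgMap_spec E q T h
  rw [h0] at h1
  exact congrFun₂ (h1.unique IsMatrix.zero) x y

end Lifting

/-! ### The kernel of 𝔐P → 𝔑Q and homomorphisms induced from separable algebras. -/

section Relative

variable {X : Type u} [MetricSpace X] [BoundedGeometry X] (X₀ : Set X)
  {P Q R : CStarAlg.{u}}

/-- The projection `𝔐ᵘ_X B → 𝔑ᵘ_{X, X₀} B`. -/
def relMk (B : CStarAlg.{u}) : (roeFunctor X).obj B →⋆ₙₐ[ℂ] (relRoeFunctor X₀).obj B :=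
  CStarIdeal.Quot.mk (relIdeal X₀ B)

theorem relMk_surjective (B : CStarAlg.{u}) : Function.Surjective (relMk X₀ B) :=
  CStarIdeal.Quot.mk_surjective (relIdeal X₀ B)

theorem relMk_eq_zero_iff {B : CStarAlg.{u}} {T : (roeFunctor X).obj B} :
    relMk X₀ B T = 0 ↔ T ∈ closure (supportedNear X₀ B) := by
  rw [← map_zero (relMk X₀ B)]
  refine (CStarIdeal.Quot.mk_eq_iff (relIdeal X₀ B)).trans ?_
  rw [sub_zero]
  rfl

theorem roeMap_surjective (q : P →⋆ₙₐ[ℂ] Q) (hq : Function.Surjective q) :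
    Function.Surjective ((roeFunctor X).map q) := matAlgMap_surjective (propagationFamily X) q hq

/-- The composition `𝔐ᵘ_X P → 𝔐ᵘ_X Q → 𝔑ᵘ_{X, X₀} Q`. -/
def relProj (q : P →⋆ₙₐ[ℂ] Q) : (roeFunctor X).obj P →⋆ₙₐ[ℂ] (relRoeFunctor X₀).obj Q :=
  (relMk X₀ Q).comp ((roeFunctor X).map q)

theorem relProj_surjective (q : P →⋆ₙₐ[ℂ] Q) (hq : Function.Surjective q) :
    Function.Surjective (relProj X₀ q) :=
  (relMk_surjective X₀ Q).comp (roeMap_surjective q hq)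

theorem map_relProj (f : Q →⋆ₙₐ[ℂ] R) (q : P →⋆ₙₐ[ℂ] Q) (T : (roeFunctor X).obj P) :
    (relRoeFunctor X₀).map f (relProj X₀ q T) = relProj X₀ (f.comp q) T := by
  change relMk X₀ R ((roeFunctor X).map f ((roeFunctor X).map q T)) = _
  rw [(roeFunctor X).map_comp_apply]
  rfl

theorem relProj_map (f : Q →⋆ₙₐ[ℂ] R) (q : P →⋆ₙₐ[ℂ] Q) (T : (roeFunctor X).obj P) :
    relProj X₀ f ((roeFunctor X).map q T) = relProj X₀ (f.comp q) T := by
  change relMk X₀ R ((roeFunctor X).map f ((roeFunctor X).map q T)) = _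
  rw [(roeFunctor X).map_comp_apply]
  rfl

theorem relProj_eq_zero_of_mem (q : P →⋆ₙₐ[ℂ] Q) {T : (roeFunctor X).obj P}
    (hT : T ∈ closure (supportedNear X₀ P)) : relProj X₀ q T = 0 := by
  have h := (relMk_eq_zero_iff X₀).2 hT
  change (relRoeFunctor X₀).map q (relMk X₀ P T) = 0
  rw [h, map_zero]

/-- The image of the closed ideal over P is closed, so only matrices supported in some neighbourhood
of X₀ need a lift. Any lift can be compressed to that neighbourhood: the entries that are cut away
map to 0 anyway. -/
theorem mem_image_supportedNear (q : P →⋆ₙₐ[ℂ] Q) (hq : Function.Surjective q)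
    {T : (roeFunctor X).obj Q} (hT : T ∈ closure (supportedNear X₀ Q)) :
    ∃ S ∈ closure (supportedNear X₀ P), (roeFunctor X).map q S = T := by
  classical
  have hc : IsClosed ((roeFunctor X).map q '' (relIdeal X₀ P).toSubalg) :=
    isClosed_image_starHom _ _ (relIdeal X₀ P).isClosed'
  have hT' : T ∈ closure ((roeFunctor X).map q '' (relIdeal X₀ P).toSubalg) := by
    refine closure_mono ?_ hT
    rintro T ⟨r, hr, m, hm, hmr⟩
    obtain ⟨S, hS⟩ := roeMap_surjective q hq T
    obtain ⟨n, hn⟩ := exists_isMatrix _ S.2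
    have hcut := isMatrix_cut hn (Metric.thickening r X₀)
    let S' : (roeFunctor X).obj P := ⟨_, cut_mem_matAlg _ (Metric.thickening r X₀) S.2⟩
    refine ⟨S', subset_closure ⟨r, hr, _, hcut, fun x y hxy => ?_⟩, ?_⟩
    · by_contra h0
      exact hxy (if_neg h0)
    · refine matAlgMap_eq (propagationFamily X) q (T := S') hcut ?_
      have hqn : m = fun x y => q (n x y) := by
        refine hm.unique ?_
        rw [← hS]
        exact matAlgMap_spec _ q S hn
      convert hm using 1
      funext x y
      split_ifs with h
      · rw [hqn]
      · rw [map_zero]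
        by_contra h0
        exact h (hmr x y (Ne.symm h0))
  rw [hc.closure_eq] at hT'
  exact hT'

/-- X is the union of the balls of integer radius about one point, and each of them is finite.
Countability is what turns a matrix into countably many conditions. -/
theorem BoundedGeometry.countable {X : Type*} [MetricSpace X] [BoundedGeometry X] : Countable X := by
  rcases isEmpty_or_nonempty X with h | ⟨⟨x⟩⟩
  · infer_instance
  · rw [← Set.countable_univ_iff, ← Metric.iUnion_closedBall_nat x]
    refine Set.countable_iUnion fun n => ?_
    -- Bounded geometry is stated for positive radii only, hence n + 1 to include n = 0.
    obtain ⟨k, hk⟩ := BoundedGeometry.card_ball_le (X := X) (n + 1) (by positivity)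
    exact ((Set.finite_of_encard_le_coe (hk x)).subset
      (Metric.closedBall_subset_closedBall (by simp))).countable

/-- An element of the kernel of `𝔐ᵘ_X P → 𝔑ᵘ_{X, X₀} Q` is killed by every homomorphism that kills
a certain countable subset of the kernel of `P → Q`. -/
theorem exists_countable_of_relProj_eq_zero (q : P →⋆ₙₐ[ℂ] Q) (hq : Function.Surjective q)
    {T : (roeFunctor X).obj P} (hT : relProj X₀ q T = 0) :
    ∃ c : Set P, c.Countable ∧ (∀ p ∈ c, q p = 0) ∧
      ∀ {R : CStarAlg.{u}} (ρ : P →⋆ₙₐ[ℂ] R), (∀ p ∈ c, ρ p = 0) → relProj X₀ ρ T = 0 := by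
  have : Countable X := BoundedGeometry.countable
  -- The image of T in 𝔐Q lies in the ideal near X₀ and lifts to S in the corresponding ideal over
  -- P. Then T − S maps to 0 in 𝔐Q, which means that each of its entries is killed by q; these
  -- entries form the countable set.
  obtain ⟨S, hS, hST⟩ := mem_image_supportedNear X₀ q hq ((relMk_eq_zero_iff X₀).1 hT)
  obtain ⟨m, hm⟩ := exists_isMatrix _ (T - S).2
  refine ⟨Set.range fun z : X × X => m z.1 z.2, Set.countable_range _, ?_, fun ρ hρ => ?_⟩
  · rintro _ ⟨z, rfl⟩
    refine apply_eq_zero_of_matAlgMap_eq_zero (propagationFamily X) q (T := T - S) hm ?_ _ _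
    refine (map_sub ((roeFunctor X).map q) T S).trans ?_
    exact sub_eq_zero.2 hST.symm
  · have h1 : (roeFunctor X).map ρ (T - S) = 0 :=
      matAlgMap_eq_zero (propagationFamily X) ρ (T := T - S) hm fun x y => hρ _ ⟨(x, y), rfl⟩
    have h2 : relProj X₀ ρ (T - S) = 0 := by
      change relMk X₀ _ ((roeFunctor X).map ρ (T - S)) = 0
      rw [h1, map_zero]
    rw [map_sub, relProj_eq_zero_of_mem X₀ ρ hS, sub_zero] at h2
    exact h2

/-- A homomorphism `A → 𝔑ᵘ_{X, X₀} Q` on a separable algebra induces a homomorphism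
`A → 𝔑ᵘ_{X, X₀} R` for every homomorphism `P → R` that kills a certain countable subset of the
kernel of `P → Q`. -/
theorem exists_induced {A : CStarAlg.{u}} [TopologicalSpace.SeparableSpace A]
    (q : P →⋆ₙₐ[ℂ] Q) (hq : Function.Surjective q) (φ : A →⋆ₙₐ[ℂ] (relRoeFunctor X₀).obj Q) :
    ∃ (c : Set P) (l : A → (roeFunctor X).obj P), c.Countable ∧ (∀ p ∈ c, q p = 0) ∧
      (∀ a, relProj X₀ q (l a) = φ a) ∧
      ∀ {R : CStarAlg.{u}} (ρ : P →⋆ₙₐ[ℂ] R), (∀ p ∈ c, ρ p = 0) →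
        ∃ ψ : A →⋆ₙₐ[ℂ] (relRoeFunctor X₀).obj R, ∀ a, relProj X₀ ρ (l a) = ψ a := by
  obtain ⟨D, hD, hl⟩ := exists_separable_lift (relProj X₀ q) (relProj_surjective X₀ q hq) φ
  choose l hlD hl using hl
  -- The kernel inside the separable algebra D is separable as well. Treating a countable dense
  -- subset s of it is enough, because the kernel of `relProj X₀ ρ` is closed.
  obtain ⟨s, hsD, hs, hds⟩ := (hD.mono (Set.inter_subset_left
    (t := {T | relProj X₀ q T = 0}))).exists_countable_dense_subset
  choose! c hc hcq hcρ using fun T (hT : T ∈ s) =>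
    exists_countable_of_relProj_eq_zero X₀ q hq (hsD hT).2
  refine ⟨⋃ T ∈ s, c T, l, hs.biUnion hc, ?_, hl, fun ρ hρ => ?_⟩
  · intro p hp
    obtain ⟨T, hT, hp⟩ := Set.mem_iUnion₂.1 hp
    exact hcq T hT p hp
  · obtain ⟨ψ, hψ⟩ := exists_factor (relProj X₀ q) (relProj X₀ ρ) D (fun d hd h0 => by
      have hcl : IsClosed {T | relProj X₀ ρ T = 0} :=
        isClosed_singleton.preimage (starHom_continuous (relProj X₀ ρ))
      refine closure_minimal (fun T hT => ?_) hcl (hds ⟨hd, h0⟩)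
      exact hcρ T hT ρ fun p hp => hρ p (Set.mem_iUnion₂.2 ⟨T, hT, hp⟩)) φ
      fun a => ⟨l a, hlD a, hl a⟩
    exact ⟨ψ, fun a => hψ a _ (hlD a) (hl a)⟩

end Relative

/-! ### Continuous selections along a surjection. -/

section PathLifting

variable {P Q : Type*} [NonUnitalCStarAlgebra P] [NonUnitalCStarAlgebra Q]

/-- A bounded continuous function with values in the range of a surjective `⋆`-homomorphism lifts
approximately to a bounded continuous function. -/
theorem exists_approx_continuous_lift {Z : Type*} [TopologicalSpace Z] [NormalSpace Z]
    [ParacompactSpace Z] (q : P →⋆ₙₐ[ℂ] Q) (hq : Function.Surjective q) {f : Z → Q}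
    (hf : Continuous f) {K : ℝ} (hK : ∀ z, ‖f z‖ ≤ K) {ε : ℝ} (hε : 0 < ε) :
    ∃ (g : Z → P) (C : ℝ), Continuous g ∧ (∀ z, ‖g z‖ ≤ C) ∧ ∀ z, ‖f z - q (g z)‖ < ε := by
  obtain ⟨s, C, hC, -, hs⟩ := exists_bounded_section q hq
  -- Convexity is a notion over ℝ, so q is regarded as a real linear map.
  let q' : P →ₗ[ℝ] Q :=
    { toFun := q, map_add' := map_add q, map_smul' := fun c p => map_smul q (c : ℂ) p }
  -- The admissible values at z form a convex set, and a fixed lift of f(z) is admissible at all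
  -- points near z, so a partition of unity glues such local choices. The closed ball keeps the
  -- selection bounded, as needed for C_b.
  let t : Z → Set P := fun z => q' ⁻¹' Metric.ball (f z) ε ∩ Metric.closedBall 0 (C * K)
  obtain ⟨g, hg⟩ := exists_continuous_forall_mem_convex_of_local_const (t := t)
    (fun z => ((convex_ball _ _).linear_preimage q').inter (convex_closedBall _ _)) fun z => by
      refine ⟨s (f z), ?_⟩
      filter_upwards [hf.continuousAt (Metric.ball_mem_nhds (f z) hε)] with y hy
      refine ⟨?_, ?_⟩
      · change q (s (f z)) ∈ Metric.ball (f y) ε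
        rw [(hs _).1, Metric.mem_ball']
        exact hy
      · rw [mem_closedBall_zero_iff]
        exact (hs _).2.trans (mul_le_mul_of_nonneg_left (hK z) hC.le)
  refine ⟨g, C * K, g.continuous, fun z => mem_closedBall_zero_iff.1 (hg z).2, fun z => ?_⟩
  have := (hg z).1
  rw [← dist_eq_norm]
  exact Metric.mem_ball'.1 this

end PathLifting

/-! ### Function algebras on [0,1] and [0,∞), and the choice of a growth function. -/

section Families

open scoped NNReal BoundedContinuousFunction

variable {D E : CStarAlg.{u}}

/-- A continuous family of `⋆`-homomorphisms indexed by `[0,1]`, as a homomorphism into the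
cylinder. -/
def cylHom (η : unitInterval → (D →⋆ₙₐ[ℂ] E)) (h : ∀ d, Continuous fun s => η s d) :
    D →⋆ₙₐ[ℂ] cyl E where
  toFun d := (⟨fun s => η s d, h d⟩ : C(unitInterval, E))
  map_smul' c _ := ContinuousMap.ext fun s => map_smul (η s) c _
  map_zero' := ContinuousMap.ext fun s => map_zero (η s)
  map_add' _ _ := ContinuousMap.ext fun s => map_add (η s) _ _
  map_mul' _ _ := ContinuousMap.ext fun s => map_mul (η s) _ _
  map_star' _ := ContinuousMap.ext fun s => map_star (η s) _

/-- A continuous family of `⋆`-homomorphisms indexed by `[0,∞)`, as a homomorphism into the path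
algebra. -/
def pathHom (η : ℝ≥0 → (D →⋆ₙₐ[ℂ] E)) (h : ∀ d, Continuous fun t => η t d) :
    D →⋆ₙₐ[ℂ] pathAlg E where
  toFun d := BoundedContinuousFunction.ofNormedAddCommGroup (fun t => η t d) (h d) ‖d‖
    fun t => NonUnitalStarAlgHom.norm_apply_le (η t) d
  map_smul' c _ := BoundedContinuousFunction.ext fun t => map_smul (η t) c _
  map_zero' := BoundedContinuousFunction.ext fun t => map_zero (η t)
  map_add' _ _ := BoundedContinuousFunction.ext fun t => map_add (η t) _ _
  map_mul' _ _ := BoundedContinuousFunction.ext fun t => map_mul (η t) _ _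
  map_star' _ := BoundedContinuousFunction.ext fun t => map_star (η t) _

/-- A jointly continuous family of `⋆`-homomorphisms indexed by `[0,∞) × [0,1]`, as a homomorphism
into the path algebra of the cylinder. -/
def pathCylHom (η : ℝ≥0 → unitInterval → (D →⋆ₙₐ[ℂ] E))
    (h : ∀ d, Continuous fun z : ℝ≥0 × unitInterval => η z.1 z.2 d) :
    D →⋆ₙₐ[ℂ] pathAlg (cyl E) :=
  pathHom (fun t => cylHom (η t) fun d => (h d).comp (by fun_prop : Continuous fun s => (t, s)))
    -- Currying gives continuity for the compact-open topology, which on the compact interval is the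
    -- norm topology of the cylinder.
    fun d => (ContinuousMap.curry
      (⟨fun z => η z.1 z.2 d, h d⟩ : C(ℝ≥0 × unitInterval, E))).continuous

theorem norm_cyl_le {f : cyl E} {C : ℝ} (hC : 0 ≤ C) (h : ∀ s, ‖ev E s f‖ ≤ C) : ‖f‖ ≤ C :=
  (ContinuousMap.norm_le (show C(unitInterval, E) from f) hC).2 h

theorem norm_ev_le (f : cyl E) (s : unitInterval) : ‖ev E s f‖ ≤ ‖f‖ :=
  NonUnitalStarAlgHom.norm_apply_le (ev E s) f

theorem norm_path_le {f : pathAlg E} {C : ℝ} (hC : 0 ≤ C) (h : ∀ t, ‖pathEv t f‖ ≤ C) : ‖f‖ ≤ C :=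
  (BoundedContinuousFunction.norm_le (f := (show ℝ≥0 →ᵇ E from f)) hC).2 h

theorem continuous_pathEv (f : pathAlg E) : Continuous fun t => pathEv t f :=
  (show ℝ≥0 →ᵇ E from f).continuous

/-- The outer path is continuous for the supremum norm and evaluation is jointly continuous for that
norm. This allows f to be evaluated along arbitrary curves in the quadrant. -/
theorem continuous_pathEv_pathEv (f : pathAlg (pathAlg E)) :
    Continuous fun z : ℝ≥0 × ℝ≥0 => pathEv z.2 (pathEv z.1 f) :=
  (continuous_eval (F := ℝ≥0 →ᵇ E)).comp
    (((continuous_pathEv f).comp continuous_fst).prodMk continuous_snd)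

/-- The projection `𝔗 E → 𝔄 E`. -/
def asymMk (E : CStarAlg.{u}) : pathAlg E →⋆ₙₐ[ℂ] asymFunctor.obj E :=
  CStarIdeal.Quot.mk (nullIdeal E)

theorem asymMk_surjective : Function.Surjective (asymMk E) :=
  CStarIdeal.Quot.mk_surjective (nullIdeal E)

theorem asymMk_eq_zero_iff {f : pathAlg E} :
    asymMk E f = 0 ↔ Tendsto (fun t => pathEv t f) atTop (𝓝 0) := by
  rw [← map_zero (asymMk E)]
  refine (CStarIdeal.Quot.mk_eq_iff (nullIdeal E)).trans ?_
  rw [sub_zero]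
  rfl

theorem asymMk_eq_iff {f g : pathAlg E} :
    asymMk E f = asymMk E g ↔ Tendsto (fun t => pathEv t f - pathEv t g) atTop (𝓝 0) := by
  rw [← sub_eq_zero, ← map_sub, asymMk_eq_zero_iff]
  simp only [map_sub]

theorem asymMk_eq_of_eventually {f g : pathAlg E} (h : ∀ᶠ t in atTop, pathEv t f = pathEv t g) :
    asymMk E f = asymMk E g := by
  rw [asymMk_eq_iff]
  refine tendsto_const_nhds.congr' (h.mono fun t ht => ?_)
  exact (sub_eq_zero.2 ht).symm

/-- Some representative of the class has supremum norm only slightly above the quotient norm, and it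
differs from f by a null function. Together with `norm_asymMk_le` this identifies the norm of 𝔄E
with the limes superior of the pointwise norms. -/
theorem exists_forall_norm_lt_of_norm_asymMk_lt {f : pathAlg E} {δ : ℝ} (h : ‖asymMk E f‖ < δ) :
    ∃ V : ℝ≥0, ∀ v ≥ V, ‖pathEv v f‖ < δ := by
  have hδ : 0 < (δ - ‖asymMk E f‖) / 2 := by linarith
  obtain ⟨g, hg, hlt⟩ : ∃ g, asymMk E g = asymMk E f ∧
      ‖g‖ < ‖asymMk E f‖ + (δ - ‖asymMk E f‖) / 2 :=
    CStarIdeal.Quot.exists_norm_lt (nullIdeal E) (asymMk E f) hδ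
  have h0 : Tendsto (fun t => pathEv t f - pathEv t g) atTop (𝓝 0) := asymMk_eq_iff.1 hg.symm
  obtain ⟨V, hV⟩ := eventually_atTop.1 (Metric.tendsto_nhds.1 h0 _ hδ)
  refine ⟨V, fun v hv => ?_⟩
  have h1 := hV v hv
  rw [dist_zero_right] at h1
  have h2 := norm_pathEv_le g v
  have h3 : pathEv v f = (pathEv v f - pathEv v g) + pathEv v g := (sub_add_cancel _ _).symm
  rw [h3]
  exact (norm_add_le _ _).trans_lt (by linarith)

theorem norm_asymMk_le {f : pathAlg E} {C : ℝ} (V : ℝ≥0) (h : ∀ v ≥ V, ‖pathEv v f‖ ≤ C) :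
    ‖asymMk E f‖ ≤ C := by
  have hC : 0 ≤ C := (norm_nonneg _).trans (h V le_rfl)
  -- Freezing f before the time V leaves its class unchanged and makes the bound C hold everywhere.
  let g : pathAlg E := BoundedContinuousFunction.ofNormedAddCommGroup
    (fun t => pathEv (max V t) f) ((continuous_pathEv f).comp (by fun_prop)) C
    fun t => h _ (le_max_left _ _)
  have hg : asymMk E f = asymMk E g := by
    refine asymMk_eq_of_eventually ((eventually_ge_atTop V).mono fun t ht => ?_)
    change pathEv t f = pathEv (max V t) f
    rw [max_eq_right ht]
  rw [hg]
  exact (NonUnitalStarAlgHom.norm_apply_le (asymMk E) g).trans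
    (norm_path_le hC fun t => h _ (le_max_left _ _))

/-- The range is closed, so the approximate lifts supplied by `exists_approx_continuous_lift`
suffice. -/
theorem pathMap_surjective (q : D →⋆ₙₐ[ℂ] E) (hq : Function.Surjective q) :
    Function.Surjective (pathMap q) := by
  refine surjective_of_denseRange _ fun f => Metric.mem_closure_iff.2 fun ε hε => ?_
  obtain ⟨g, C, hg, hC, hgf⟩ := exists_approx_continuous_lift q hq (continuous_pathEv f)
    (norm_pathEv_le f) (half_pos hε)
  let g' : pathAlg D := BoundedContinuousFunction.ofNormedAddCommGroup g hg C hC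
  refine ⟨_, ⟨g', rfl⟩, ?_⟩
  rw [dist_eq_norm]
  refine (norm_path_le (half_pos hε).le fun t => ?_).trans_lt (half_lt_self hε)
  rw [map_sub]
  exact (hgf t).le

/-- The projection `𝔗² E → 𝔄² E`. -/
def asymMk₂ (E : CStarAlg.{u}) :
    pathAlg (pathAlg E) →⋆ₙₐ[ℂ] asymFunctor.obj (asymFunctor.obj E) :=
  (asymMk (asymFunctor.obj E)).comp (pathMap (asymMk E))

theorem asymMk₂_surjective : Function.Surjective (asymMk₂ E) :=
  asymMk_surjective.comp (pathMap_surjective _ asymMk_surjective)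

theorem asymMk₂_eq_zero_iff {f : pathAlg (pathAlg E)} :
    asymMk₂ E f = 0 ↔ Tendsto (fun t => asymMk E (pathEv t f)) atTop (𝓝 0) :=
  asymMk_eq_zero_iff (f := pathMap (asymMk E) f)

/-- `f(u)(v)` tends to zero as `u → ∞`, uniformly for `v ≥ r(u)`. -/
def Adapted (r : ℝ≥0 → ℝ≥0) (f : pathAlg (pathAlg E)) : Prop :=
  ∀ ε > 0, ∃ T : ℝ≥0, ∀ u ≥ T, ∀ v ≥ r u, ‖pathEv v (pathEv u f)‖ ≤ ε

theorem Adapted.mono {r r' : ℝ≥0 → ℝ≥0} (h : ∀ t, r t ≤ r' t) {f : pathAlg (pathAlg E)}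
    (hf : Adapted r f) : Adapted r' f := fun ε hε => by
  obtain ⟨T, hT⟩ := hf ε hε
  exact ⟨T, fun u hu v hv => hT u hu v ((h u).trans hv)⟩

/-- At the single time t, a threshold V exists because the norm in 𝔄E is a limes superior. As f(u)
moves little in supremum norm for u near t, the same V serves a whole neighbourhood; the three
errors are δ/3 each. -/
theorem eventually_forall_norm_le (f : pathAlg (pathAlg E)) (t : ℝ≥0) {δ : ℝ} (hδ : 0 < δ) :
    ∃ V : ℝ≥0, ∀ᶠ u in 𝓝 t, ∀ v ≥ V,
      ‖pathEv v (pathEv u f)‖ ≤ ‖asymMk E (pathEv u f)‖ + δ := by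
  obtain ⟨V, hV⟩ := exists_forall_norm_lt_of_norm_asymMk_lt
    (show ‖asymMk E (pathEv t f)‖ < ‖asymMk E (pathEv t f)‖ + δ / 3 by linarith)
  refine ⟨V, ?_⟩
  have hc : Tendsto (fun u => pathEv u f) (𝓝 t) (𝓝 (pathEv t f)) := (continuous_pathEv f).tendsto t
  filter_upwards [Metric.tendsto_nhds.1 hc (δ / 3) (by positivity)] with u hu v hv
  rw [dist_eq_norm] at hu
  have h1 : ‖pathEv v (pathEv u f - pathEv t f)‖ ≤ δ / 3 := (norm_pathEv_le _ v).trans hu.le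
  rw [map_sub] at h1
  have h2 : ‖asymMk E (pathEv u f - pathEv t f)‖ ≤ δ / 3 :=
    (NonUnitalStarAlgHom.norm_apply_le (asymMk E) _).trans hu.le
  rw [map_sub] at h2
  have h3 := norm_sub_norm_le (pathEv v (pathEv u f)) (pathEv v (pathEv t f))
  have h4 := norm_sub_norm_le (asymMk E (pathEv t f)) (asymMk E (pathEv u f))
  rw [norm_sub_rev] at h4
  have h5 := hV v hv
  linarith

/-- A diagonal argument in continuous time: at time u only the functions with index at most u are
controlled, each up to 1/(u+1) above its norm in 𝔄E. For every single function both bounds tend to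
0. The admissible values of r(u) form an upward closed, hence convex, subset of ℝ, so local constant
choices glue to a continuous r. -/
theorem exists_adapted (c : Set (pathAlg (pathAlg E))) (hc : c.Countable)
    (h0 : ∀ f ∈ c, asymMk₂ E f = 0) :
    ∃ r : ℝ≥0 → ℝ≥0, Continuous r ∧ (∀ t, t ≤ r t) ∧ ∀ f ∈ c, Adapted r f := by
  -- Adjoining the zero function makes the family nonempty, so that a sequence can enumerate it.
  obtain ⟨F, hF⟩ := (hc.insert 0).exists_eq_range (Set.insert_nonempty _ _)
  have hF0 : ∀ k, Tendsto (fun t => asymMk E (pathEv t (F k))) atTop (𝓝 0) := fun k => by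
    have : F k ∈ insert 0 c := hF ▸ ⟨k, rfl⟩
    rcases this with h | h
    · rw [h]; simp
    · exact asymMk₂_eq_zero_iff.1 (h0 _ h)
  let t : ℝ≥0 → Set ℝ := fun u => {y | (u : ℝ) ≤ y ∧ ∀ k : ℕ, (k : ℝ≥0) ≤ u → ∀ v : ℝ≥0, y ≤ v →
    ‖pathEv v (pathEv u (F k))‖ ≤ ‖asymMk E (pathEv u (F k))‖ + 1 / ((u : ℝ) + 1)}
  obtain ⟨g, hg⟩ := exists_continuous_forall_mem_convex_of_local_const (t := t) (fun u => by
      have : IsUpperSet (t u) := fun y y' hy h =>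
        ⟨h.1.trans hy, fun k hk v hv => h.2 k hk v (hy.trans hv)⟩
      exact this.ordConnected.convex) fun u => by
    -- The tolerance must serve all y < u + 1 near u, and for these 1/(u+2) ≤ 1/(y+1).
    have hδ : (0 : ℝ) < 1 / ((u : ℝ) + 2) := by positivity
    choose V hV using fun k => eventually_forall_norm_le (F k) u hδ
    obtain ⟨K, hK⟩ := exists_nat_ge (u + 1)
    -- The summand u + 1 dominates every nearby y, and the sum dominates every threshold V k with k
    -- ≤ K; all indices k ≤ y < u + 1 are among these.
    refine ⟨((u + 1 + ∑ k ∈ Finset.range (K + 1), V k : ℝ≥0) : ℝ), ?_⟩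
    have h1 : ∀ᶠ y in 𝓝 u, y < u + 1 := eventually_lt_nhds (by simp)
    have h2 : ∀ᶠ y in 𝓝 u, ∀ k ∈ Finset.range (K + 1), ∀ v ≥ V k,
        ‖pathEv v (pathEv y (F k))‖ ≤ ‖asymMk E (pathEv y (F k))‖ + 1 / ((u : ℝ) + 2) :=
      (Filter.eventually_all_finset _).2 fun k _ => hV k
    filter_upwards [h1, h2] with y hy hy2
    refine ⟨?_, fun k hk v hv => ?_⟩
    · exact_mod_cast hy.le.trans (by simp)
    · have hkK : k ∈ Finset.range (K + 1) := by
        have : (k : ℝ≥0) ≤ K := (hk.trans hy.le).trans hK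
        exact Finset.mem_range.2 (Nat.lt_succ_of_le (by exact_mod_cast this))
      have hv' : V k ≤ v := by
        have e1 : V k ≤ ∑ k ∈ Finset.range (K + 1), V k :=
          Finset.single_le_sum (fun _ _ => zero_le) hkK
        have e2 : u + 1 + ∑ k ∈ Finset.range (K + 1), V k ≤ v := by exact_mod_cast hv
        exact (e1.trans le_add_self).trans e2
      refine (hy2 k hkK v hv').trans ?_
      gcongr 1
      have : (y : ℝ) < u + 1 := by exact_mod_cast hy
      have h0 : (0 : ℝ) ≤ y := y.2
      exact one_div_le_one_div_of_le (by linarith) (by linarith)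
  refine ⟨fun u => Real.toNNReal (g u), by fun_prop, fun u => ?_, fun f hf ε hε => ?_⟩
  · rw [← NNReal.coe_le_coe]
    exact (hg u).1.trans (Real.le_coe_toNNReal _)
  · obtain ⟨k, rfl⟩ : f ∈ Set.range F := hF ▸ Set.mem_insert_of_mem _ hf
    obtain ⟨T, hT⟩ := eventually_atTop.1 (Metric.tendsto_nhds.1 (hF0 k) (ε / 2) (by positivity))
    obtain ⟨L, hL⟩ := exists_nat_gt (2 / ε)
    -- From T on, the class of f(u) has norm below ε/2; from k on, the function with index k is
    -- under control; from L on, the tolerance is at most ε/2.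
    refine ⟨max T (max k L), fun u hu v hv => ?_⟩
    have h1 := hT u ((le_max_left _ _).trans hu)
    rw [dist_zero_right] at h1
    have h2 := (hg u).2 k (((le_max_left _ _).trans (le_max_right _ _)).trans hu) v
      ((Real.le_coe_toNNReal _).trans (NNReal.coe_le_coe.2 hv))
    have h3 : (L : ℝ) ≤ u := by
      exact_mod_cast ((le_max_right _ _).trans (le_max_right _ _)).trans hu
    have h4 : 1 / ((u : ℝ) + 1) ≤ ε / 2 := by
      rw [div_le_iff₀ (by positivity)]
      rw [div_lt_iff₀ hε] at hL
      nlinarith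
    linarith

end Families

/-! ### Restriction to the graph of r, and the homotopies that realize it. -/

section Diagonal

open scoped NNReal BoundedContinuousFunction

variable {D E : CStarAlg.{u}} {r : ℝ≥0 → ℝ≥0} (hr : Continuous r)

/-- The homomorphism `𝔗² E → 𝔗 E` that sends `f` to `t ↦ f(t)(r(t))`. -/
def diagHom (E : CStarAlg.{u}) {r : ℝ≥0 → ℝ≥0} (hr : Continuous r) :
    pathAlg (pathAlg E) →⋆ₙₐ[ℂ] pathAlg E :=
  pathHom (fun t => (pathEv (r t)).comp (pathEv t)) fun f =>
    (continuous_pathEv_pathEv f).comp (continuous_id.prodMk hr)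

/-- The homomorphism `𝔗² E → 𝔄 E` that sends `f` to the class of `t ↦ f(t)(r(t))`. -/
def asymDiag (E : CStarAlg.{u}) {r : ℝ≥0 → ℝ≥0} (hr : Continuous r) :
    pathAlg (pathAlg E) →⋆ₙₐ[ℂ] asymFunctor.obj E := (asymMk E).comp (diagHom E hr)

theorem asymDiag_eq_zero {f : pathAlg (pathAlg E)} (hf : Adapted r f) : asymDiag E hr f = 0 := by
  refine asymMk_eq_zero_iff.2 (Metric.tendsto_nhds.2 fun ε hε => ?_)
  obtain ⟨T, hT⟩ := hf (ε / 2) (half_pos hε)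
  filter_upwards [eventually_ge_atTop T] with t ht
  rw [dist_zero_right]
  exact (hT t ht _ le_rfl).trans_lt (half_lt_self hε)

theorem map_asymDiag (g : D →⋆ₙₐ[ℂ] E) :
    (asymFunctor.map g).comp (asymDiag D hr) = (asymDiag E hr).comp (pathMap (pathMap g)) := rfl

theorem map_asymMk₂ (g : D →⋆ₙₐ[ℂ] E) :
    (asymFunctor.map (asymFunctor.map g)).comp (asymMk₂ D) =
      (asymMk₂ E).comp (pathMap (pathMap g)) := rfl

theorem asymMk₂_pathConst :
    (asymMk₂ E).comp (pathConst (pathAlg E)) = (asymUnit (asymFunctor.obj E)).comp (asymMk E) := rfl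

/-- Multiplication by a number in the unit interval. -/
def scale (s : unitInterval) (t : ℝ≥0) : ℝ≥0 := unitInterval.toNNReal s * t

theorem continuous_scale : Continuous fun z : ℝ≥0 × unitInterval => scale z.2 z.1 :=
  (unitInterval.toNNReal_continuous.comp continuous_snd).mul continuous_fst

theorem scale_zero (t : ℝ≥0) : scale 0 t = 0 := by simp [scale]

theorem scale_one (t : ℝ≥0) : scale 1 t = t := by simp [scale]

/-- The homomorphism `𝔗² E → 𝔗 I E` that sends `f` to
`(t, s) ↦ f(max(t₁, s t))(max(t, r(s t)))`. -/
def slideAt (E : CStarAlg.{u}) {r : ℝ≥0 → ℝ≥0} (hr : Continuous r) (t₁ : ℝ≥0) :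
    pathAlg (pathAlg E) →⋆ₙₐ[ℂ] pathAlg (cyl E) :=
  pathCylHom (fun t s => (pathEv (max t (r (scale s t)))).comp (pathEv (max t₁ (scale s t))))
    fun f => (continuous_pathEv_pathEv f).comp
      ((continuous_const.max continuous_scale).prodMk
        (continuous_fst.max (hr.comp continuous_scale)))

theorem ev_slideAt (t₁ t : ℝ≥0) (s : unitInterval) (f : pathAlg (pathAlg E)) :
    ev E s (pathEv t (slideAt E hr t₁ f)) =
      pathEv (max t (r (scale s t))) (pathEv (max t₁ (scale s t)) f) := rfl

/-- If w is at least t and t₁, both terms coincide. Otherwise w is below the larger of the two, and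
both arguments lie within the distance of t from t₁. Continuity of f at the single point t₁
therefore gives a bound uniform in w, without uniform continuity of f. -/
theorem eventually_norm_max_sub_le (f : pathAlg E) (t₁ : ℝ≥0) {ε : ℝ} (hε : 0 < ε) :
    ∀ᶠ t in 𝓝 t₁, ∀ w, ‖pathEv (max t w) f - pathEv (max t₁ w) f‖ ≤ ε := by
  obtain ⟨δ, hδ, h⟩ := Metric.continuousAt_iff.1 (continuous_pathEv f).continuousAt (ε / 2)
    (half_pos hε)
  filter_upwards [Metric.ball_mem_nhds t₁ hδ] with t ht w
  rw [Metric.mem_ball, NNReal.dist_eq, abs_lt] at ht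
  by_cases hw : t ≤ w ∧ t₁ ≤ w
  · rw [max_eq_right hw.1, max_eq_right hw.2, sub_self, norm_zero]
    exact hε.le
  · have hw' : w < max t t₁ := by
      by_contra hcon
      exact hw (max_le_iff.1 (not_lt.1 hcon))
    have e : ∀ y : ℝ≥0, y = t ∨ y = t₁ → dist (max y w) t₁ < δ := by
      intro y hy
      have hmax : (w : ℝ) < max t t₁ := by exact_mod_cast hw'
      rw [NNReal.dist_eq, abs_lt, NNReal.coe_max]
      rcases hy with rfl | rfl
      · rcases max_cases (y : ℝ) t₁ with h1 | h1 <;> rcases max_cases (y : ℝ) w with h2 | h2 <;>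
          constructor <;> linarith
      · rcases max_cases (t : ℝ) y with h1 | h1 <;> rcases max_cases (y : ℝ) w with h2 | h2 <;>
          constructor <;> linarith
    have h1 := h (e t (Or.inl rfl))
    have h2 := h (e t₁ (Or.inr rfl))
    rw [← dist_eq_norm]
    refine (dist_triangle_right _ _ (pathEv t₁ f)).trans ?_
    linarith

/-- The parameter t₁ enters only through max(t₁, st), so the bound of `eventually_norm_max_sub_le`,
uniform in w = st, is uniform in t and s. This makes the slide a path in 𝔗(IE), not merely a
pointwise continuous family. -/
theorem continuous_slideAt (f : pathAlg (pathAlg E)) : Continuous fun t₁ => slideAt E hr t₁ f := by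
  refine continuous_iff_continuousAt.2 fun t₁ => Metric.tendsto_nhds.2 fun ε hε => ?_
  filter_upwards [eventually_norm_max_sub_le f t₁ (half_pos hε)] with t ht
  rw [dist_eq_norm]
  refine (norm_path_le (half_pos hε).le fun t₂ => norm_cyl_le (half_pos hε).le fun s => ?_).trans_lt
    (half_lt_self hε)
  rw [map_sub, map_sub, ev_slideAt, ev_slideAt, ← map_sub]
  exact (norm_pathEv_le _ _).trans (ht _)

/-- The homomorphism `𝔗² E → 𝔄² I E` given by a homotopy from the projection `𝔗² E → 𝔄² E` to
`asymDiag`. -/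
def asymSlide (E : CStarAlg.{u}) {r : ℝ≥0 → ℝ≥0} (hr : Continuous r) :
    pathAlg (pathAlg E) →⋆ₙₐ[ℂ] asymFunctor.obj (asymFunctor.obj (cyl E)) :=
  (asymMk₂ (cyl E)).comp (pathHom (slideAt E hr) (continuous_slideAt hr))

/-- For inner variable v ≥ r(t₁), the point of evaluation stays in the region where f is small. If
sv ≥ t₁, the first argument is sv and the second is at least r(sv); otherwise the first is t₁ and
the second is at least v ≥ r(t₁). The first argument is always at least t₁, and hence large. -/
theorem asymSlide_eq_zero {f : pathAlg (pathAlg E)} (hf : Adapted r f) : asymSlide E hr f = 0 := by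
  refine asymMk₂_eq_zero_iff.2 (Metric.tendsto_nhds.2 fun ε hε => ?_)
  obtain ⟨T, hT⟩ := hf (ε / 2) (half_pos hε)
  filter_upwards [eventually_ge_atTop T] with t ht
  rw [dist_zero_right]
  refine (norm_asymMk_le (r t) fun v hv => norm_cyl_le (half_pos hε).le fun s => ?_).trans_lt
    (half_lt_self hε)
  change ‖pathEv (max v (r (scale s v))) (pathEv (max t (scale s v)) f)‖ ≤ ε / 2
  refine hT _ (ht.trans (le_max_left _ _)) _ ?_
  rcases le_total t (scale s v) with h | h
  · rw [max_eq_right h]; exact le_max_right _ _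
  · rw [max_eq_left h]; exact le_max_of_le_left hv

/-- At s = 0 the formula reads f(t₁)(max(t, r(0))), which differs from f(t₁)(t) only for t < r(0).
The inner quotient by null functions does not see this. -/
theorem map_ev_zero_asymSlide :
    (asymFunctor.map (asymFunctor.map (ev E 0))).comp (asymSlide E hr) = asymMk₂ E := by
  ext1 f
  refine asymMk_eq_of_eventually (Eventually.of_forall fun t₁ => ?_)
  refine asymMk_eq_of_eventually ((eventually_ge_atTop (r 0)).mono fun t ht => ?_)
  change pathEv (max t (r (scale 0 t))) (pathEv (max t₁ (scale 0 t)) f) = pathEv t (pathEv t₁ f)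
  rw [scale_zero, max_eq_left ht, max_eq_left zero_le]

/-- At s = 1 and for t ≥ t₁ the formula reads f(t)(r(t)), because t ≤ r(t). The outer variable t₁
has disappeared, so the outer path is constant in 𝔄E, which is what `asymUnit` produces. -/
theorem map_ev_one_asymSlide (h : ∀ t, t ≤ r t) :
    (asymFunctor.map (asymFunctor.map (ev E 1))).comp (asymSlide E hr) =
      (asymUnit (asymFunctor.obj E)).comp (asymDiag E hr) := by
  ext1 f
  refine asymMk_eq_of_eventually (Eventually.of_forall fun t₁ => ?_)
  refine asymMk_eq_of_eventually ((eventually_ge_atTop t₁).mono fun t ht => ?_)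
  change pathEv (max t (r (scale 1 t))) (pathEv (max t₁ (scale 1 t)) f) = pathEv (r t) (pathEv t f)
  rw [scale_one, max_eq_right (h t), max_eq_right ht]

/-- The homomorphism `𝔄 E → 𝔄 I E` that sends the class of `f` to that of
`(t, s) ↦ f(max(t, s r(t)))`. -/
def stretch (E : CStarAlg.{u}) {r : ℝ≥0 → ℝ≥0} (hr : Continuous r) :
    asymFunctor.obj E →⋆ₙₐ[ℂ] asymFunctor.obj (cyl E) :=
  CStarIdeal.Quot.map (J := nullIdeal E) (K := nullIdeal (cyl E))
    (pathCylHom (fun t s => pathEv (max t (scale s (r t)))) fun f =>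
      (continuous_pathEv f).comp (continuous_fst.max
        (continuous_scale.comp ((hr.comp continuous_fst).prodMk continuous_snd))))
    fun f (hf : Tendsto _ _ _) => by
      -- The argument max(t, s r(t)) is at least t, so decay of f at infinity survives uniformly in
      -- s.
      refine Metric.tendsto_nhds.2 fun ε hε => ?_
      obtain ⟨T, hT⟩ := eventually_atTop.1 (Metric.tendsto_nhds.1 hf (ε / 2) (half_pos hε))
      filter_upwards [eventually_ge_atTop T] with t ht
      rw [dist_zero_right]
      refine (norm_cyl_le (half_pos hε).le fun s => ?_).trans_lt (half_lt_self hε)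
      have := hT _ (ht.trans (le_max_left t (scale s (r t))))
      rw [dist_zero_right] at this
      exact this.le

theorem map_ev_zero_stretch :
    (asymFunctor.map (ev E 0)).comp (stretch E hr) = NonUnitalStarAlgHom.id ℂ _ := by
  ext1 x
  obtain ⟨f, rfl⟩ := asymMk_surjective x
  refine asymMk_eq_of_eventually (Eventually.of_forall fun t => ?_)
  change pathEv (max t (scale 0 (r t))) f = pathEv t f
  rw [scale_zero, max_eq_left zero_le]

/-- Both sides send f to t ↦ f(r(t)): restricting the constant path with value f to the graph of r
is a reparametrization of f. This identifies the ends of a restricted homotopy in the proof of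
injectivity. -/
theorem map_ev_one_stretch (h : ∀ t, t ≤ r t) :
    ((asymFunctor.map (ev E 1)).comp (stretch E hr)).comp (asymMk E) =
      (asymDiag E hr).comp (pathConst (pathAlg E)) := by
  ext1 f
  refine asymMk_eq_of_eventually (Eventually.of_forall fun t => ?_)
  change pathEv (max t (scale 1 (r t))) f = pathEv (r t) f
  rw [scale_one, max_eq_right (h t)]

end Diagonal

/-! ### Moving the cylinder inside a functor: the case of 𝔄. -/

section Exchange

open scoped NNReal BoundedContinuousFunction

/-- The functor `G` admits homomorphisms `I G B → G I B` that are compatible with evaluation. -/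
def HasExchange (G : Endofunctor.{u}) : Prop :=
  ∀ B : CStarAlg.{u}, ∃ c : cyl (G.obj B) →⋆ₙₐ[ℂ] G.obj (cyl B),
    ∀ s, (G.map (ev B s)).comp c = ev (G.obj B) s

theorem HasExchange.ident : HasExchange Endofunctor.ident.{u} := fun B =>
  ⟨NonUnitalStarAlgHom.id ℂ (cyl B), fun _ => rfl⟩

/-- The cylinder moves past one functor at a time: I F G B → F I G B → F G I B. -/
theorem HasExchange.comp {F G : Endofunctor.{u}} (hF : HasExchange F) (hG : HasExchange G) :
    HasExchange (F.comp G) := fun B => by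
  obtain ⟨c, hc⟩ := hF (G.obj B)
  obtain ⟨c', hc'⟩ := hG B
  refine ⟨(F.map c').comp c, fun s => ?_⟩
  have h : (F.map (G.map (ev B s))).comp ((F.map c').comp c) = ev (F.obj (G.obj B)) s := by
    rw [← NonUnitalStarAlgHom.comp_assoc, ← F.map_comp, hc', hc]
  exact h

variable {B D E : CStarAlg.{u}}

theorem continuous_ev (f : cyl E) : Continuous fun s => ev E s f :=
  (show C(unitInterval, E) from f).continuous

/-- Pointwise application of a `⋆`-homomorphism to functions on the unit interval. -/
def cylMap (q : D →⋆ₙₐ[ℂ] E) : cyl D →⋆ₙₐ[ℂ] cyl E :=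
  cylHom (fun s => q.comp (ev D s)) fun f => (starHom_continuous q).comp (continuous_ev f)

theorem ev_cylMap (q : D →⋆ₙₐ[ℂ] E) (s : unitInterval) (f : cyl D) :
    ev E s (cylMap q f) = q (ev D s f) := rfl

theorem cylMap_surjective (q : D →⋆ₙₐ[ℂ] E) (hq : Function.Surjective q) :
    Function.Surjective (cylMap q) := by
  refine surjective_of_denseRange _ fun f => Metric.mem_closure_iff.2 fun ε hε => ?_
  obtain ⟨g, C, hg, -, hgf⟩ := exists_approx_continuous_lift q hq (continuous_ev f)
    (norm_ev_le f) (half_pos hε)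
  let g' : cyl D := (⟨g, hg⟩ : C(unitInterval, D))
  refine ⟨_, ⟨g', rfl⟩, ?_⟩
  rw [dist_eq_norm]
  refine (norm_cyl_le (half_pos hε).le fun s => ?_).trans_lt (half_lt_self hε)
  rw [map_sub]
  exact (hgf s).le

/-- The homomorphism `I 𝔗 B → 𝔗 I B` that exchanges the two variables. -/
def pathFlip (B : CStarAlg.{u}) : cyl (pathAlg B) →⋆ₙₐ[ℂ] pathAlg (cyl B) :=
  pathCylHom (fun t s => (pathEv t).comp (ev (pathAlg B) s)) fun f =>
    (continuous_eval (F := ℝ≥0 →ᵇ B)).comp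
      (((continuous_ev f).comp continuous_snd).prodMk continuous_fst)

/-- A property that holds eventually along a filter near every parameter holds eventually for all
parameters in the unit interval. -/
theorem exists_forall_unitInterval {ι : Type*} [LinearOrder ι] [Nonempty ι]
    {p : unitInterval → ι → Prop}
    (h : ∀ s, ∃ T, ∀ᶠ s' in 𝓝 s, ∀ t ≥ T, p s' t) : ∃ T, ∀ s, ∀ t ≥ T, p s t := by
  -- Compact induction: finitely many local thresholds are combined by taking their maximum.
  obtain ⟨T, hT⟩ := isCompact_univ.induction_on
    (p := fun S : Set unitInterval => ∃ T, ∀ s ∈ S, ∀ t ≥ T, p s t)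
    ⟨Classical.arbitrary ι, by simp⟩
    (fun S S' hS ⟨T, hT⟩ => ⟨T, fun s hs => hT s (hS hs)⟩)
    (fun S S' ⟨T, hT⟩ ⟨T', hT'⟩ => ⟨max T T', fun s hs t ht => hs.elim
      (fun hs => hT s hs t ((le_max_left _ _).trans ht))
      (fun hs => hT' s hs t ((le_max_right _ _).trans ht))⟩)
    (fun s _ => by
      obtain ⟨T, hT⟩ := h s
      exact ⟨_, mem_nhdsWithin_of_mem_nhds hT, T, fun s' hs' => hs'⟩)
  exact ⟨T, fun s => hT s trivial⟩

/-- Each path f(s) vanishes at infinity, and f(s) depends on s continuously in supremum norm. A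
threshold at s therefore works near s with a slightly larger error, and compactness of [0,1] makes
the decay uniform. -/
theorem asymMk_pathFlip_eq_zero {f : cyl (pathAlg B)} (hf : cylMap (asymMk B) f = 0) :
    asymMk (cyl B) (pathFlip B f) = 0 := by
  have h0 : ∀ s, Tendsto (fun t => pathEv t (ev _ s f)) atTop (𝓝 0) := fun s => by
    rw [← asymMk_eq_zero_iff, ← ev_cylMap, hf, map_zero]
  refine asymMk_eq_zero_iff.2 (Metric.tendsto_nhds.2 fun ε hε => ?_)
  have : ∃ T : ℝ≥0, ∀ s, ∀ t ≥ T, ‖pathEv t (ev _ s f)‖ ≤ ε / 2 := by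
    refine exists_forall_unitInterval fun s => ?_
    obtain ⟨T, hT⟩ := eventually_atTop.1 (Metric.tendsto_nhds.1 (h0 s) (ε / 4) (by positivity))
    refine ⟨T, ?_⟩
    filter_upwards [Metric.continuousAt_iff'.1 (continuous_ev f).continuousAt (ε / 4)
      (by positivity)] with s' hs' t ht
    have h1 := hT t ht
    rw [dist_eq_norm] at hs'
    rw [dist_zero_right] at h1
    have h2 := (norm_pathEv_le (ev _ s' f - ev _ s f) t).trans hs'.le
    rw [map_sub] at h2
    have h3 := norm_sub_norm_le (pathEv t (ev _ s' f)) (pathEv t (ev _ s f))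
    linarith
  obtain ⟨T, hT⟩ := this
  filter_upwards [eventually_ge_atTop T] with t ht
  rw [dist_zero_right]
  exact (norm_cyl_le (half_pos hε).le fun s => hT s t ht).trans_lt (half_lt_self hε)

theorem HasExchange.asym : HasExchange asymFunctor.{u} := fun B => by
  -- With the whole algebra as D and the identity as φ, `exists_factor` is descent along the
  -- surjection I𝔗B → I𝔄B.
  obtain ⟨c, hc⟩ := exists_factor (cylMap (asymMk B)) ((asymMk (cyl B)).comp (pathFlip B)) ⊤
    (fun f _ hf => asymMk_pathFlip_eq_zero hf) (NonUnitalStarAlgHom.id ℂ _) fun f => by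
      obtain ⟨g, hg⟩ := cylMap_surjective (asymMk B) asymMk_surjective f
      exact ⟨g, trivial, hg⟩
  refine ⟨c, fun s => ?_⟩
  ext1 f
  obtain ⟨g, rfl⟩ := cylMap_surjective (asymMk B) asymMk_surjective f
  exact (congrArg (asymFunctor.map (ev B s)) (hc _ g trivial rfl)).symm

end Exchange

/-! ### Moving the cylinder inside 𝕂 and the iterates of 𝔄. -/

section CompactExchange

section UnitMatrices

variable {X B : Type*} [NonUnitalCStarAlgebra B]

theorem IsMatrix.congr {T : Adj X B} {m m' : X → X → B} (h : IsMatrix T m)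
    (hm : ∀ x y, m x y = m' x y) : IsMatrix T m' := by
  have : m = m' := funext₂ hm
  rwa [← this]

open Classical in
/-- The matrices with a single nonzero entry. -/
theorem exists_unitMat (i j : X) : ∃ e : B →L[ℂ] MatAlg (finiteFamily X) B,
    ∀ b, IsMatrix (e b).1 fun x y => if x = i ∧ y = j then b else 0 := by
  have hs : ∀ b : B, (finiteFamily X).IsSupp
      fun x y => (if x = i ∧ y = j then b else 0) ≠ 0 := fun b =>
    ⟨{i, j}, fun x y hxy => by
      by_cases h : x = i ∧ y = j
      · simp [h.1, h.2]
      · exact absurd (if_neg h) hxy⟩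
  have hb : ∀ (b : B) x y, ‖if x = i ∧ y = j then b else 0‖ ≤ ‖b‖ := fun b x y => by
    split_ifs <;> simp
  choose T hT using fun b : B => (finiteFamily X).exists_adj (hs b) (hb b)
  have hmem : ∀ b, T b ∈ matAlg (finiteFamily X) B := fun b =>
    NonUnitalStarSubalgebra.le_topologicalClosure _ ⟨_, hT b, hs b, _, hb b⟩
  let e : B →ₗ[ℂ] MatAlg (finiteFamily X) B :=
    { toFun := fun b => ⟨T b, hmem b⟩
      map_add' := fun b b' => Subtype.ext ((hT (b + b')).ext
        (((hT b).add (hT b')).congr fun x y => by split_ifs <;> simp))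
      map_smul' := fun c b => Subtype.ext ((hT (c • b)).ext
        (((hT b).smul c).congr fun x y => by split_ifs <;> simp)) }
  refine ⟨e.mkContinuous 1 fun b => ?_, hT⟩
  rw [one_mul]
  refine ContinuousLinearMap.opNorm_le_bound _ (norm_nonneg _) fun ξ => ?_
  have h : (T b).1 ξ = L2.single i (b * ξ.1 j) := by
    ext x
    rw [L2.single_val]
    refine ((hT b).hasSum ξ x).unique ?_
    by_cases hx : x = i
    · rw [if_pos hx]
      convert hasSum_ite_eq j (b * ξ.1 j) using 2 with y
      by_cases hy : y = j
      · simp [hx, hy]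
      · simp [hy]
    · rw [if_neg hx]
      convert hasSum_zero using 2 with y
      simp [hx]
  change ‖(T b).1 ξ‖ ≤ _
  rw [h, L2.norm_single]
  exact (norm_mul_le _ _).trans
    (mul_le_mul_of_nonneg_left (L2.norm_apply_le ξ j) (norm_nonneg _))

/-- The matrix with the entry `b` at `(i, j)` and zeros elsewhere. -/
def unitMat (i j : X) : B →L[ℂ] MatAlg (finiteFamily X) B := (exists_unitMat i j).choose

open Classical in
theorem isMatrix_unitMat (i j : X) (b : B) :
    IsMatrix (unitMat i j b).1 fun x y => if x = i ∧ y = j then b else 0 :=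
  (exists_unitMat i j).choose_spec b

theorem matAlgMap_unitMat {A : Type*} [NonUnitalCStarAlgebra A] (f : A →⋆ₙₐ[ℂ] B) (i j : X)
    (a : A) : matAlgMap (finiteFamily X) f (unitMat i j a) = unitMat i j (f a) := by
  classical
  exact matAlgMap_eq _ f (isMatrix_unitMat i j a)
    ((isMatrix_unitMat i j (f a)).congr fun x y => by split_ifs <;> simp)

theorem MatAlg.ext_isMatrix {E : SupportFamily X} {S T : MatAlg E B} {m : X → X → B}
    (hS : IsMatrix S.1 m) (hT : IsMatrix T.1 m) : S = T := Subtype.ext (hS.ext hT)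

theorem isMatrix_sum_unitMat (F : Finset (X × X)) (m : X → X → B) [DecidableEq X] :
    IsMatrix (∑ z ∈ F, unitMat z.1 z.2 (m z.1 z.2) : MatAlg (finiteFamily X) B).1
      fun x y => if (x, y) ∈ F then m x y else 0 := by
  classical
  induction F using Finset.induction_on with
  | empty => exact IsMatrix.zero
  | insert z F hz ih =>
    rw [Finset.sum_insert hz]
    refine ((isMatrix_unitMat z.1 z.2 (m z.1 z.2)).add ih).congr fun x y => ?_
    by_cases h : (x, y) = z
    · subst h
      simp [hz]
    · have h' : ¬ (x = z.1 ∧ y = z.2) := fun h' => h (Prod.ext h'.1 h'.2)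
      simp [h, h']

theorem eq_sum_unitMat (F : Finset (X × X)) {T : MatAlg (finiteFamily X) B} {m : X → X → B}
    (hm : IsMatrix T.1 m) (hF : ∀ x y, (x, y) ∉ F → m x y = 0) :
    T = ∑ z ∈ F, unitMat z.1 z.2 (m z.1 z.2) := by
  classical
  refine MatAlg.ext_isMatrix hm ((isMatrix_sum_unitMat F m).congr fun x y => ?_)
  split_ifs with h
  · rfl
  · exact (hF x y h).symm

theorem norm_cut_le (Y : Set X) : ‖(cut Y : Adj X B)‖ ≤ 1 := by
  classical
  refine ContinuousLinearMap.opNorm_le_bound _ zero_le_one fun ξ => ?_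
  rw [one_mul]
  refine L2.norm_le_of_forall_sum _ (norm_nonneg _) fun t => ?_
  refine le_trans (le_of_eq ?_) (L2.norm_sum_le ξ (t.filter (· ∈ Y)))
  congr 1
  rw [Finset.sum_filter]
  refine Finset.sum_congr rfl fun x _ => ?_
  change star ((cutL Y ξ).1 x) * (cutL Y ξ).1 x = _
  rw [cutL_val]
  split_ifs <;> simp

theorem norm_cut_mul_cut_le (Y : Set X) (T : Adj X B) : ‖cut Y * T * cut Y‖ ≤ ‖T‖ := by
  have h := norm_cut_le (B := B) Y
  calc ‖cut Y * T * cut Y‖ ≤ ‖(cut Y : Adj X B)‖ * ‖T‖ * ‖(cut Y : Adj X B)‖ :=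
        (norm_mul_le _ _).trans (mul_le_mul_of_nonneg_right (norm_mul_le _ _) (norm_nonneg _))
    _ ≤ 1 * ‖T‖ * 1 := by gcongr
    _ = ‖T‖ := by ring

/-- The compression of a matrix to a subset. -/
def compress (E : SupportFamily X) (Y : Set X) (T : MatAlg E B) : MatAlg E B :=
  ⟨cut Y * T.1 * cut Y, cut_mem_matAlg E Y T.2⟩

theorem norm_compress_sub_le (E : SupportFamily X) (Y : Set X) (S T : MatAlg E B) :
    ‖compress E Y S - compress E Y T‖ ≤ ‖S - T‖ := by
  change ‖cut Y * S.1 * cut Y - cut Y * T.1 * cut Y‖ ≤ ‖S.1 - T.1‖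
  rw [← sub_mul, ← mul_sub]
  exact norm_cut_mul_cut_le Y _

/-- T is close to a finite matrix, which large compressions leave unchanged; since compressions are
contractive, the error for T is at most twice this distance. -/
theorem exists_forall_norm_compress_sub_le (T : MatAlg (finiteFamily ℕ) B) {ε : ℝ} (hε : 0 < ε) :
    ∃ N, ∀ n ≥ N, ‖compress (finiteFamily ℕ) (Set.Iio n) T - T‖ ≤ ε := by
  classical
  obtain ⟨S, hS, hST⟩ := Metric.mem_closure_iff.1 T.2 (ε / 2) (half_pos hε)
  have hle : banded (finiteFamily ℕ) B ≤ matAlg (finiteFamily ℕ) B :=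
    NonUnitalStarSubalgebra.le_topologicalClosure _
  let S' : MatAlg (finiteFamily ℕ) B := ⟨S, hle hS⟩
  have hST' : ‖T - S'‖ < ε / 2 := by
    rw [dist_eq_norm] at hST
    exact hST
  obtain ⟨m, hm, ⟨F, hF⟩, -⟩ := id hS
  -- The set `Set.Iio n` omits n, hence the + 1 beyond the largest index in the support.
  refine ⟨F.sup id + 1, fun n hn => ?_⟩
  have hF' : ∀ x ∈ F, x ∈ Set.Iio n := fun x hx =>
    lt_of_lt_of_le (Nat.lt_succ_of_le (Finset.le_sup (f := id) hx)) hn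
  have e : compress (finiteFamily ℕ) (Set.Iio n) S' = S' := by
    refine MatAlg.ext_isMatrix (isMatrix_cut hm (Set.Iio n)) (hm.congr fun x y => ?_)
    split_ifs with h
    · rfl
    · by_contra h0
      obtain ⟨h1, h2⟩ := hF x y h0
      exact h ⟨hF' x h1, hF' y h2⟩
  have h1 := norm_compress_sub_le (finiteFamily ℕ) (Set.Iio n) T S'
  rw [e] at h1
  rw [norm_sub_rev] at hST'
  calc _ = ‖(compress (finiteFamily ℕ) (Set.Iio n) T - S') + (S' - T)‖ := by
        rw [sub_add_sub_cancel]
    _ ≤ _ := norm_add_le _ _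
    _ ≤ ε := by rw [norm_sub_rev T S'] at h1; linarith

end UnitMatrices

variable {B : CStarAlg.{u}}

/-- Finite corners of T approximate it in norm, and evaluation is contractive, so the approximation
is uniform in s. For a finite corner the claim reduces to continuity of finitely many entries. -/
theorem continuous_matAlgMap_ev (T : MatAlg (finiteFamily ℕ) (cyl B)) :
    Continuous fun s => matAlgMap (finiteFamily ℕ) (ev B s) T := by
  classical
  refine continuous_of_uniform_approx_of_continuous fun V hV => ?_
  obtain ⟨ε, hε, hV⟩ := Metric.mem_uniformity_dist.1 hV
  obtain ⟨N, hN⟩ := exists_forall_norm_compress_sub_le T (half_pos hε)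
  set S := compress (finiteFamily ℕ) (Set.Iio N) T with hS
  refine ⟨fun s => matAlgMap (finiteFamily ℕ) (ev B s) S, ?_, fun s => hV ?_⟩
  · obtain ⟨m, hm⟩ := exists_isMatrix _ T.2
    have e := eq_sum_unitMat (Finset.range N ×ˢ Finset.range N) (T := S)
      (isMatrix_cut hm (Set.Iio N)) fun x y h => if_neg fun h' => h
        (Finset.mem_product.2 ⟨Finset.mem_range.2 h'.1, Finset.mem_range.2 h'.2⟩)
    rw [e]
    simp only [map_sum, matAlgMap_unitMat]
    exact continuous_finsetSum _ fun z _ => (unitMat z.1 z.2).continuous.comp (continuous_ev _)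
  · rw [dist_comm, dist_eq_norm, ← map_sub]
    exact ((NonUnitalStarAlgHom.norm_apply_le _ _).trans (hN N le_rfl)).trans_lt (half_lt_self hε)

/-- The homomorphism `𝕂 I B → I 𝕂 B`. -/
def compactCyl (B : CStarAlg.{u}) :
    compactFunctor.obj (cyl B) →⋆ₙₐ[ℂ] cyl (compactFunctor.obj B) :=
  cylHom (fun s => compactFunctor.map (ev B s)) continuous_matAlgMap_ev

theorem compactCyl_eq_zero {T : compactFunctor.obj (cyl B)} (h : compactCyl B T = 0) : T = 0 := by
  obtain ⟨m, hm⟩ := exists_isMatrix _ T.2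
  have h0 : ∀ s, compactFunctor.map (ev B s) T = 0 := fun s => by
    have := congrArg (ev _ s) h
    rwa [map_zero] at this
  have hm0 : m = fun _ _ => 0 := by
    funext x y
    refine cyl_ext fun s => ?_
    rw [map_zero]
    exact apply_eq_zero_of_matAlgMap_eq_zero _ (ev B s) hm (h0 s) x y
  rw [hm0] at hm
  exact MatAlg.ext_isMatrix hm IsMatrix.zero

/-- The corners of a path f(s) converge to f(s) at a rate that is uniform in s, by compactness. A
corner of fixed size is a finite matrix of functions on [0,1], and so comes from 𝕂(IB). Closedness
of the range does the rest. -/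
theorem compactCyl_surjective : Function.Surjective (compactCyl B) := by
  classical
  refine surjective_of_denseRange _ fun f => Metric.mem_closure_iff.2 fun ε hε => ?_
  let f' : unitInterval → MatAlg (finiteFamily ℕ) B := fun s => ev _ s f
  have hf' : Continuous f' := continuous_ev f
  have : ∃ N : ℕ, ∀ s, ∀ n ≥ N,
      ‖compress (finiteFamily ℕ) (Set.Iio n) (f' s) - f' s‖ ≤ ε / 2 := by
    refine exists_forall_unitInterval fun s => ?_
    -- The bound ε/2 splits into three parts ε/6: moving from s' to s under the compression,
    -- compressing at s, and moving back.
    obtain ⟨N, hN⟩ := exists_forall_norm_compress_sub_le (f' s) (show 0 < ε / 6 by positivity)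
    refine ⟨N, ?_⟩
    filter_upwards [Metric.continuousAt_iff'.1 hf'.continuousAt (ε / 6) (by positivity)]
      with s' hs' n hn
    rw [dist_eq_norm] at hs'
    have h1 := norm_compress_sub_le (finiteFamily ℕ) (Set.Iio n) (f' s') (f' s)
    have h2 := hN n hn
    calc _ = ‖(compress (finiteFamily ℕ) (Set.Iio n) (f' s') -
            compress (finiteFamily ℕ) (Set.Iio n) (f' s)) +
            (compress (finiteFamily ℕ) (Set.Iio n) (f' s) - f' s) + (f' s - f' s')‖ := by
          congr 1; abel
      _ ≤ _ := norm_add₃_le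
      _ ≤ ε / 2 := by rw [norm_sub_rev (f' s) (f' s')]; linarith
  obtain ⟨N, hN⟩ := this
  choose m hm using fun s => exists_isMatrix (finiteFamily ℕ) (f' s).2
  -- An entry is bounded by the operator norm, so the entries inherit continuity from the path.
  have hcont : ∀ x y, Continuous fun s => m s x y := fun x y => by
    refine continuous_iff_continuousAt.2 fun s => Metric.continuousAt_iff'.2 fun δ hδ => ?_
    filter_upwards [Metric.continuousAt_iff'.1 hf'.continuousAt δ hδ] with s' hs'
    rw [dist_eq_norm] at hs' ⊢
    exact (((hm s').sub (hm s)).norm_le x y).trans_lt hs'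
  let m' : ℕ → ℕ → cyl B := fun x y => (⟨fun s => m s x y, hcont x y⟩ : C(unitInterval, B))
  let T : MatAlg (finiteFamily ℕ) (cyl B) :=
    ∑ z ∈ Finset.range N ×ˢ Finset.range N, unitMat z.1 z.2 (m' z.1 z.2)
  have hT : ∀ s, matAlgMap (finiteFamily ℕ) (ev B s) T =
      compress (finiteFamily ℕ) (Set.Iio N) (f' s) := fun s => by
    refine MatAlg.ext_isMatrix (matAlgMap_spec _ (ev B s) T (isMatrix_sum_unitMat _ m'))
      ((isMatrix_cut (hm s) (Set.Iio N)).congr fun x y => ?_)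
    by_cases h : x ∈ Set.Iio N ∧ y ∈ Set.Iio N
    · rw [if_pos h, if_pos (by simpa using h)]
      rfl
    · rw [if_neg h, if_neg (by simpa using h), map_zero]
  refine ⟨_, ⟨T, rfl⟩, ?_⟩
  rw [dist_comm, dist_eq_norm]
  refine (norm_cyl_le (half_pos hε).le fun s => ?_).trans_lt (half_lt_self hε)
  rw [map_sub]
  have e : ev _ s (compactCyl B T) = compress (finiteFamily ℕ) (Set.Iio N) (f' s) := hT s
  rw [e]
  exact hN s N le_rfl

/-- The map 𝕂(IB) → I(𝕂B) is bijective, and its inverse is the exchange; `exists_factor` with the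
identity as σ produces this inverse as a homomorphism. -/
theorem HasExchange.compact : HasExchange compactFunctor.{u} := fun B => by
  obtain ⟨c, hc⟩ := exists_factor (compactCyl B) (NonUnitalStarAlgHom.id ℂ _) ⊤
    (fun f _ hf => compactCyl_eq_zero hf) (NonUnitalStarAlgHom.id ℂ _) fun f => by
      obtain ⟨g, hg⟩ := compactCyl_surjective f
      exact ⟨g, trivial, hg⟩
  refine ⟨c, fun s => ?_⟩
  ext1 f
  obtain ⟨g, rfl⟩ := compactCyl_surjective f
  exact (congrArg (compactFunctor.map (ev B s)) (hc _ g trivial rfl)).symm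

theorem HasExchange.asymIter (n : ℕ) : HasExchange (asymIter.{u} n) := by
  induction n with
  | zero => exact HasExchange.ident
  | succ n ih => exact HasExchange.asym.comp ih

end CompactExchange

/-! ### Bijectivity of the transition maps. -/

section Reparametrization

variable {X : Type u} [MetricSpace X] [BoundedGeometry X] (X₀ : Set X)
  {A B : CStarAlg.{u}} {H : Endofunctor.{u}}

/-- Reparametrization does not change the homotopy class. -/
theorem fHomotopic_stretch (hH : HasExchange H) {r : NNReal → NNReal} (hr : Continuous r)
    (φ : A →⋆ₙₐ[ℂ] (relRoeFunctor X₀).obj (asymFunctor.obj (H.obj B))) :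
    FHomotopic (F := (relRoeFunctor X₀).comp (asymFunctor.comp H)) (B := B) φ
      (((relRoeFunctor X₀).map ((asymFunctor.map (ev (H.obj B) 1)).comp
        (stretch (H.obj B) hr))).comp φ) := by
  -- The stretch ends in 𝔄I(HB); the exchange e carries it to 𝔄H(IB), where a homotopy for the
  -- composite functor has to live.
  obtain ⟨e, he⟩ := hH B
  have key : ∀ s a, (relRoeFunctor X₀).map (asymFunctor.map (H.map (ev B s)))
      ((relRoeFunctor X₀).map ((asymFunctor.map e).comp (stretch (H.obj B) hr)) (φ a)) =
      (relRoeFunctor X₀).map ((asymFunctor.map (ev (H.obj B) s)).comp (stretch (H.obj B) hr))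
        (φ a) := fun s a => by
    rw [Endofunctor.map_comp_apply, ← NonUnitalStarAlgHom.comp_assoc, ← asymFunctor.map_comp, he]
  refine ⟨((relRoeFunctor X₀).map ((asymFunctor.map e).comp (stretch (H.obj B) hr))).comp φ,
    ?_, ?_⟩
  · ext1 a
    refine (key 0 a).trans ?_
    rw [map_ev_zero_stretch, Endofunctor.map_id]
    rfl
  · ext1 a
    exact key 1 a

variable [TopologicalSpace.SeparableSpace A]

/-- Every homomorphism into `𝔑ᵘ 𝔄² H B` is homotopic to one that comes from `𝔑ᵘ 𝔄 H B`. -/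
theorem exists_fHomotopic_asymUnit (hH : HasExchange H)
    (φ : A →⋆ₙₐ[ℂ] (relRoeFunctor X₀).obj (asymFunctor.obj (asymFunctor.obj (H.obj B)))) :
    ∃ ψ : A →⋆ₙₐ[ℂ] (relRoeFunctor X₀).obj (asymFunctor.obj (H.obj B)),
      FHomotopic (F := (relRoeFunctor X₀).comp (asymFunctor.comp (asymFunctor.comp H))) (B := B)
        φ (((relRoeFunctor X₀).map (asymUnit (asymFunctor.obj (H.obj B)))).comp ψ) := by
  obtain ⟨c, l, hc, hc0, hl, hρ⟩ := exists_induced X₀ (asymMk₂ (H.obj B)) asymMk₂_surjective φ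
  obtain ⟨r, hr, hrt, hrc⟩ := exists_adapted c hc hc0
  obtain ⟨e, he⟩ := hH B
  -- The restriction to the graph and the slide kill the same countable set c. Both are thus induced
  -- through the same lifts l, so the ends of Φ can be compared with φ and ψ on representatives.
  obtain ⟨ψ, hψ⟩ := hρ (asymDiag (H.obj B) hr) fun f hf => asymDiag_eq_zero hr (hrc f hf)
  obtain ⟨Φ, hΦ⟩ := hρ (asymSlide (H.obj B) hr) fun f hf => asymSlide_eq_zero hr (hrc f hf)
  have key : ∀ s a, (relRoeFunctor X₀).map (asymFunctor.map (asymFunctor.map (H.map (ev B s))))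
      ((relRoeFunctor X₀).map (asymFunctor.map (asymFunctor.map e)) (Φ a)) =
      relProj X₀ ((asymFunctor.map (asymFunctor.map (ev (H.obj B) s))).comp
        (asymSlide (H.obj B) hr)) (l a) := fun s a => by
    rw [Endofunctor.map_comp_apply, ← asymFunctor.map_comp, ← asymFunctor.map_comp, he, ← hΦ,
      map_relProj]
  refine ⟨ψ, ((relRoeFunctor X₀).map (asymFunctor.map (asymFunctor.map e))).comp Φ, ?_, ?_⟩
  · ext1 a
    refine (key 0 a).trans ?_
    rw [map_ev_zero_asymSlide]
    exact hl a
  · ext1 a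
    refine (key 1 a).trans ?_
    rw [map_ev_one_asymSlide hr hrt, ← map_relProj, hψ]
    rfl

/-- Homomorphisms into `𝔑ᵘ 𝔄 H B` that become homotopic in `𝔑ᵘ 𝔄² H B` are homotopic. -/
theorem fHomotopic_of_asymUnit (hH : HasExchange H)
    {φ ψ : A →⋆ₙₐ[ℂ] (relRoeFunctor X₀).obj (asymFunctor.obj (H.obj B))}
    (h : FHomotopic (F := (relRoeFunctor X₀).comp (asymFunctor.comp (asymFunctor.comp H))) (B := B)
      (((relRoeFunctor X₀).map (asymUnit (asymFunctor.obj (H.obj B)))).comp φ)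
      (((relRoeFunctor X₀).map (asymUnit (asymFunctor.obj (H.obj B)))).comp ψ)) :
    FHomotopic (F := (relRoeFunctor X₀).comp (asymFunctor.comp H)) (B := B) φ ψ := by
  obtain ⟨Φ, h0, h1⟩ := h
  obtain ⟨c, l, hc, hc0, hl, hρ⟩ :=
    exists_induced X₀ (asymMk₂ (H.obj (cyl B))) asymMk₂_surjective Φ
  obtain ⟨r, hr, hrt, hrc⟩ := exists_adapted c hc hc0
  -- The ends of the new homotopy are compared only on a countable dense set, so that a single r
  -- meets all the conditions that arise.
  obtain ⟨d, hd, hdd⟩ := TopologicalSpace.exists_countable_dense A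
  -- If the end of Φ at s comes from χ, then for all r above some k the restriction of this end to
  -- the graph of r is χ reparametrized by r, at least on d. The claim is made for every large r
  -- because both ends have to use the same one.
  have key : ∀ (s : unitInterval) (χ : A →⋆ₙₐ[ℂ] (relRoeFunctor X₀).obj
      (asymFunctor.obj (H.obj B))), (∀ a, (relRoeFunctor X₀).map
        (asymFunctor.map (asymFunctor.map (H.map (ev B s)))) (Φ a) =
        (relRoeFunctor X₀).map (asymUnit (asymFunctor.obj (H.obj B))) (χ a)) →
      ∃ k : NNReal → NNReal, Continuous k ∧ ∀ {r : NNReal → NNReal} (hr : Continuous r),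
        (∀ t, t ≤ r t) → (∀ t, k t ≤ r t) → ∀ a ∈ d, relProj X₀ ((asymFunctor.map
          (H.map (ev B s))).comp (asymDiag (H.obj (cyl B)) hr)) (l a) =
          (relRoeFunctor X₀).map ((asymFunctor.map (ev (H.obj B) 1)).comp
            (stretch (H.obj B) hr)) (χ a) := by
    intro s χ hχ
    choose m hm using fun a => relProj_surjective X₀ (asymMk (H.obj B)) asymMk_surjective (χ a)
    -- p(a) is the difference of two lifts of the same element of 𝔑𝔄²HB: the evaluated lift of Φ(a),
    -- and the constant path on a lift of χ(a). It vanishes there, hence is governed by countably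
    -- many null functions, and k is adapted to these for all a in d.
    let p : A → (roeFunctor X).obj (pathAlg (pathAlg (H.obj B))) := fun a =>
      (roeFunctor X).map (pathMap (pathMap (H.map (ev B s)))) (l a) -
        (roeFunctor X).map (pathConst (pathAlg (H.obj B))) (m a)
    have hp : ∀ a, relProj X₀ (asymMk₂ (H.obj B)) (p a) = 0 := fun a => by
      rw [map_sub, relProj_map, relProj_map, ← map_asymMk₂, asymMk₂_pathConst, ← map_relProj,
        ← map_relProj, hm, hl]
      exact sub_eq_zero.2 (hχ a)
    choose c' hc' hc0' hcρ' using fun a =>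
      exists_countable_of_relProj_eq_zero X₀ (asymMk₂ (H.obj B)) asymMk₂_surjective (hp a)
    obtain ⟨k, hk, -, hkc⟩ := exists_adapted (⋃ a ∈ d, c' a) (hd.biUnion fun a _ => hc' a)
      fun f hf => by
        obtain ⟨a, -, hf⟩ := Set.mem_iUnion₂.1 hf
        exact hc0' a f hf
    refine ⟨k, hk, fun {r} hr hrt hkr a ha => ?_⟩
    have hz := hcρ' a (asymDiag (H.obj B) hr) fun f hf => asymDiag_eq_zero hr
      ((hkc f (Set.mem_iUnion₂.2 ⟨a, ha, hf⟩)).mono hkr)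
    rw [map_sub, relProj_map, relProj_map, sub_eq_zero] at hz
    rw [map_asymDiag, hz, ← map_ev_one_stretch hr hrt, ← map_relProj, hm]
  obtain ⟨k₀, hk₀, key₀⟩ := key 0 φ fun a => congrArg (fun f => f a) h0
  obtain ⟨k₁, hk₁, key₁⟩ := key 1 ψ fun a => congrArg (fun f => f a) h1
  -- A larger growth function stays adapted, so the maximum handles the homotopy itself and both of
  -- its ends.
  let r' : NNReal → NNReal := fun t => max (r t) (max (k₀ t) (k₁ t))
  have hr' : Continuous r' := hr.max (hk₀.max hk₁)
  have hrt' : ∀ t, t ≤ r' t := fun t => (hrt t).trans (le_max_left _ _)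
  obtain ⟨Ψ, hΨ⟩ := hρ (asymDiag (H.obj (cyl B)) hr') fun f hf =>
    asymDiag_eq_zero hr' ((hrc f hf).mono fun t => le_max_left _ _)
  -- The chain runs from φ to its reparametrization by r', along the restricted homotopy Ψ to the
  -- reparametrization of ψ, and back to ψ.
  refine (fHomotopic_stretch X₀ hH hr' φ).trans (FHomotopic.trans ?_
    (fHomotopic_stretch X₀ hH hr' ψ).symm)
  have ext_dense : ∀ {f g : A →⋆ₙₐ[ℂ] (relRoeFunctor X₀).obj (asymFunctor.obj (H.obj B))},
      (∀ a ∈ d, f a = g a) → f = g := fun {f g} hfg =>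
    NonUnitalStarAlgHom.ext fun a => congrFun
      (Continuous.ext_on hdd (starHom_continuous f) (starHom_continuous g) hfg) a
  refine ⟨Ψ, ext_dense fun a ha => ?_, ext_dense fun a ha => ?_⟩
  · change (relRoeFunctor X₀).map (asymFunctor.map (H.map (ev B 0))) (Ψ a) = _
    rw [← hΨ, map_relProj]
    exact key₀ hr' hrt' (fun t => (le_max_left _ _).trans (le_max_right _ _)) a ha
  · change (relRoeFunctor X₀).map (asymFunctor.map (H.map (ev B 1))) (Ψ a) = _
    rw [← hΨ, map_relProj]
    exact key₁ hr' hrt' (fun t => (le_max_right _ _).trans (le_max_right _ _)) a ha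

variable (A B)

/-- The two preceding results apply with H = 𝔄ⁿ𝕂. One copy of 𝔄 has to remain as target of the
restriction to a graph, so the argument starts at stage 1, not at stage 0. -/
theorem transition_bijective (n : ℕ) : Function.Bijective (transition A B X₀ (n + 1)) := by
  have hH : HasExchange ((asymIter n).comp compactFunctor) :=
    (HasExchange.asymIter n).comp HasExchange.compact
  constructor
  · intro x y h
    induction x using HomotopyClass.ind with | _ φ
    induction y using HomotopyClass.ind with | _ ψ
    exact HomotopyClass.sound (fHomotopic_of_asymUnit X₀ hH (Quotient.exact h))
  · intro y
    induction y using HomotopyClass.ind with | _ φ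
    obtain ⟨ψ, hψ⟩ := exists_fHomotopic_asymUnit X₀ hH φ
    exact ⟨HomotopyClass.mk ψ, HomotopyClass.sound (FHomotopic.symm hψ)⟩

end Reparametrization

/-! ### Sequential colimits along bijections. -/

section Colimit

variable {G : ℕ → Type u} [∀ i, AddCommMonoid (G i)] {f : ∀ i, G i →+ G (i + 1)}

theorem seqMap_bijective (hf : ∀ i, Function.Bijective (f i)) (i j : ℕ) (h : i ≤ j) :
    Function.Bijective (seqMap G f i j h) := by
  induction j, h using Nat.le_induction with
  | base => rw [seqMap_self]; exact Function.bijective_id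
  | succ j h ih => rw [seqMap_succ _ _ _ _ h]; exact (hf j).comp ih

/-- Equality in the colimit is witnessed at a later stage, where injectivity of the composite
applies. An element of stage j is pushed to stage max(i, j) and pulled back to stage i there. -/
theorem SeqColimit.of_bijective (hf : ∀ i, Function.Bijective (f i)) (i : ℕ) :
    Function.Bijective (SeqColimit.of G f i) := by
  constructor
  · intro x y h
    obtain ⟨k, hk, hk', e⟩ := Quotient.exact h
    exact (seqMap_bijective hf i k hk).1 e
  · intro z
    obtain ⟨⟨j, y⟩, rfl⟩ := Quotient.exists_rep z
    obtain ⟨x, hx⟩ := (seqMap_bijective hf i (max i j) (le_max_left _ _)).2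
      (seqMap G f j (max i j) (le_max_right _ _) y)
    exact ⟨x, Quotient.sound ⟨max i j, le_max_left _ _, le_max_right _ _, hx⟩⟩

theorem SeqColimit.of_add (i : ℕ) (x y : G i) :
    SeqColimit.of G f i (x + y) = SeqColimit.of G f i x + SeqColimit.of G f i y :=
  (DirectLimit.add_def i x y).symm

end Colimit

end RoeAsym

end

theorem theorem4p1 (A B : RoeAsym.CStarAlg.{u}) [TopologicalSpace.SeparableSpace A]
    (X : Type u) [MetricSpace X] [RoeAsym.BoundedGeometry X] (X₀ : Set X) :
    (∀ n : ℕ, 1 ≤ n → Function.Bijective (RoeAsym.transition A B X₀ n)) ∧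
    ∃ e : RoeAsym.RoeClass A B X₀ 1 ≃+ RoeAsym.RoeColimit A B X₀,
      ∀ x, e x = RoeAsym.toColimit A B X₀ x := by
  refine ⟨fun n hn => ?_, ?_⟩
  · obtain ⟨m, rfl⟩ := Nat.exists_eq_add_of_le' hn
    exact RoeAsym.transition_bijective X₀ A B m
  -- The sequence is indexed from 0, with term i equal to the class monoid of stage i + 1; stage 1
  -- is its initial term.
  · exact ⟨AddEquiv.mk' (Equiv.ofBijective (RoeAsym.toColimit A B X₀)
      (RoeAsym.SeqColimit.of_bijective (G := fun i => RoeAsym.RoeClass A B X₀ (i + 1))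
        (f := fun i => RoeAsym.transition A B X₀ (i + 1))
        (fun i => RoeAsym.transition_bijective X₀ A B i) 0))
      (fun x y => RoeAsym.SeqColimit.of_add (G := fun i => RoeAsym.RoeClass A B X₀ (i + 1))
        (f := fun i => RoeAsym.transition A B X₀ (i + 1)) 0 x y), fun _ => rfl⟩
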